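/- Let $K$ be a field, let $S=K[X_1,\ldots,X_m,Y_1,\ldots,Y_n]$ with its natural $\mathbb Z^m\times\mathbb Z^n$-bigrading, and let $I\subseteq S$ be an ideal generated by squarefree monomials. Let $R=S/I=K[\Delta]$, where $\Delta$ is the simplicial complex on the vertex set $V\sqcup W$, $V=\{v_1,\ldots,v_m\}$, $W=\{w_1,\ldots,w_n\}$, whose faces are the sets of vertices for which the product of the corresponding variables $X_i$ (for $v_i$) and $Y_j$ (for $w_j$) does not lie in $I$. Let $y_j$ be the residue class of $Y_j$ in $R$, and let $P=(y_1,\ldots,y_n)\subseteq R$. For $A\subseteq V\sqcup W$ let $\operatorname{lk}A=\{B : A\cap B=\emptyset,\ A\cup B\in\Delta\}$ (which has no face at all if $A\notin\Delta$), and for a complex $\Gamma$ on $V\sqcup W$ let $\Gamma_W$ be the complex of the faces of $\Gamma$ contained in $W$. For every $i\ge 0$ the local cohomology module $H^i_P(R)=\varinjlim_t\operatorname{Ext}^i_R(R/P^t,R)$ is isomorphic, as an $R$-module, to the $i$-th cohomology of the Čech complex of $R$ with respect to $y_1,\ldots,y_n$, whose terms $\bigoplus_{j_1<\cdots<j_t}R_{y_{j_1}\cdots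 y_{j_t}}$ have their natural $\mathbb Z^m\times\mathbb Z^n$-bigrading. With the bigrading that $H^i_P(R)$ receives in this way, $H^i_P(R)=\bigoplus_{(a,b)\in\mathbb Z^m\times\mathbb Z^n}H^i_P(R)_{(a,b)}$, every component has finite dimension over $K$, the component of bidegree $(a,b)$ is zero unless all $a_k\ge 0$ and all $b_j\le 0$, and its bigraded Hilbert series is $$\sum_{(a,b)\in\mathbb Z^m\times\mathbb Z^n}\dim_K H^i_P(K[\Delta])_{(a,b)}\,\mathbf s^a\mathbf t^b=\sum_{F\in\Delta_W}\ \sum_{G\subseteq V}\dim_K\widetilde H_{i-|F|-1}\bigl((\operatorname{lk}(F\cup G))_W;K\bigr)\prod_{v_k\in G}\frac{s_k}{1-s_k}\prod_{w_j\in F}\frac{t_j^{-1}}{1-t_j^{-1}}$$ as formal power series in $s_1,\ldots,s_m,t_1^{-1},\ldots,t_n^{-1}$. Here $\widetilde H_j(\Gamma;K)$ is the reduced simplicial homology with coefficients in $K$, for $j\in\mathbb Z$; it is zero for $j<-1$ and for the complex without faces, and $\widetilde H_{-1}(\{\emptyset\};K)=K$. -/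

import Mathlib

universe u

noncomputable section

/-! ### Simplicial complexes

A simplicial complex on the vertex set `V` is a lower set of finite subsets of `V`.  Faces may be
empty, so that the void complex (no face at all) and the complex whose only face is `∅` are
different; the vertices of `V` are not required to be faces. -/

namespace SimplicialCpx

variable {V : Type*} [DecidableEq V]

/-- The link of `A`: all `B` disjoint from `A` with `A ∪ B ∈ Δ`.  It is void if `A ∉ Δ`. -/
def link (Δ : LowerSet (Finset V)) (A : Finset V) : LowerSet (Finset V) where
  carrier := {B | Disjoint A B ∧ A ∪ B ∈ Δ}
  lower' := fun _ _ hle h =>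
    ⟨h.1.mono_right hle, Δ.lower (Finset.union_subset_union_right hle) h.2⟩

/-- For a vertex set `V ⊔ W`, the restriction of `Δ` to `W`: all faces with vertices in `W`. -/
def restrictRight {V W : Type*} (Δ : LowerSet (Finset (V ⊕ W))) : LowerSet (Finset W) where
  carrier := {B | B.map Function.Embedding.inr ∈ Δ}
  lower' := fun _ _ hle h => Δ.lower (Finset.map_subset_map.2 hle) h

open Classical in
/-- The finite set of faces of a complex on a finite vertex set. -/
def faces {W : Type*} [Fintype W] (Γ : LowerSet (Finset W)) : Finset (Finset W) :=
  Finset.univ.filter (fun B => B ∈ Γ)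

section Homology

variable (K : Type u) [Field K] {W : Type} [LinearOrder W] [Fintype W] (Γ : LowerSet (Finset W))

/-- The faces of dimension `j`, that is, with `j + 1` vertices (`∅` has dimension `-1`). -/
def Face (j : ℤ) : Type := {B : Finset W // B ∈ Γ ∧ (B.card : ℤ) = j + 1}

instance (j : ℤ) : Finite (Face Γ j) :=
  inferInstanceAs (Finite {B : Finset W // B ∈ Γ ∧ (B.card : ℤ) = j + 1})

instance (j : ℤ) : Fintype (Face Γ j) := Fintype.ofFinite _

/-- The `j`-chains of the augmented oriented chain complex with coefficients in `K`: the vector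
space with basis the faces of dimension `j`, where `c` stands for the sum of the `c B • [B]`. -/
abbrev Chain (j : ℤ) : Type u := Face Γ j → K

/-- The facet of a face obtained by leaving out the vertex `v`. -/
def Face.erase {Γ : LowerSet (Finset W)} {j k : ℤ} (h : k + 1 = j) (B : Face Γ j)
    (v : W) (hv : v ∈ B.1) : Face Γ k :=
  ⟨B.1.erase v, Γ.lower (Finset.erase_subset v B.1) B.2.1, by
    have h1 := Finset.card_erase_add_one hv
    have h2 := B.2.2
    omega⟩

open Classical in
/-- The boundary map: `[w₀, …, w_j] ↦ ∑ₛ (-1)ˢ [w₀, …, ŵₛ, …, w_j]` for `w₀ < ⋯ < w_j`. -/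
def boundary (j k : ℤ) (h : k + 1 = j) : Chain K Γ j →ₗ[K] Chain K Γ k :=
  Fintype.linearCombination K fun B : Face Γ j =>
    ∑ v ∈ B.1.attach, Pi.single (B.erase h v.1 v.2)
      ((-1 : K) ^ (B.1.filter (fun w => w < v.1)).card)

/-- The `j`-cycles. -/
def cycles (j : ℤ) : Submodule K (Chain K Γ j) :=
  LinearMap.ker (boundary K Γ j (j - 1) (sub_add_cancel j 1))

/-- The `j`-boundaries. -/
def boundaries (j : ℤ) : Submodule K (Chain K Γ j) :=
  LinearMap.range (boundary K Γ (j + 1) j rfl)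

/-- The reduced simplicial homology `H̃_j(Γ; K)`, for every integer `j`. -/
abbrev ReducedHomology (j : ℤ) : Type u :=
  cycles K Γ j ⧸ (boundaries K Γ j).submoduleOf (cycles K Γ j)

end Homology

end SimplicialCpx

/-! ### The Čech complex of a finite sequence of elements of a ring -/

namespace Cech

variable {R : Type u} [CommRing R] {n : ℕ} (y : Fin n → R)

/-- The localization of `R` at the product of the `y j`, `j ∈ T`. -/
abbrev Loc (T : Finset (Fin n)) : Type u := Localization.Away (∏ j ∈ T, y j)

lemma isUnit_algebraMap_of_subset {T T' : Finset (Fin n)} (h : T ⊆ T') :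
    IsUnit (algebraMap R (Loc y T') (∏ j ∈ T, y j)) :=
  isUnit_of_dvd_unit (map_dvd _ (Finset.prod_dvd_prod_of_subset T T' y h))
    (IsLocalization.Away.algebraMap_isUnit (S := Loc y T') (∏ j ∈ T', y j))

/-- The natural map between localizations. -/
def nat {T T' : Finset (Fin n)} (h : T ⊆ T') : Loc y T →ₐ[R] Loc y T' :=
  IsLocalization.Away.liftAlgHom (∏ j ∈ T, y j) (f := Algebra.ofId R (Loc y T'))
    (isUnit_algebraMap_of_subset y h)

/-- The subsets of `{1, …, n}` with `t` elements. -/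
abbrev Idx (n t : ℕ) : Type := {T : Finset (Fin n) // T.card = t}

/-- The module `C^t`, the direct sum of the localizations of `R` at the products of `t` of the
elements `y j`. -/
abbrev Cochain (t : ℕ) : Type u := (T : Idx n t) → Loc y T.1

/-- Leaving out one element of an index set. -/
def Idx.erase {t : ℕ} (T : Idx n (t + 1)) (j : Fin n) (hj : j ∈ T.1) : Idx n t :=
  ⟨T.1.erase j, by rw [Finset.card_erase_of_mem hj, T.2]; rfl⟩

/-- The differential `C^t → C^(t+1)`. -/
def d (t : ℕ) : Cochain y t →ₗ[R] Cochain y (t + 1) :=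
  LinearMap.pi fun T => ∑ j ∈ T.1.attach,
    ((-1 : R) ^ (T.1.filter (fun k => k < j.1)).card) •
      ((nat y (Finset.erase_subset j.1 T.1)).toLinearMap ∘ₗ
        LinearMap.proj (R := R) (φ := fun S : Idx n t => Loc y S.1) (T.erase j.1 j.2))

/-- The cocycles in `C^t`. -/
def cocycles (t : ℕ) : Submodule R (Cochain y t) :=
  LinearMap.ker (d y t)

/-- The coboundaries in `C^t`. -/
def coboundaries : (t : ℕ) → Submodule R (Cochain y t)
  | 0 => ⊥
  | t + 1 => LinearMap.range (d y t)

/-- The cohomology `H^t(C)` of the Čech complex. -/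
abbrev Cohomology (t : ℕ) : Type u :=
  cocycles y t ⧸ (coboundaries y t).submoduleOf (cocycles y t)

end Cech

/-! ### Stanley–Reisner rings and their bigraded local cohomology -/

namespace StanleyReisner

open MvPolynomial

variable {K : Type u} [Field K] {m n : ℕ}

/-- The variables: `X (Sum.inl i)` is `Xᵢ` and `X (Sum.inr j)` is `Y_j`. -/
abbrev PolyRing (K : Type u) [Field K] (m n : ℕ) : Type u := MvPolynomial (Fin m ⊕ Fin n) K

/-- Ideals generated by squarefree monomials. -/
def IsSquarefreeMonomialIdeal (I : Ideal (PolyRing K m n)) : Prop :=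
  ∃ A : Set (Finset (Fin m ⊕ Fin n)),
    I = Ideal.span ((fun B : Finset (Fin m ⊕ Fin n) => ∏ v ∈ B, (X v : PolyRing K m n)) '' A)

/-- The simplicial complex corresponding to `I`: its faces are the sets of vertices whose product
of variables is not in `I`. -/
def complex (I : Ideal (PolyRing K m n)) : LowerSet (Finset (Fin m ⊕ Fin n)) where
  carrier := {B | ∏ v ∈ B, (X v : PolyRing K m n) ∉ I}
  lower' := fun B C hle h hC =>
    h (I.mem_of_dvd (Finset.prod_dvd_prod_of_subset C B _ hle) hC)

/-- The ring `R = S / I`. -/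
abbrev Quot (I : Ideal (PolyRing K m n)) : Type u := PolyRing K m n ⧸ I

variable (I : Ideal (PolyRing K m n))

/-- The residue class `y_j` of `Y_j`. -/
def y (j : Fin n) : Quot I := Ideal.Quotient.mk I (X (Sum.inr j))

/-- The ideal `P = (y_1, …, y_n)`. -/
def P : Ideal (Quot I) := Ideal.span (Set.range (y I))

/-- The local cohomology module `H^i_P(R)`, as an `R`-module and as a `K`-vector space. -/
def LocalCohomology (i : ℕ) : Type u :=
  (localCohomology (P I) i).obj (ModuleCat.of (Quot I) (Quot I))

instance (i : ℕ) : AddCommGroup (LocalCohomology I i) :=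
  inferInstanceAs (AddCommGroup ((localCohomology (P I) i).obj (ModuleCat.of (Quot I) (Quot I))))

instance (i : ℕ) : Module (Quot I) (LocalCohomology I i) :=
  inferInstanceAs
    (Module (Quot I) ((localCohomology (P I) i).obj (ModuleCat.of (Quot I) (Quot I))))

instance (i : ℕ) : Module K (LocalCohomology I i) :=
  Module.compHom _ (algebraMap K (Quot I))

instance (i : ℕ) : IsScalarTower K (Quot I) (LocalCohomology I i) :=
  ⟨fun k r x => by
    have h : k • r = algebraMap K (Quot I) k * r := Algebra.smul_def k r
    exact (congrArg (· • x) h).trans (mul_smul _ r x)⟩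

/-- The bidegrees `(a, b)` with `a ∈ ℤ^m` and `b ∈ ℤ^n`. -/
abbrev Bidegree (m n : ℕ) : Type := (Fin m → ℤ) × (Fin n → ℤ)

/-- The component of bidegree `(a, b)` of the localization of `R` at `y_T = ∏_{j ∈ T} y_j`:
the fractions `r / y_T ^ l` with `r` bihomogeneous and `deg r - l • deg y_T = (a, b)`. -/
def locPiece (T : Finset (Fin n)) (c : Bidegree m n) : Submodule K (Cech.Loc (y I) T) :=
  Submodule.span K {z | ∃ (e : (Fin m ⊕ Fin n) →₀ ℕ) (k : K) (l : ℕ),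
    (∀ i, (e (Sum.inl i) : ℤ) = c.1 i) ∧
    (∀ j, (e (Sum.inr j) : ℤ) - (if j ∈ T then (l : ℤ) else 0) = c.2 j) ∧
    z = Localization.mk (Ideal.Quotient.mk I (monomial e k))
      (⟨(∏ j ∈ T, y I j) ^ l, l, rfl⟩ : Submonoid.powers (∏ j ∈ T, y I j))}

/-- The component of bidegree `c` of the `t`-th cohomology of the Čech complex: the classes of the
cocycles all of whose entries have bidegree `c`. -/
def cechPiece (t : ℕ) (c : Bidegree m n) : Submodule K (Cech.Cohomology (y I) t) :=
  ((Submodule.pi Set.univ fun T : Cech.Idx n t => locPiece I T.1 c).comap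
      ((Cech.cocycles (y I) t).subtype.restrictScalars K)).map
    ((Submodule.mkQ ((Cech.coboundaries (y I) t).submoduleOf
      (Cech.cocycles (y I) t))).restrictScalars K)

/-- The component of bidegree `c` of the local cohomology module `H^i_P(R)`, with the bigrading
transported from the Čech complex along an isomorphism. -/
def piece {i : ℕ} (φ : LocalCohomology I i ≃ₗ[Quot I] Cech.Cohomology (y I) i)
    (c : Bidegree m n) : Submodule K (LocalCohomology I i) :=
  (cechPiece I i c).comap (φ.toLinearMap.restrictScalars K)

/-- The series `∑ dim_K M_(a,b) s^a t^b` of a bigraded vector space `M` that lives in bidegrees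
`(a, b)` with `a ≥ 0` and `b ≤ 0` only, as a formal power series in the variables
`s_i = X (Sum.inl i)` and `t_j⁻¹ = X (Sum.inr j)`. -/
def hilbertSeries {M : Type*} [AddCommGroup M] [Module K M] (H : Bidegree m n → Submodule K M) :
    MvPowerSeries (Fin m ⊕ Fin n) ℚ :=
  fun e => (Module.finrank K
    (H (fun i => (e (Sum.inl i) : ℤ), fun j => -(e (Sum.inr j) : ℤ))) : ℚ)

end StanleyReisner

end

/-!
The proof has two independent parts: the comparison of `H^i_P(R)` with the Čech complex, which holds
over every noetherian ring, and the computation of the components of the Čech cohomology of a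
Stanley–Reisner ring.

*Comparison.* By dimension shifting along `0 → M → E → E/M → 0` with `E` injective, a sequence
of functions `H^i` on modules is determined up to isomorphism by three properties, collected in
`IsGammaTheory`: `H^0` is the module of elements killed by powers of all `y_j`, `H^1(M)` is the
cokernel of `H^0(E) → H^0(E/M)`, and `H^{i+2}(M)` is isomorphic to `H^{i+1}(E/M)`; see
`IsGammaTheory.nonempty_linearEquiv`. Local cohomology has these properties because filtered
colimits are exact and `Ext^i(R/P^t, -)` has connecting homomorphisms that are natural in the first
argument. Since Mathlib defines `Ext` by deriving the functors `Hom(-, M)` in the first variable,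
these are obtained in `LeftDerived` from short exact sequences of functors on projective modules.
For Čech cohomology the point is that it vanishes on an injective module `E` in positive degrees
(`CechSystem.isZero_cech_homology_of_injective`). This follows by splitting off the `a`-power
torsion of `E`, `a = y_j`: the torsion part is again injective by the Artin–Rees lemma, and on the
quotient `a` acts bijectively, so that the Čech complex is contractible
(`CechSystem.exists_totalD_eq`).

*Components.* The component of bidegree `c` of `R_{y_T}` is spanned by a single fraction
`mon I T c`, which is nonzero exactly if the support of `c` together with `T` is a face and `c` is
nonnegative outside `T` (`Adm`); that it is nonzero is seen by mapping `R_{y_T}` to the Laurent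
polynomials after setting the variables outside that face to zero. The transition maps send
`mon I T c` to `mon I T' c`. If some `Y`-coordinate `j` of `c` is positive, then adding `j` to `T`
does not change whether the fraction vanishes, and the component of the Čech complex is contractible;
if some `X`-coordinate is negative, it is zero. In the remaining case `c = (a, b)` with `a ≥ 0`,
`b ≤ 0`, let `G` and `F` be the supports of `a` and `b`. The sets `T` with a nonzero fraction are the
`F ∪ B` with `B` a face of `(lk (F ∪ G))_W`, so that, after a change of signs, the component of the
Čech complex is the reduced simplicial cochain complex of this link, shifted by `|F| + 1`
(`StanleyReisner.toChain_cechD`). As the coboundary map is the transpose of the boundary map, its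
cohomology has the dimension of the homology (`StanleyReisner.finrank_cechPiece`). The dimension
depends on `G` and `F` only, and the product of the series `x / (1 - x)` over a set of variables
collects the monomials whose support is that set, which gives the Hilbert series.
-/

/-! ### Čech complexes of systems indexed by finite sets -/

noncomputable section
open CategoryTheory Limits

namespace CechSystem

variable {R : Type u} [CommRing R] {n : ℕ}

/-- The sign `(-1)^s` where `s` is the position of `j` in `T`. -/
def sgn (R : Type u) [CommRing R] {n : ℕ} (j : Fin n) (T : Finset (Fin n)) : R :=
  (-1) ^ (T.filter (fun k => k < j)).card

lemma sgn_mul_self (j : Fin n) (T : Finset (Fin n)) : sgn R j T * sgn R j T = 1 := by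
  rw [sgn, ← mul_pow]; simp

lemma sgn_erase_of_lt {j k : Fin n} {T : Finset (Fin n)} (h : j < k) :
    sgn R j (T.erase k) = sgn R j T := by
  unfold sgn
  congr 2
  ext x
  simp only [Finset.mem_filter, Finset.mem_erase]
  constructor
  · rintro ⟨⟨_, h2⟩, h3⟩; exact ⟨h2, h3⟩
  · rintro ⟨h2, h3⟩; exact ⟨⟨(h3.trans h).ne, h2⟩, h3⟩

lemma sgn_erase_of_gt {j k : Fin n} {T : Finset (Fin n)} (h : k < j) (hk : k ∈ T) :
    sgn R j T = - sgn R j (T.erase k) := by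
  unfold sgn
  have : T.filter (fun x => x < j) = insert k ((T.erase k).filter (fun x => x < j)) := by
    ext x
    simp only [Finset.mem_filter, Finset.mem_erase, Finset.mem_insert]
    constructor
    · rintro ⟨h1, h2⟩
      by_cases hx : x = k
      · exact Or.inl hx
      · exact Or.inr ⟨⟨hx, h1⟩, h2⟩
    · rintro (rfl | ⟨⟨_, h1⟩, h2⟩)
      · exact ⟨hk, h⟩
      · exact ⟨h1, h2⟩
  rw [this, Finset.card_insert_of_notMem (by simp), pow_succ]
  ring

/-- Removing two elements in the two possible orders gives opposite signs. -/
lemma sgn_swap {j k : Fin n} {T : Finset (Fin n)} (hne : j ≠ k) (hj : j ∈ T) (hk : k ∈ T) :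
    sgn R j T * sgn R k (T.erase j) = -(sgn R k T * sgn R j (T.erase k)) := by
  rcases lt_or_gt_of_ne hne with h | h
  · rw [sgn_erase_of_lt h, sgn_erase_of_gt h hj]; ring
  · rw [sgn_erase_of_lt h, sgn_erase_of_gt h hk]; ring

variable (A B : Finset (Fin n) ⥤ ModuleCat.{u} R)

/-- The restriction map of the system `A`. -/
abbrev res {S T : Finset (Fin n)} (h : S ⊆ T) : A.obj S →ₗ[R] A.obj T :=
  (A.map (homOfLE h)).hom

variable {A B} in
lemma res_res {S T U : Finset (Fin n)} (h : S ⊆ T) (h' : T ⊆ U) (x : A.obj S) :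
    res A h' (res A h x) = res A (h.trans h') x := by
  have := A.map_comp (homOfLE h) (homOfLE h')
  exact (congrArg (fun f => f.hom x) this).symm

variable {A B} in
lemma res_refl {S : Finset (Fin n)} (h : S ⊆ S) (x : A.obj S) : res A h x = x := by
  have := A.map_id S
  exact congrArg (fun f => f.hom x) this

/-- The value of `f` at `S`, mapped to `A T` if `S ⊆ T`. It allows to compare the values at
two sets that are only propositionally equal. -/
def push (T S : Finset (Fin n)) : (∀ U, A.obj U) →ₗ[R] A.obj T :=
  if h : S ⊆ T then res A h ∘ₗ LinearMap.proj S else 0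

variable {A} in
lemma push_of_subset {T S : Finset (Fin n)} (h : S ⊆ T) (f : ∀ U, A.obj U) :
    push A T S f = res A h (f S) := by
  simp [push, h]

variable {A} in
lemma res_push {T S U : Finset (Fin n)} (h : S ⊆ T) (h' : T ⊆ U) (f : ∀ U, A.obj U) :
    res A h' (push A T S f) = push A U S f := by
  rw [push_of_subset h, push_of_subset (h.trans h'), res_res]

/-- The differential on families indexed by all subsets of `Fin n`. -/
def totalD : (∀ U, A.obj U) →ₗ[R] (∀ U, A.obj U) :=
  LinearMap.pi fun T => ∑ j ∈ T, sgn R j T • push A T (T.erase j)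

variable {A} in
lemma totalD_apply (f : ∀ U, A.obj U) (T : Finset (Fin n)) :
    totalD A f T = ∑ j ∈ T, sgn R j T • push A T (T.erase j) f := by
  simp [totalD]

variable {A} in
lemma totalD_totalD (f : ∀ U, A.obj U) : totalD A (totalD A f) = 0 := by
  funext T
  have h1 : ∀ j ∈ T, sgn R j T • push A T (T.erase j) (totalD A f) =
      ∑ k ∈ T.erase j, (sgn R j T * sgn R k (T.erase j)) • push A T ((T.erase j).erase k) f := by
    intro j hj
    rw [push_of_subset (Finset.erase_subset j T), totalD_apply, map_sum, Finset.smul_sum]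
    refine Finset.sum_congr rfl fun k hk => ?_
    rw [map_smul, res_push (Finset.erase_subset _ _), smul_smul]
  rw [totalD_apply, Finset.sum_congr rfl h1, Finset.sum_sigma', Pi.zero_apply]
  refine Finset.sum_involution (fun p _ => ⟨p.2, p.1⟩) ?_ ?_ ?_ ?_
  · rintro ⟨j, k⟩ hp
    simp only [Finset.mem_sigma, Finset.mem_erase] at hp
    obtain ⟨hj, hkj, hk⟩ := hp
    simp only
    rw [sgn_swap (Ne.symm hkj) hj hk, Finset.erase_right_comm (a := k), neg_smul,
      neg_add_cancel]
  · rintro ⟨j, k⟩ hp _ heq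
    simp only [Finset.mem_sigma, Finset.mem_erase] at hp
    simp only [Sigma.mk.injEq, heq_eq_eq] at heq
    exact hp.2.1 heq.1
  · rintro ⟨j, k⟩ hp
    simp only [Finset.mem_sigma, Finset.mem_erase] at hp ⊢
    exact ⟨hp.2.2, Ne.symm hp.2.1, hp.1⟩
  · rintro ⟨j, k⟩ hp; rfl

variable {A} in
/-- If all maps `A T → A (T ∪ {j})` are bijective, then the total complex is contractible. -/
lemma exists_totalD_eq (j : Fin n)
    (hA : ∀ T, Function.Bijective (res A (Finset.subset_insert j T)))
    (z : ∀ U, A.obj U) (hz : totalD A z = 0) :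
    ∃ w : ∀ U, A.obj U, totalD A w = z ∧
      (∀ T, j ∈ T → w T = 0) ∧ ∀ T, z (insert j T) = 0 → w T = 0 := by
  classical
  choose g hg using fun T => (hA T).2
  -- the contracting homotopy inserts `j` and goes back along `A T → A (T ∪ {j})`
  have hg0 : ∀ T, g T 0 = 0 := fun T => (hA T).1 (by rw [hg, map_zero])
  let w : ∀ U, A.obj U := fun T => if j ∈ T then 0 else sgn R j (insert j T) • g T (z (insert j T))
  have hw1 : ∀ T, j ∈ T → w T = 0 := fun T h => by simp [w, h]
  have hw2 : ∀ T, j ∉ T → res A (Finset.subset_insert j T) (w T) =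
      sgn R j (insert j T) • z (insert j T) := fun T h => by
    simp only [w, h, if_false, map_smul, hg]
  refine ⟨w, ?_, hw1, fun T h => ?_⟩
  · funext T
    by_cases hT : j ∈ T
    · rw [totalD_apply, ← Finset.add_sum_erase _ _ hT]
      have hins : insert j (T.erase j) = T := Finset.insert_erase hT
      have e1 : push A T (T.erase j) w = push A T (insert j (T.erase j))
          (fun U => sgn R j U • z U) := by
        have hsub : insert j (T.erase j) ⊆ T := hins.le
        rw [push_of_subset hsub, ← hw2 _ (Finset.notMem_erase j T), res_res,
          push_of_subset (Finset.erase_subset _ _)]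
      rw [e1, hins, push_of_subset subset_rfl, res_refl, smul_smul, sgn_mul_self, one_smul,
        Finset.sum_eq_zero, add_zero]
      intro k hk
      rw [push_of_subset (Finset.erase_subset _ _), hw1, map_zero, smul_zero]
      rw [Finset.mem_erase] at hk ⊢
      exact ⟨hk.1.symm, hT⟩
    · apply (hA T).1
      have hz' : totalD A z (insert j T) = 0 := by rw [hz]; rfl
      rw [totalD_apply, Finset.sum_insert hT, Finset.erase_insert hT,
        push_of_subset (Finset.subset_insert j T)] at hz'
      rw [totalD_apply, map_sum]
      have key : sgn R j (insert j T) • ∑ k ∈ T, res A (Finset.subset_insert j T)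
          (sgn R k T • push A T (T.erase k) w) =
          - ∑ k ∈ T, sgn R k (insert j T) • push A (insert j T) ((insert j T).erase k) z := by
        rw [Finset.smul_sum, ← Finset.sum_neg_distrib]
        refine Finset.sum_congr rfl fun k hk => ?_
        have hkj : k ≠ j := fun h => hT (h ▸ hk)
        have hj' : j ∉ T.erase k := fun h => hT (Finset.mem_of_mem_erase h)
        have hsub : insert j (T.erase k) ⊆ insert j T :=
          Finset.insert_subset_insert _ (Finset.erase_subset _ _)
        have e2 : push A (insert j T) (T.erase k) w =
            sgn R j (insert j (T.erase k)) • push A (insert j T) (insert j (T.erase k)) z := by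
          rw [push_of_subset ((Finset.erase_subset _ _).trans (Finset.subset_insert j T)),
            push_of_subset hsub, ← map_smul, ← hw2 _ hj', res_res]
        rw [map_smul, res_push (Finset.erase_subset _ _), e2, Finset.erase_insert_of_ne hkj.symm,
          smul_smul, smul_smul, ← neg_smul]
        congr 1
        have h3 := sgn_swap (R := R) hkj (Finset.mem_insert_of_mem hk)
          (Finset.mem_insert_self j T)
        rw [Finset.erase_insert_of_ne hkj.symm, Finset.erase_insert hT] at h3
        have h4 : sgn R k (insert j T) =
            -(sgn R j (insert j T) * sgn R k T) * sgn R j (insert j (T.erase k)) := by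
          rw [← h3, mul_assoc, sgn_mul_self, mul_one]
        rw [h4]; ring
      have h5 := eq_neg_of_add_eq_zero_left hz'
      rw [← h5] at key
      have h6 := congrArg (fun x => sgn R j (insert j T) • x) key
      simpa only [smul_smul, sgn_mul_self, one_smul] using h6
  · by_cases hT : j ∈ T
    · exact hw1 T hT
    · simp only [w, hT, if_false, h, hg0, smul_zero]

/-! ### Cochains of a fixed degree -/

/-- The cochains of degree `t`. -/
abbrev Cochain (t : ℕ) : Type u := (T : Cech.Idx n t) → A.obj T.1

/-- The differential of the Čech complex of the system `A`. -/
def d (t : ℕ) : Cochain A t →ₗ[R] Cochain A (t + 1) :=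
  LinearMap.pi fun T => ∑ j ∈ T.1.attach,
    ((-1 : R) ^ (T.1.filter (fun k => k < j.1)).card) •
      (res A (Finset.erase_subset j.1 T.1) ∘ₗ
        LinearMap.proj (R := R) (φ := fun S : Cech.Idx n t => A.obj S.1) (T.erase j.1 j.2))

/-- Extension by zero of a cochain of degree `t` to a family indexed by all subsets. -/
def ext (t : ℕ) : Cochain A t →ₗ[R] (∀ U, A.obj U) :=
  LinearMap.pi fun T => if h : T.card = t then
    LinearMap.proj (R := R) (φ := fun S : Cech.Idx n t => A.obj S.1) ⟨T, h⟩ else 0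

variable {A}

lemma ext_of_card {t : ℕ} (z : Cochain A t) {T : Finset (Fin n)} (h : T.card = t) :
    ext A t z T = z ⟨T, h⟩ := by
  simp [ext, h]

lemma ext_of_card_ne {t : ℕ} (z : Cochain A t) {T : Finset (Fin n)} (h : T.card ≠ t) :
    ext A t z T = 0 := by
  simp [ext, h]

lemma ext_injective (t : ℕ) : Function.Injective (ext A t) := by
  intro z z' h
  funext T
  rw [← ext_of_card z T.2, ← ext_of_card z' T.2, h]

lemma d_apply {t : ℕ} (z : Cochain A t) (T : Cech.Idx n (t + 1)) :
    d A t z T = ∑ j ∈ T.1.attach, sgn R j.1 T.1 •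
      res A (Finset.erase_subset j.1 T.1) (z (T.erase j.1 j.2)) := by
  simp only [d, LinearMap.pi_apply, LinearMap.sum_apply, LinearMap.smul_apply]
  rfl

lemma totalD_ext {t : ℕ} (z : Cochain A t) : totalD A (ext A t z) = ext A (t + 1) (d A t z) := by
  funext T
  rw [totalD_apply]
  by_cases h : T.card = t + 1
  · rw [ext_of_card _ h, d_apply, ← Finset.sum_attach]
    refine Finset.sum_congr rfl fun j _ => ?_
    rw [push_of_subset (Finset.erase_subset _ _), ext_of_card]
    rfl
  · rw [ext_of_card_ne _ h]
    refine Finset.sum_eq_zero fun j hj => ?_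
    rw [push_of_subset (Finset.erase_subset _ _), ext_of_card_ne, map_zero, smul_zero]
    have := Finset.card_erase_add_one hj
    omega

lemma d_d {t : ℕ} (z : Cochain A t) : d A (t + 1) (d A t z) = 0 := by
  apply ext_injective
  rw [← totalD_ext, ← totalD_ext, totalD_totalD, map_zero]

/-- If all maps `A T → A (T ∪ {j})` are bijective, then the Čech complex is acyclic in degree
zero. -/
lemma eq_zero_of_bijective (j : Fin n)
    (hA : ∀ T, Function.Bijective (res A (Finset.subset_insert j T)))
    (z : Cochain A 0) (hz : d A 0 z = 0) : z = 0 := by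
  obtain ⟨w, hw, -, hw0⟩ := exists_totalD_eq j hA (ext A 0 z) (by rw [totalD_ext, hz, map_zero])
  have : w = 0 := by
    funext T
    apply hw0
    apply ext_of_card_ne
    simp
  apply ext_injective
  rw [← hw, this, map_zero, map_zero]

/-- If all maps `A T → A (T ∪ {j})` are bijective, then the Čech complex is acyclic in positive
degrees. -/
lemma exists_d_eq_of_bijective (j : Fin n)
    (hA : ∀ T, Function.Bijective (res A (Finset.subset_insert j T)))
    {t : ℕ} (z : Cochain A (t + 1)) (hz : d A (t + 1) z = 0) : ∃ w, d A t w = z := by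
  obtain ⟨w, hw, hwj, hw0⟩ :=
    exists_totalD_eq j hA (ext A (t + 1) z) (by rw [totalD_ext, hz, map_zero])
  refine ⟨fun T => w T.1, ext_injective _ ?_⟩
  rw [← totalD_ext, ← hw]
  congr 1
  funext T
  by_cases h : T.card = t
  · rw [ext_of_card _ h]
  · rw [ext_of_card_ne _ h]
    by_cases hj : j ∈ T
    · exact (hwj T hj).symm
    · refine (hw0 T (ext_of_card_ne _ ?_)).symm
      rw [Finset.card_insert_of_notMem hj]
      omega

end CechSystem
end

/-! ### The Čech complex as a functor -/

noncomputable section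
open CategoryTheory Limits

namespace CechSystem

variable {R : Type u} [CommRing R] {n : ℕ}

/-- The map on cochains induced by a morphism of systems. -/
def cochainMap {A B : Finset (Fin n) ⥤ ModuleCat.{u} R} (α : A ⟶ B) (t : ℕ) :
    Cochain A t →ₗ[R] Cochain B t :=
  LinearMap.pi fun T => (α.app T.1).hom ∘ₗ
    LinearMap.proj (R := R) (φ := fun S : Cech.Idx n t => A.obj S.1) T

lemma d_cochainMap {A B : Finset (Fin n) ⥤ ModuleCat.{u} R} (α : A ⟶ B) (t : ℕ)
    (z : Cochain A t) : d B t (cochainMap α t z) = cochainMap α (t + 1) (d A t z) := by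
  funext T
  change d B t (fun S => (α.app S.1).hom (z S)) T = (α.app T.1).hom (d A t z T)
  rw [d_apply, d_apply, map_sum]
  refine Finset.sum_congr rfl fun j _ => ?_
  rw [map_smul]
  congr 1
  have := α.naturality (homOfLE (Finset.erase_subset j.1 T.1))
  exact (congrArg (fun f => f.hom (z (T.erase j.1 j.2))) this).symm

/-- The Čech complex of a system of modules. -/
def complexObj (A : Finset (Fin n) ⥤ ModuleCat.{u} R) : CochainComplex (ModuleCat.{u} R) ℕ :=
  CochainComplex.of (fun t => ModuleCat.of R (Cochain A t))
    (fun t => ModuleCat.ofHom (d A t))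
    (fun _ => ModuleCat.hom_ext (LinearMap.ext fun z => d_d z))

lemma complexObj_d (A : Finset (Fin n) ⥤ ModuleCat.{u} R) (t : ℕ) :
    (complexObj A).d t (t + 1) = ModuleCat.ofHom (d A t) :=
  CochainComplex.of_d (fun t => ModuleCat.of R (Cochain A t)) (fun t => ModuleCat.ofHom (d A t)) t

/-- The Čech complex of a system of modules, as a functor. -/
def complex : (Finset (Fin n) ⥤ ModuleCat.{u} R) ⥤ CochainComplex (ModuleCat.{u} R) ℕ where
  obj A := complexObj A
  map {A B} α := CochainComplex.ofHom
    (fun t => ModuleCat.ofHom (cochainMap α t))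
    (fun t => by
      rw [complexObj_d, complexObj_d]
      exact ModuleCat.hom_ext (LinearMap.ext fun z => d_cochainMap α t z))
  map_id _ := HomologicalComplex.hom_ext _ _ fun _ => rfl
  map_comp _ _ := HomologicalComplex.hom_ext _ _ fun _ => rfl

lemma complex_obj_d (A : Finset (Fin n) ⥤ ModuleCat.{u} R) (t : ℕ) (z : Cochain A t) :
    ((complex.obj A).d t (t + 1)).hom z = d A t z :=
  congrArg (fun f => f.hom z) (complexObj_d A t)

instance : (complex (R := R) (n := n)).PreservesZeroMorphisms where
  map_zero A B := by
    exact HomologicalComplex.hom_ext _ _ fun _ => rfl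

/-- The Čech complex is exact in the system. -/
lemma complex_shortExact {S : ShortComplex (Finset (Fin n) ⥤ ModuleCat.{u} R)}
    (hS : ∀ T, (S.map ((evaluation _ _).obj T)).ShortExact) :
    (S.map complex).ShortExact := by
  apply HomologicalComplex.shortExact_of_degreewise_shortExact
  intro t
  have hinj : ∀ T, Function.Injective (S.f.app T).hom := fun T =>
    (ModuleCat.mono_iff_injective _).1 (hS T).mono_f
  have hsurj : ∀ T, Function.Surjective (S.g.app T).hom := fun T =>
    (ModuleCat.epi_iff_surjective _).1 (hS T).epi_g
  have hex : ∀ T, ∀ x, (S.g.app T).hom x = 0 → ∃ y, (S.f.app T).hom y = x := fun T =>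
    (ShortComplex.moduleCat_exact_iff _).1 (hS T).exact
  refine { exact := ?_, mono_f := ?_, epi_g := ?_ }
  · rw [ShortComplex.moduleCat_exact_iff]
    intro z hz
    choose w hw using fun T : Cech.Idx n t => hex T.1 (z T) (congrFun hz T)
    exact ⟨w, funext hw⟩
  · rw [ModuleCat.mono_iff_injective]
    intro z z' h
    funext T
    exact hinj T.1 (congrFun h T)
  · rw [ModuleCat.epi_iff_surjective]
    intro z
    choose w hw using fun T : Cech.Idx n t => hsurj T.1 (z T)
    exact ⟨w, funext hw⟩

lemma isZero_homology_succ (A : Finset (Fin n) ⥤ ModuleCat.{u} R) (t : ℕ)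
    (h : ∀ z : Cochain A (t + 1), d A (t + 1) z = 0 → ∃ w, d A t w = z) :
    IsZero ((complex.obj A).homology (t + 1)) := by
  rw [← HomologicalComplex.exactAt_iff_isZero_homology,
    HomologicalComplex.exactAt_iff' _ t (t + 1) (t + 2) (by simp) (by simp),
    ShortComplex.moduleCat_exact_iff]
  intro z hz
  obtain ⟨w, hw⟩ := h z ((complex_obj_d A (t + 1) z).symm.trans hz)
  exact ⟨w, (complex_obj_d A t w).trans hw⟩

lemma isZero_homology_zero (A : Finset (Fin n) ⥤ ModuleCat.{u} R)
    (h : ∀ z : Cochain A 0, d A 0 z = 0 → z = 0) :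
    IsZero ((complex.obj A).homology 0) := by
  rw [← HomologicalComplex.exactAt_iff_isZero_homology,
    HomologicalComplex.exactAt_iff' _ 0 0 1 (by simp) (by simp),
    ShortComplex.moduleCat_exact_iff]
  intro z hz
  exact ⟨0, (map_zero _).trans (h z ((complex_obj_d A 0 z).symm.trans hz)).symm⟩

end CechSystem

/-- The homology of a short complex of modules is the quotient of the kernel by the range. -/
def ShortComplex.homologyEquiv {R : Type u} [CommRing R] (S : ShortComplex (ModuleCat.{u} R)) :
    S.homology ≃ₗ[R] (LinearMap.ker S.g.hom ⧸
      (LinearMap.range S.f.hom).submoduleOf (LinearMap.ker S.g.hom)) :=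
  S.moduleCatHomologyIso.toLinearEquiv ≪≫ₗ
    Submodule.quotEquivOfEq _ _ (by
      ext x
      constructor
      · rintro ⟨y, rfl⟩
        exact ⟨y, rfl⟩
      · rintro ⟨y, hy⟩
        exact ⟨y, Subtype.ext hy⟩)
end

/-! ### Torsion of injective modules -/

noncomputable section
open CategoryTheory Limits

section Injective

variable {R : Type u} [CommRing R] {E : Type u} [AddCommGroup E] [Module R E]

/-- The elements killed by a power of `a`. -/
abbrev powerTorsion (a : R) (E : Type u) [AddCommGroup E] [Module R E] : Submodule R E :=
  Submodule.torsion' R E (Submonoid.powers a)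

lemma mem_powerTorsion {a : R} {x : E} : x ∈ powerTorsion a E ↔ ∃ k : ℕ, a ^ k • x = 0 := by
  rw [Submodule.mem_torsion'_iff]
  constructor
  · rintro ⟨⟨_, k, rfl⟩, h⟩
    exact ⟨k, h⟩
  · rintro ⟨k, h⟩
    exact ⟨⟨a ^ k, k, rfl⟩, h⟩

variable [IsNoetherianRing R]

/-- The Artin–Rees lemma shows that the `a`-power torsion of an injective module is injective. -/
lemma injective_powerTorsion (a : R) (hE : Module.Injective R E) :
    Module.Injective R (powerTorsion a E) := by
  apply Module.Baer.injective
  intro I g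
  -- a power of `a` kills the image of `g`
  obtain ⟨k, hk⟩ : ∃ k : ℕ, ∀ x, a ^ k • g x = 0 := by
    let N : ℕ →o Submodule R I :=
      { toFun := fun k => LinearMap.ker (a ^ k • g)
        monotone' := by
          intro k l hkl x hx
          rw [LinearMap.mem_ker, LinearMap.smul_apply] at hx ⊢
          rw [← Nat.sub_add_cancel hkl, pow_add, mul_smul, hx, smul_zero] }
    obtain ⟨k, hk⟩ := monotone_stabilizes_iff_noetherian.2
      (inferInstance : IsNoetherian R I) N
    refine ⟨k, fun x => ?_⟩
    obtain ⟨l, hl⟩ := mem_powerTorsion.1 (g x).2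
    have h1 : x ∈ N (max k l) := by
      apply N.monotone (le_max_right k l)
      change (a ^ l • g) x = 0
      exact Subtype.ext hl
    rw [← hk _ (le_max_left k l)] at h1
    exact h1
  obtain ⟨c, hc⟩ := Ideal.exists_pow_inf_eq_pow_smul (Ideal.span {a}) (M := R) I
  -- by Artin–Rees, `g` vanishes on `I ∩ (a ^ (c + k))`, so that it factors through a submodule
  -- of `R / (a ^ (c + k))`
  let J : Ideal R := Ideal.span {a ^ (c + k)}
  have hJ : ∀ x : I, (x : R) ∈ J → g x = 0 := by
    intro x hx
    have h1 : (x : R) ∈ (Ideal.span {a}) ^ (c + k) • (⊤ : Submodule R R) ⊓ I := by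
      refine ⟨?_, x.2⟩
      rw [Ideal.span_singleton_pow, smul_eq_mul, Ideal.mul_top]
      exact hx
    rw [hc _ (Nat.le_add_right c k), Nat.add_sub_cancel_left, Ideal.span_singleton_pow,
      smul_eq_mul, Ideal.mem_span_singleton_mul] at h1
    obtain ⟨z, hz, hzx⟩ := h1
    have h2 : a ^ k • (⟨z, hz.2⟩ : I) = x := Subtype.ext hzx
    rw [← hk ⟨z, hz.2⟩, ← g.map_smul, h2]
  let f : (I ⧸ Submodule.comap (Submodule.subtype I) J) →ₗ[R] (R ⧸ J) :=
    Submodule.mapQ _ _ (Submodule.subtype I) le_rfl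
  have hf : Function.Injective f := by
    rw [← LinearMap.ker_eq_bot, Submodule.ker_mapQ, Submodule.mkQ_map_self]
  obtain ⟨h, hh⟩ := hE.out f hf (Submodule.liftQ _ ((powerTorsion a E).subtype ∘ₗ g) (by
    intro x hx
    have := hJ x hx
    simp [this]))
  refine ⟨(h ∘ₗ J.mkQ).codRestrict _ (fun x => mem_powerTorsion.2 ⟨c + k, ?_⟩), fun x hx => ?_⟩
  · rw [← map_smul]
    have : a ^ (c + k) • x ∈ J := Ideal.mul_mem_right _ _ (Ideal.mem_span_singleton_self _)
    exact (congrArg h ((Submodule.Quotient.mk_eq_zero J).2 this)).trans (map_zero h)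
  · exact Subtype.ext (hh (Submodule.Quotient.mk ⟨x, hx⟩))

/-- Dividing out the `a`-power torsion of an injective module makes `a` act bijectively. -/
lemma bijective_smul_quotient_powerTorsion (a : R) (hE : Module.Injective R E) :
    Function.Bijective (fun x : E ⧸ powerTorsion a E => a • x) := by
  constructor
  · refine (injective_iff_map_eq_zero
      (LinearMap.lsmul R (E ⧸ powerTorsion a E) a)).2 fun x hx => ?_
    obtain ⟨x, rfl⟩ := Submodule.Quotient.mk_surjective _ x
    have hx' : a • x ∈ powerTorsion a E := (Submodule.Quotient.mk_eq_zero _).1 hx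
    obtain ⟨k, hk⟩ := mem_powerTorsion.1 hx'
    refine (Submodule.Quotient.mk_eq_zero _).2 (mem_powerTorsion.2 ⟨k + 1, ?_⟩)
    rw [pow_succ, mul_smul, hk]
  · intro x
    obtain ⟨e, rfl⟩ := Submodule.Quotient.mk_surjective _ x
    let N : ℕ →o Submodule R R :=
      { toFun := fun k => LinearMap.ker (LinearMap.toSpanSingleton R R (a ^ k))
        monotone' := by
          intro k l hkl x hx
          rw [LinearMap.mem_ker, LinearMap.toSpanSingleton_apply, smul_eq_mul] at hx ⊢
          rw [← Nat.sub_add_cancel hkl, pow_add, mul_left_comm, hx, mul_zero] }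
    obtain ⟨k, hk⟩ := monotone_stabilizes_iff_noetherian.2 (inferInstance : IsNoetherian R R) N
    have hle : LinearMap.ker (LinearMap.toSpanSingleton R R (a ^ (k + 1))) ≤
        LinearMap.ker (LinearMap.toSpanSingleton R E (a ^ k • e)) := by
      intro r hr
      have h1 : r ∈ N k := by rw [hk (k + 1) (Nat.le_succ k)]; exact hr
      have h2 : r * a ^ k = 0 := h1
      rw [LinearMap.mem_ker, LinearMap.toSpanSingleton_apply, smul_smul, h2, zero_smul]
    -- extend the well-defined map `a ^ (k + 1) ↦ a ^ k • e` to all of `R`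
    obtain ⟨h, hh⟩ := hE.out
      (Submodule.liftQ _ (LinearMap.toSpanSingleton R R (a ^ (k + 1))) le_rfl)
      (by rw [← LinearMap.ker_eq_bot]; exact Submodule.ker_liftQ_eq_bot _ _ _ le_rfl)
      (Submodule.liftQ _ _ hle)
    have h1 := hh (Submodule.Quotient.mk 1)
    simp only [Submodule.liftQ_apply, LinearMap.toSpanSingleton_apply, one_smul] at h1
    refine ⟨Submodule.Quotient.mk (h 1), ?_⟩
    refine (Submodule.Quotient.eq _).2 (mem_powerTorsion.2 ⟨k, ?_⟩)
    rw [smul_sub, smul_smul, ← pow_succ, ← map_smul, smul_eq_mul, mul_one, h1, sub_self]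

end Injective

/-! ### The Čech complex of a module -/

namespace CechSystem

open TensorProduct

variable {R : Type u} [CommRing R] {n : ℕ} (y : Fin n → R)

lemma nat_nat {S T U : Finset (Fin n)} (h : S ⊆ T) (h' : T ⊆ U) (z : Cech.Loc y S) :
    Cech.nat y h' (Cech.nat y h z) = Cech.nat y (h.trans h') z := by
  have : (Cech.nat y h').comp (Cech.nat y h) = Cech.nat y (h.trans h') :=
    IsLocalization.algHom_ext (Submonoid.powers (∏ j ∈ S, y j)) (Subsingleton.elim _ _)
  exact congrArg (fun f => f z) this

lemma nat_refl {S : Finset (Fin n)} (h : S ⊆ S) (z : Cech.Loc y S) : Cech.nat y h z = z := by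
  have : Cech.nat y h = AlgHom.id R _ :=
    IsLocalization.algHom_ext (Submonoid.powers (∏ j ∈ S, y j)) (Subsingleton.elim _ _)
  exact congrArg (fun f => f z) this

/-- The system of the localizations `M_{y_T} = R_{y_T} ⊗ M`. -/
def locSystem : ModuleCat.{u} R ⥤ (Finset (Fin n) ⥤ ModuleCat.{u} R) where
  obj M :=
    { obj := fun T => ModuleCat.of R (Cech.Loc y T ⊗[R] M)
      map := fun f => ModuleCat.ofHom (LinearMap.rTensor M (Cech.nat y (leOfHom f)).toLinearMap)
      map_id := fun T => by
        refine ModuleCat.hom_ext (TensorProduct.ext' fun z x => ?_)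
        exact congrArg (· ⊗ₜ[R] x) (nat_refl y subset_rfl z)
      map_comp := fun f g => by
        refine ModuleCat.hom_ext (TensorProduct.ext' fun z x => ?_)
        exact congrArg (· ⊗ₜ[R] x) (nat_nat y (leOfHom f) (leOfHom g) z).symm }
  map f :=
    { app := fun T => ModuleCat.ofHom (LinearMap.lTensor (Cech.Loc y T) f.hom)
      naturality := fun S T g => by
        refine ModuleCat.hom_ext (TensorProduct.ext' fun z x => ?_)
        rfl }
  map_id M := by
    refine NatTrans.ext (funext fun T => ModuleCat.hom_ext (TensorProduct.ext' fun z x => ?_))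
    rfl
  map_comp f g := by
    refine NatTrans.ext (funext fun T => ModuleCat.hom_ext (TensorProduct.ext' fun z x => ?_))
    rfl

instance : (locSystem y).PreservesZeroMorphisms where
  map_zero A B := by
    refine NatTrans.ext (funext fun T => ModuleCat.hom_ext (TensorProduct.ext' fun z x => ?_))
    exact TensorProduct.tmul_zero _ z

lemma locSystem_shortExact {S : ShortComplex (ModuleCat.{u} R)} (hS : S.ShortExact)
    (T : Finset (Fin n)) :
    ((S.map (locSystem y)).map ((evaluation _ _).obj T)).ShortExact := by
  have hinj := (ModuleCat.mono_iff_injective _).1 hS.mono_f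
  have hsurj := (ModuleCat.epi_iff_surjective _).1 hS.epi_g
  have hex := (ShortComplex.ShortExact.moduleCat_exact_iff_function_exact S).1 hS.exact
  have : Module.Flat R (Cech.Loc y T) := inferInstance
  refine { exact := ?_, mono_f := ?_, epi_g := ?_ }
  · rw [ShortComplex.ShortExact.moduleCat_exact_iff_function_exact]
    exact Module.Flat.lTensor_exact (Cech.Loc y T) hex
  · rw [ModuleCat.mono_iff_injective]
    exact Module.Flat.lTensor_preserves_injective_linearMap S.f.hom hinj
  · rw [ModuleCat.epi_iff_surjective]
    exact LinearMap.lTensor_surjective (Cech.Loc y T) hsurj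

instance isLocalizedModule_mk (M : Type u) [AddCommGroup M] [Module R M] (T : Finset (Fin n)) :
    IsLocalizedModule (Submonoid.powers (∏ j ∈ T, y j))
      (TensorProduct.mk R (Cech.Loc y T) M 1) :=
  (isLocalizedModule_iff_isBaseChange (Submonoid.powers (∏ j ∈ T, y j)) (Cech.Loc y T) _).2
    (TensorProduct.isBaseChange R M (Cech.Loc y T))

lemma res_mk (M : ModuleCat.{u} R) {S T : Finset (Fin n)} (h : S ⊆ T) (x : M) :
    res ((locSystem y).obj M) h (TensorProduct.mk R (Cech.Loc y S) M 1 x) =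
      TensorProduct.mk R (Cech.Loc y T) M 1 x :=
  congrArg (· ⊗ₜ[R] x) (map_one (Cech.nat y h))

section

variable {M : Type u} [AddCommGroup M] [Module R M] (T : Finset (Fin n))

lemma exists_pow_smul_eq_mk (a : Cech.Loc y T ⊗[R] M) :
    ∃ (k : ℕ) (x : M), (∏ j ∈ T, y j) ^ k • a = TensorProduct.mk R (Cech.Loc y T) M 1 x := by
  obtain ⟨⟨x, ⟨s, hs⟩⟩, hx⟩ := IsLocalizedModule.surj (Submonoid.powers (∏ j ∈ T, y j))
    (TensorProduct.mk R (Cech.Loc y T) M 1) a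
  obtain ⟨k, rfl⟩ := hs
  exact ⟨k, x, hx⟩

lemma pow_smul_bijective (k : ℕ) :
    Function.Bijective (fun a : Cech.Loc y T ⊗[R] M => (∏ j ∈ T, y j) ^ k • a) :=
  (Module.End.isUnit_iff _).1 (IsLocalizedModule.map_units (TensorProduct.mk R (Cech.Loc y T) M 1)
    (⟨_, k, rfl⟩ : Submonoid.powers (∏ j ∈ T, y j)))

lemma mk_eq_zero_iff (x : M) :
    TensorProduct.mk R (Cech.Loc y T) M 1 x = 0 ↔ ∃ k : ℕ, (∏ j ∈ T, y j) ^ k • x = 0 := by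
  rw [IsLocalizedModule.eq_zero_iff (Submonoid.powers (∏ j ∈ T, y j))]
  constructor
  · rintro ⟨⟨_, k, rfl⟩, h⟩
    exact ⟨k, h⟩
  · rintro ⟨k, h⟩
    exact ⟨⟨_, k, rfl⟩, h⟩

end

lemma res_bijective (M : ModuleCat.{u} R) (j : Fin n)
    (hj : Function.Bijective (fun x : M => y j • x)) (T : Finset (Fin n)) :
    Function.Bijective (res ((locSystem y).obj M) (Finset.subset_insert j T)) := by
  by_cases hT : j ∈ T
  · have hins : insert j T = T := Finset.insert_eq_of_mem hT
    constructor
    · intro a b hab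
      have := congrArg (res ((locSystem y).obj M) hins.le) hab
      rwa [res_res, res_res, res_refl, res_refl] at this
    · intro b
      refine ⟨res ((locSystem y).obj M) hins.le b, ?_⟩
      rw [res_res, res_refl]
  have hpow : ∀ k : ℕ, Function.Bijective (fun x : M => y j ^ k • x) := by
    intro k
    have : (fun x : M => y j ^ k • x) = (fun x => y j • x)^[k] := by
      rw [smul_iterate]
    rw [this]
    exact hj.iterate k
  have hprod : ∏ k ∈ insert j T, y k = y j * ∏ k ∈ T, y k := Finset.prod_insert hT
  let ρ : Cech.Loc y T ⊗[R] M →ₗ[R] Cech.Loc y (insert j T) ⊗[R] M :=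
    LinearMap.rTensor M (Cech.nat y (Finset.subset_insert j T)).toLinearMap
  have hρ : ∀ x, ρ (TensorProduct.mk R (Cech.Loc y T) M 1 x) =
    TensorProduct.mk R (Cech.Loc y (insert j T)) M 1 x := res_mk y M (Finset.subset_insert j T)
  change Function.Bijective ρ
  constructor
  · rw [injective_iff_map_eq_zero]
    intro a ha
    obtain ⟨k, x, hx⟩ := exists_pow_smul_eq_mk y T a
    have h1 : TensorProduct.mk R (Cech.Loc y (insert j T)) M 1 x = 0 := by
      rw [← hρ, ← hx, map_smul, ha, smul_zero]
    obtain ⟨l, hl⟩ := (mk_eq_zero_iff y _ x).1 h1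
    have h2 : (∏ k ∈ T, y k) ^ l • x = 0 := by
      apply (hpow l).1
      simp only [smul_zero]
      rw [smul_smul, ← mul_pow, ← hprod]
      exact hl
    rw [(mk_eq_zero_iff y _ x).2 ⟨l, h2⟩] at hx
    exact (pow_smul_bijective y T k).1 (hx.trans (smul_zero _).symm)
  · intro b
    obtain ⟨k, x, hx⟩ := exists_pow_smul_eq_mk y _ b
    obtain ⟨x', rfl⟩ := (hpow k).2 x
    obtain ⟨a, ha⟩ := (pow_smul_bijective y T k).2 (TensorProduct.mk R (Cech.Loc y T) M 1 x')
    refine ⟨a, (pow_smul_bijective y (insert j T) k).1 (Eq.trans ?_ hx.symm)⟩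
    have h3 : (∏ j ∈ T, y j) ^ k • ρ a = TensorProduct.mk R (Cech.Loc y (insert j T)) M 1 x' := by
      rw [← map_smul, ← hρ]
      exact congrArg ρ ha
    simp only [hprod, mul_pow, mul_smul, h3, map_smul]

lemma subsingleton_of_torsion (M : Type u) [AddCommGroup M] [Module R M] {T : Finset (Fin n)}
    {j : Fin n} (hj : j ∈ T) (h : ∀ x : M, ∃ k : ℕ, y j ^ k • x = 0) :
    Subsingleton (Cech.Loc y T ⊗[R] M) := by
  refine subsingleton_of_forall_eq 0 fun a => ?_
  obtain ⟨k, x, hx⟩ := exists_pow_smul_eq_mk y T a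
  obtain ⟨l, hl⟩ := h x
  have h1 : (∏ k ∈ T, y k) ^ l • x = 0 := by
    rw [← Finset.mul_prod_erase _ _ hj, mul_comm, mul_pow, mul_smul, hl, smul_zero]
  rw [(mk_eq_zero_iff y _ x).2 ⟨l, h1⟩] at hx
  exact (pow_smul_bijective y T k).1 (hx.trans (smul_zero _).symm)

/-- The Čech complex of a module. -/
def cech : ModuleCat.{u} R ⥤ CochainComplex (ModuleCat.{u} R) ℕ := locSystem y ⋙ complex

instance : (cech y).PreservesZeroMorphisms := by unfold cech; infer_instance

lemma cech_shortExact {S : ShortComplex (ModuleCat.{u} R)} (hS : S.ShortExact) :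
    (S.map (cech y)).ShortExact :=
  complex_shortExact (S := S.map (locSystem y)) (locSystem_shortExact y hS)

/-- If one of the `y j` acts bijectively on `M`, then the Čech complex of `M` is acyclic. -/
lemma isZero_cech_homology_of_bijective (M : ModuleCat.{u} R) (j : Fin n)
    (hj : Function.Bijective (fun x : M => y j • x)) (t : ℕ) :
    IsZero (((cech y).obj M).homology t) := by
  cases t with
  | zero => exact isZero_homology_zero _ (eq_zero_of_bijective j (res_bijective y M j hj))
  | succ t =>
    exact isZero_homology_succ _ t (exists_d_eq_of_bijective j (res_bijective y M j hj))

/-- Over a noetherian ring, the Čech complex of an injective module is acyclic in positive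
degrees. The induction runs over the set `J` of those `j` for which the module need not be
`y j`-power torsion. -/
theorem isZero_cech_homology_of_injective [IsNoetherianRing R] (J : Finset (Fin n)) :
    ∀ (E : Type u) [AddCommGroup E] [Module R E], Module.Injective R E →
      (∀ j ∉ J, ∀ x : E, ∃ k : ℕ, y j ^ k • x = 0) → ∀ t : ℕ,
        IsZero (((cech y).obj (ModuleCat.of R E)).homology (t + 1)) := by
  induction J using Finset.induction with
  | empty =>
    intro E _ _ _ h t
    refine isZero_homology_succ _ t fun z _ => ⟨0, ?_⟩
    rw [map_zero]
    funext T
    obtain ⟨j, hj⟩ : T.1.Nonempty := by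
      rw [← Finset.card_pos, T.2]
      exact Nat.succ_pos t
    exact (subsingleton_of_torsion y E hj (h j (Finset.notMem_empty j))).elim _ _
  | insert j J _ ih =>
    intro E _ _ hE h t
    let S : ShortComplex (ModuleCat.{u} R) := ShortComplex.mk
      (ModuleCat.ofHom (powerTorsion (y j) E).subtype)
      (ModuleCat.ofHom (powerTorsion (y j) E).mkQ)
      (ModuleCat.hom_ext (LinearMap.ext fun x => by simp))
    have hS : S.ShortExact := by
      refine { exact := ?_, mono_f := ?_, epi_g := ?_ }
      · rw [ShortComplex.moduleCat_exact_iff]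
        intro x hx
        exact ⟨⟨x, (Submodule.Quotient.mk_eq_zero _).1 hx⟩, rfl⟩
      · rw [ModuleCat.mono_iff_injective]
        exact Subtype.val_injective
      · rw [ModuleCat.epi_iff_surjective]
        exact Submodule.mkQ_surjective _
    have hex := (cech_shortExact y hS).homology_exact₂ (t + 1)
    refine hex.isZero_of_both_zeros (IsZero.eq_of_src ?_ _ _) (IsZero.eq_of_tgt ?_ _ _)
    · refine ih (powerTorsion (y j) E) (injective_powerTorsion (y j) hE) (fun k hk x => ?_) t
      by_cases hkj : k = j
      · obtain ⟨l, hl⟩ := mem_powerTorsion.1 x.2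
        exact ⟨l, Subtype.ext (hkj ▸ hl)⟩
      · obtain ⟨l, hl⟩ := h k (by simp [hk, hkj]) x
        exact ⟨l, Subtype.ext hl⟩
    · exact isZero_cech_homology_of_bijective y _ j
        (bijective_smul_quotient_powerTorsion (y j) hE) _

end CechSystem
end

/-! ### Connecting morphisms of left derived functors -/

noncomputable section
open CategoryTheory Limits

namespace LeftDerived

universe v₁ u₁ v₂ u₂

variable {C : Type u₁} [Category.{v₁} C] {D : Type u₂} [Category.{v₂} D]
  [Abelian C] [Abelian D]
  {F₁ F₂ F₃ : C ⥤ D} [F₁.Additive] [F₂.Additive] [F₃.Additive] {α : F₁ ⟶ F₂} {β : F₂ ⟶ F₃}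

/-- The short complex of chain complexes `F₁ P → F₂ P → F₃ P`. -/
def shortCpx (w : α ≫ β = 0) (P : ChainComplex C ℕ) : ShortComplex (ChainComplex D ℕ) :=
  ShortComplex.mk ((NatTrans.mapHomologicalComplex α _).app P)
    ((NatTrans.mapHomologicalComplex β _).app P)
    (HomologicalComplex.hom_ext _ _ fun i => congrArg (fun f => f.app (P.X i)) w)

/-- A morphism of chain complexes induces a morphism of short complexes. -/
def shortCpxMap (w : α ≫ β = 0) {P Q : ChainComplex C ℕ} (f : P ⟶ Q) :
    shortCpx w P ⟶ shortCpx w Q where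
  τ₁ := (F₁.mapHomologicalComplex _).map f
  τ₂ := (F₂.mapHomologicalComplex _).map f
  τ₃ := (F₃.mapHomologicalComplex _).map f
  comm₁₂ := (NatTrans.mapHomologicalComplex α _).naturality f
  comm₂₃ := (NatTrans.mapHomologicalComplex β _).naturality f

lemma shortCpx_shortExact (w : α ≫ β = 0)
    (h : ∀ X : C, Projective X →
      (ShortComplex.mk (α.app X) (β.app X) (congrArg (fun f => f.app X) w)).ShortExact)
    {X : C} (P : ProjectiveResolution X) : (shortCpx w P.complex).ShortExact :=
  HomologicalComplex.shortExact_of_degreewise_shortExact _ fun i => h _ (P.projective i)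

variable (w : α ≫ β = 0)
    (h : ∀ X : C, Projective X →
      (ShortComplex.mk (α.app X) (β.app X) (congrArg (fun f => f.app X) w)).ShortExact)

/-- The connecting morphism in the homology of `F₁ P → F₂ P → F₃ P`. -/
def resDelta {X : C} (P : ProjectiveResolution X) (i : ℕ) :
    ((F₃.mapHomologicalComplex _).obj P.complex).homology (i + 1) ⟶
      ((F₁.mapHomologicalComplex _).obj P.complex).homology i :=
  (shortCpx_shortExact w h P).δ (i + 1) i (by simp)

lemma resDelta_naturality {X Y : C} (P : ProjectiveResolution X) (Q : ProjectiveResolution Y)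
    (g : P.complex ⟶ Q.complex) (i : ℕ) :
    resDelta w h P i ≫ HomologicalComplex.homologyMap ((F₁.mapHomologicalComplex _).map g) i =
      HomologicalComplex.homologyMap ((F₃.mapHomologicalComplex _).map g) (i + 1) ≫
        resDelta w h Q i :=
  HomologicalComplex.HomologySequence.δ_naturality (shortCpxMap w g)
      (shortCpx_shortExact w h P) (shortCpx_shortExact w h Q) (i + 1) i (by simp)

lemma resDelta_comp {X : C} (P : ProjectiveResolution X) (i : ℕ) :
    resDelta w h P i ≫ HomologicalComplex.homologyMap
      ((NatTrans.mapHomologicalComplex α _).app P.complex) i = 0 :=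
  (shortCpx_shortExact w h P).δ_comp (i + 1) i (by simp)

lemma resDelta_exact {X : C} (P : ProjectiveResolution X) (i : ℕ) :
    (ShortComplex.mk (resDelta w h P i) _ (resDelta_comp w h P i)).Exact :=
  (shortCpx_shortExact w h P).homology_exact₁ (i + 1) i (by simp)

lemma mono_resDelta {X : C} (P : ProjectiveResolution X) (i : ℕ)
    (hz : IsZero (((F₂.mapHomologicalComplex _).obj P.complex).homology (i + 1))) :
    Mono (resDelta w h P i) :=
  ((shortCpx_shortExact w h P).homology_exact₃ (i + 1) i (by simp)).mono_g (hz.eq_of_src _ _)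

variable [HasProjectiveResolutions C]

/-- The left derived functors, computed by a projective resolution. -/
def leftDerivedIso (F : C ⥤ D) [F.Additive] {X : C} (P : ProjectiveResolution X) (i : ℕ) :
    (F.leftDerived i).obj X ≅ ((F.mapHomologicalComplex _).obj P.complex).homology i :=
  P.isoLeftDerivedObj F i

lemma leftDerived_map (F : C ⥤ D) [F.Additive] {X Y : C} (f : X ⟶ Y)
    (P : ProjectiveResolution X) (Q : ProjectiveResolution Y) (i : ℕ) :
    (F.leftDerived i).map f = (leftDerivedIso F P i).hom ≫
      HomologicalComplex.homologyMap ((F.mapHomologicalComplex _).map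
        (ProjectiveResolution.lift f P Q)) i ≫ (leftDerivedIso F Q i).inv :=
  F.leftDerived_map_eq i f _ (ProjectiveResolution.lift_commutes f P Q)

lemma leftDerived_app {F G : C ⥤ D} [F.Additive] [G.Additive] (γ : F ⟶ G) {X : C}
    (P : ProjectiveResolution X) (i : ℕ) :
    (NatTrans.leftDerived γ i).app X = (leftDerivedIso F P i).hom ≫
      HomologicalComplex.homologyMap ((NatTrans.mapHomologicalComplex γ _).app P.complex) i ≫
        (leftDerivedIso G P i).inv :=
  P.leftDerived_app_eq γ i

lemma fromLeftDerivedZero_app (F : C ⥤ D) [F.Additive] {X : C} (P : ProjectiveResolution X) :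
    F.fromLeftDerivedZero.app X = (leftDerivedIso F P 0).hom ≫
      HomologicalComplex.homologyι _ 0 ≫ P.fromLeftDerivedZero' F := by
  rw [P.fromLeftDerivedZero_eq F]
  rfl

/-- The comparison of the zeroth left derived functor with the functor is natural. -/
lemma leftDerived_fromLeftDerivedZero {F G : C ⥤ D} [F.Additive] [G.Additive] (γ : F ⟶ G) :
    NatTrans.leftDerived γ 0 ≫ G.fromLeftDerivedZero = F.fromLeftDerivedZero ≫ γ := by
  ext X
  let P := projectiveResolution X
  rw [NatTrans.comp_app, NatTrans.comp_app, leftDerived_app γ P,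
    fromLeftDerivedZero_app F P, fromLeftDerivedZero_app G P]
  simp only [Category.assoc, Iso.inv_hom_id_assoc]
  congr 1
  rw [HomologicalComplex.homologyι_naturality_assoc]
  congr 1
  rw [← cancel_epi (HomologicalComplex.pOpcycles _ 0),
    HomologicalComplex.p_opcyclesMap_assoc,
    ProjectiveResolution.pOpcycles_comp_fromLeftDerivedZero',
    ProjectiveResolution.pOpcycles_comp_fromLeftDerivedZero'_assoc]
  exact (γ.naturality (P.π.f 0)).symm

/-- The connecting morphism of left derived functors. -/
def delta (i : ℕ) : F₃.leftDerived (i + 1) ⟶ F₁.leftDerived i where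
  app X := (leftDerivedIso F₃ (projectiveResolution X) (i + 1)).hom ≫
    resDelta w h (projectiveResolution X) i ≫
      (leftDerivedIso F₁ (projectiveResolution X) i).inv
  naturality X Y f := by
    rw [leftDerived_map F₃ f (projectiveResolution X) (projectiveResolution Y),
      leftDerived_map F₁ f (projectiveResolution X) (projectiveResolution Y)]
    simp only [Category.assoc, Iso.inv_hom_id_assoc]
    rw [← reassoc_of% resDelta_naturality]

lemma delta_comp (i : ℕ) : delta w h i ≫ NatTrans.leftDerived α i = 0 := by
  ext X
  rw [NatTrans.comp_app, leftDerived_app α (projectiveResolution X)]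
  simp only [delta, Category.assoc, Iso.inv_hom_id_assoc]
  rw [reassoc_of% resDelta_comp]
  simp

/-- Exactness of `L_{i+1} F₃ → L_i F₁ → L_i F₂`. -/
lemma delta_exact (i : ℕ) (X : C) :
    (ShortComplex.mk ((delta w h i).app X) ((NatTrans.leftDerived α i).app X)
      (congrArg (fun f => f.app X) (delta_comp w h i))).Exact := by
  refine ShortComplex.exact_of_iso ?_ (resDelta_exact w h (projectiveResolution X) i)
  refine ShortComplex.isoMk (leftDerivedIso F₃ (projectiveResolution X) (i + 1)).symm
    (leftDerivedIso F₁ (projectiveResolution X) i).symm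
    (leftDerivedIso F₂ (projectiveResolution X) i).symm ?_ ?_
  · simp only [delta, Iso.symm_hom, Iso.inv_hom_id_assoc]
  · simp only [Iso.symm_hom, leftDerived_app α (projectiveResolution X), Iso.inv_hom_id_assoc]

lemma mono_delta (i : ℕ) (X : C) (hz : IsZero ((F₂.leftDerived (i + 1)).obj X)) :
    Mono ((delta w h i).app X) := by
  have := mono_resDelta w h (projectiveResolution X) i
    (hz.of_iso (leftDerivedIso F₂ (projectiveResolution X) (i + 1)).symm)
  simp only [delta]
  infer_instance

/-- The connecting morphism is an isomorphism where the derived functors of `F₂` vanish. -/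
lemma isIso_delta (i : ℕ) (hz : ∀ X, IsZero ((F₂.leftDerived (i + 1)).obj X))
    (hz' : ∀ X, IsZero ((F₂.leftDerived i).obj X)) : IsIso (delta w h i) := by
  have : ∀ X, IsIso ((delta w h i).app X) := fun X => by
    have h1 := mono_delta w h i X (hz X)
    have h2 : Epi ((delta w h i).app X) :=
      (delta_exact w h i X).epi_f ((hz' X).eq_of_tgt _ _)
    exact isIso_of_mono_of_epi _
  exact NatIso.isIso_of_isIso_app _

end LeftDerived
end

/-! ### Dimension shifting -/

noncomputable section
open CategoryTheory Limits

section GammaTheory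

variable {R : Type u} [CommRing R]

/-- The elements of `M` killed by a power of each of the `y j`. -/
def Gamma {n : ℕ} (y : Fin n → R) (M : Type u) [AddCommGroup M] [Module R M] : Submodule R M :=
  ⨅ j, Submodule.torsion' R M (Submonoid.powers (y j))

lemma mem_Gamma {n : ℕ} {y : Fin n → R} {M : Type u} [AddCommGroup M] [Module R M] {x : M} :
    x ∈ Gamma y M ↔ ∀ j, ∃ k : ℕ, y j ^ k • x = 0 := by
  simp only [Gamma, Submodule.mem_iInf, Submodule.mem_torsion'_iff]
  refine forall_congr' fun j => ?_
  constructor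
  · rintro ⟨⟨_, k, rfl⟩, h⟩
    exact ⟨k, h⟩
  · rintro ⟨k, h⟩
    exact ⟨⟨y j ^ k, k, rfl⟩, h⟩

/-- A sequence of functions on modules that behaves on objects like the right derived functors of
`Gamma y`. -/
structure IsGammaTheory {n : ℕ} (y : Fin n → R) (H : ℕ → ModuleCat.{u} R → ModuleCat.{u} R) :
    Prop where
  zero : ∀ M, Nonempty (H 0 M ≃ₗ[R] Gamma y M)
  one : ∀ S : ShortComplex (ModuleCat.{u} R), S.ShortExact → Injective S.X₂ →
    Nonempty (H 1 S.X₁ ≃ₗ[R] (Gamma y S.X₃ ⧸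
      ((Gamma y S.X₂).map S.g.hom).submoduleOf (Gamma y S.X₃)))
  succ : ∀ S : ShortComplex (ModuleCat.{u} R), S.ShortExact → Injective S.X₂ →
    ∀ i : ℕ, Nonempty (H (i + 1) S.X₃ ≃ₗ[R] H (i + 2) S.X₁)

/-- Two sequences that behave like the derived functors of `Gamma y` agree on all modules, by
dimension shifting. -/
theorem IsGammaTheory.nonempty_linearEquiv {n : ℕ} {y : Fin n → R}
    {H H' : ℕ → ModuleCat.{u} R → ModuleCat.{u} R}
    (h : IsGammaTheory y H) (h' : IsGammaTheory y H') (i : ℕ) (M : ModuleCat.{u} R) :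
    Nonempty (H i M ≃ₗ[R] H' i M) := by
  let S : ModuleCat.{u} R → ShortComplex (ModuleCat.{u} R) := fun M =>
    ShortComplex.mk (Injective.ι M) (cokernel.π (Injective.ι M)) (cokernel.condition _)
  have hS : ∀ M, (S M).ShortExact := fun M =>
    { exact := ShortComplex.exact_cokernel _
      mono_f := inferInstanceAs (Mono (Injective.ι M))
      epi_g := inferInstanceAs (Epi (cokernel.π (Injective.ι M))) }
  have hinj : ∀ M, Injective (S M).X₂ := fun M =>
    inferInstanceAs (Injective (Injective.under M))
  cases i with
  | zero => exact ⟨(h.zero M).some.trans (h'.zero M).some.symm⟩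
  | succ i =>
    induction i generalizing M with
    | zero =>
      exact ⟨(h.one (S M) (hS M) (hinj M)).some.trans (h'.one (S M) (hS M) (hinj M)).some.symm⟩
    | succ i ih =>
      exact ⟨((h.succ (S M) (hS M) (hinj M) i).some.symm.trans (ih _).some).trans
        (h'.succ (S M) (hS M) (hinj M) i).some⟩

/-- The end of a right exact sequence `A → B → C → 0` in terms of embeddings of `A` and `B`. -/
lemma nonempty_quotient_equiv {A B C M N : Type u} [AddCommGroup A] [AddCommGroup B]
    [AddCommGroup C] [AddCommGroup M] [AddCommGroup N] [Module R A] [Module R B] [Module R C]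
    [Module R M] [Module R N] (m : A →ₗ[R] B) (δ : B →ₗ[R] C) (hmδ : Function.Exact m δ)
    (hδ : Function.Surjective δ) (g : M →ₗ[R] N) (e : A →ₗ[R] M) (e' : B →ₗ[R] N)
    (he' : Function.Injective e') (hcomm : ∀ a, e' (m a) = g (e a)) :
    Nonempty (C ≃ₗ[R] (LinearMap.range e' ⧸
      ((LinearMap.range e).map g).submoduleOf (LinearMap.range e'))) := by
  refine ⟨(hmδ.linearEquivOfSurjective hδ).symm.trans
    (Submodule.Quotient.equiv _ _ (LinearEquiv.ofInjective e' he') ?_)⟩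
  ext ⟨x, hx⟩
  simp only [Submodule.mem_map, LinearMap.mem_range, Submodule.submoduleOf, Submodule.mem_comap,
    Submodule.subtype_apply]
  constructor
  · rintro ⟨_, ⟨a, rfl⟩, h⟩
    exact ⟨e a, ⟨a, rfl⟩, (hcomm a).symm.trans (congrArg Subtype.val h)⟩
  · rintro ⟨_, ⟨a, rfl⟩, h⟩
    exact ⟨m a, ⟨a, rfl⟩, Subtype.ext ((hcomm a).trans h)⟩

end GammaTheory

/-! ### Local cohomology as a colimit of Ext modules -/

namespace ExtColimit

variable {R : Type u} [CommRing R]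

/-- The functor `Hom(-, M)` with values in the opposite category. -/
abbrev homFunctor (M : ModuleCat.{u} R) : ModuleCat.{u} R ⥤ (ModuleCat.{u} R)ᵒᵖ :=
  ((linearYoneda R (ModuleCat.{u} R)).obj M).rightOp

/-- The natural transformation `Hom(-, N) ⟶ Hom(-, M)`, in the opposite category, induced by
`f : M ⟶ N`. -/
abbrev homMap {M N : ModuleCat.{u} R} (f : M ⟶ N) : homFunctor N ⟶ homFunctor M :=
  NatTrans.rightOp ((linearYoneda R (ModuleCat.{u} R)).map f)

instance (M : ModuleCat.{u} R) : PreservesFiniteColimits (homFunctor M) := by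
  have : PreservesFiniteLimits ((linearYoneda R (ModuleCat.{u} R)).obj M) := by
    have : PreservesLimits ((linearYoneda R (ModuleCat.{u} R)).obj M ⋙ forget _) :=
      inferInstanceAs (PreservesLimits (yoneda.obj M))
    have : PreservesLimits ((linearYoneda R (ModuleCat.{u} R)).obj M) :=
      preservesLimits_of_reflects_of_preserves _ (forget (ModuleCat.{u} R))
    infer_instance
  exact preservesFiniteColimits_rightOp _

variable {S : ShortComplex (ModuleCat.{u} R)}

lemma homMap_zero (S : ShortComplex (ModuleCat.{u} R)) : homMap S.g ≫ homMap S.f = 0 := by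
  ext X
  refine Quiver.Hom.unop_inj (ModuleCat.hom_ext (LinearMap.ext fun h => ?_))
  exact (Category.assoc (show X ⟶ S.X₁ from h) S.f S.g).trans
    ((congrArg ((show X ⟶ S.X₁ from h) ≫ ·) S.zero).trans comp_zero)

lemma homMap_shortExact (hS : S.ShortExact) (X : ModuleCat.{u} R) (hX : Projective X) :
    (ShortComplex.mk ((homMap S.g).app X) ((homMap S.f).app X)
      (congrArg (fun f => f.app X) (homMap_zero S))).ShortExact := by
  have h : (S.map (((linearCoyoneda R (ModuleCat.{u} R)).obj (Opposite.op X)))).ShortExact := by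
    have := hS.mono_f
    have := hS.epi_g
    refine { exact := ?_, mono_f := ?_, epi_g := ?_ }
    · rw [ShortComplex.moduleCat_exact_iff]
      intro h hh
      exact ⟨hS.exact.lift h hh, hS.exact.lift_f h hh⟩
    · rw [ModuleCat.mono_iff_injective]
      intro a b hab
      exact (cancel_mono S.f).1 hab
    · rw [ModuleCat.epi_iff_surjective]
      intro h
      exact ⟨Projective.factorThru h S.g, Projective.factorThru_comp h S.g⟩
  exact h.op

lemma isZero_leftDerived_of_injective (E : ModuleCat.{u} R) [Injective E] (X : ModuleCat.{u} R)
    (i : ℕ) : IsZero (((homFunctor E).leftDerived (i + 1)).obj X) := by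
  let P := projectiveResolution X
  suffices h : IsZero ((((Ext R (ModuleCat.{u} R) (i + 1)).obj (Opposite.op X)).obj E)) from h.op
  refine IsZero.of_iso ?_ (P.isoExt (i + 1) E)
  rw [← HomologicalComplex.exactAt_iff_isZero_homology,
    HomologicalComplex.exactAt_iff' _ i (i + 1) (i + 2) (by simp) (by simp),
    ShortComplex.moduleCat_exact_iff]
  intro f hf
  have hex := P.exact_succ i
  exact ⟨hex.descToInjective f hf, hex.comp_descToInjective f hf⟩

section Colimit

variable {K : Type} [SmallCategory K] {A B C : K ⥤ ModuleCat.{u} R}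

lemma preservesColimitsOfShape_forget [IsFiltered K] :
    PreservesColimitsOfShape K (forget (ModuleCat.{u} R)) := by
  have := preservesFilteredColimitsOfSize_shrink.{0, u, 0, u} (forget (ModuleCat.{u} R))
  exact PreservesFilteredColimitsOfSize.preserves_filtered_colimits K

lemma colimMap_ι_apply (α : A ⟶ B) (k : K) (a : A.obj k) :
    (colimMap α).hom ((colimit.ι A k).hom a) = (colimit.ι B k).hom ((α.app k).hom a) :=
  congrArg (fun f => f.hom a) (ι_colimMap α k)

variable [IsFiltered K]

lemma exists_ι_eq (x : (colimit A : ModuleCat.{u} R)) : ∃ k a, (colimit.ι A k).hom a = x := by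
  have := preservesColimitsOfShape_forget (R := R) (K := K)
  exact Concrete.colimit_exists_rep A x

lemma surjective_colimMap (α : A ⟶ B) (h : ∀ k, Function.Surjective (α.app k).hom) :
    Function.Surjective (colimMap α).hom := by
  intro x
  obtain ⟨k, b, rfl⟩ := exists_ι_eq x
  obtain ⟨a, rfl⟩ := h k b
  exact ⟨(colimit.ι A k).hom a, colimMap_ι_apply α k a⟩

lemma exact_colimMap (α : A ⟶ B) (β : B ⟶ C)
    (h : ∀ k, Function.Exact (α.app k).hom (β.app k).hom) :
    Function.Exact (colimMap α).hom (colimMap β).hom := by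
  have := preservesColimitsOfShape_forget (R := R) (K := K)
  intro x
  constructor
  · intro hx
    obtain ⟨k, b, rfl⟩ := exists_ι_eq x
    have h0 : (colimit.ι C k).hom ((β.app k).hom b) = (colimit.ι C k).hom 0 := by
      rw [map_zero]
      exact (colimMap_ι_apply β k b).symm.trans hx
    obtain ⟨l, f, g, hfg⟩ := (Concrete.colimit_rep_eq_iff_exists C _ _).1 h0
    have h1 : (β.app l).hom ((B.map f).hom b) = 0 := by
      have := congrArg (fun φ => φ.hom b) (β.naturality f)
      exact this.trans (hfg.trans (map_zero (C.map g).hom))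
    obtain ⟨a, ha⟩ := (h l _).1 h1
    refine ⟨(colimit.ι A l).hom a, (colimMap_ι_apply α l a).trans ?_⟩
    rw [ha]
    exact congrArg (fun φ => φ.hom b) (colimit.w B f)
  · rintro ⟨z, rfl⟩
    obtain ⟨k, a, rfl⟩ := exists_ι_eq z
    have h1 := (h k ((α.app k).hom a)).2 ⟨a, rfl⟩
    refine (congrArg (colimMap β).hom (colimMap_ι_apply α k a)).trans ?_
    rw [colimMap_ι_apply, h1, map_zero]

end Colimit

variable (J : Ideal R)

/-- The directed system of the modules `Ext^i(R / J^t, M)`. -/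
abbrev system (i : ℕ) (M : ModuleCat.{u} R) : (ℕᵒᵖ)ᵒᵖ ⥤ ModuleCat.{u} R :=
  (localCohomology.ringModIdeals (localCohomology.idealPowersDiagram J)).op ⋙
    ((homFunctor M).leftDerived i).leftOp

/-- The local cohomology of `M` is the colimit of the modules `Ext^i(R / J^t, M)`. -/
def localCohomologyIso (i : ℕ) (M : ModuleCat.{u} R) :
    (localCohomology J i).obj M ≅ colimit (system J i M) :=
  colimitObjIsoColimitCompEvaluation
    (localCohomology.diagram (localCohomology.idealPowersDiagram J) i) M

/-- The map of systems induced by a natural transformation in the opposite category. -/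
abbrev systemMap {i k : ℕ} {M N : ModuleCat.{u} R}
    (α : (homFunctor N).leftDerived k ⟶ (homFunctor M).leftDerived i) :
    system J i M ⟶ system J k N :=
  Functor.whiskerLeft _ (NatTrans.leftOp α)

lemma nonempty_iso_succ (hS : S.ShortExact) [Injective S.X₂] (i : ℕ) :
    Nonempty (colimit (system J (i + 1) S.X₃) ≅ colimit (system J (i + 2) S.X₁)) := by
  have := LeftDerived.isIso_delta (homMap_zero S) (homMap_shortExact hS) (i + 1)
    (fun X => isZero_leftDerived_of_injective S.X₂ X (i + 1))
    (fun X => isZero_leftDerived_of_injective S.X₂ X i)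
  have : ∀ X, IsIso ((systemMap J
      (LeftDerived.delta (homMap_zero S) (homMap_shortExact hS) (i + 1))).app X) := fun X => by
    dsimp [systemMap]
    infer_instance
  have := NatIso.isIso_of_isIso_app (systemMap J
    (LeftDerived.delta (homMap_zero S) (homMap_shortExact hS) (i + 1)))
  exact ⟨HasColimit.isoOfNatIso (asIso (systemMap J
    (LeftDerived.delta (homMap_zero S) (homMap_shortExact hS) (i + 1))))⟩

/-- The right exact sequence `Ext^0(R/J^t, E) → Ext^0(R/J^t, N) → Ext^1(R/J^t, M) → 0`, in the
colimit. -/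
lemma exists_exact (hS : S.ShortExact) [Injective S.X₂] :
    ∃ δ : colimit (system J 0 S.X₃) ⟶ colimit (system J 1 S.X₁),
      Function.Exact (colimMap (systemMap J (NatTrans.leftDerived (homMap S.g) 0))).hom δ.hom ∧
        Function.Surjective δ.hom := by
  let δ := systemMap J (LeftDerived.delta (homMap_zero S) (homMap_shortExact hS) 0)
  have hepi : ∀ X, Epi (δ.app X) := fun X => by
    have := LeftDerived.mono_delta (homMap_zero S) (homMap_shortExact hS) 0
      ((localCohomology.ringModIdeals (localCohomology.idealPowersDiagram J)).obj X.unop)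
      (isZero_leftDerived_of_injective S.X₂ _ 0)
    dsimp [δ, systemMap]
    infer_instance
  refine ⟨colimMap δ, exact_colimMap _ δ fun X => ?_, surjective_colimMap δ fun X =>
    (ModuleCat.epi_iff_surjective _).1 (hepi X)⟩
  exact (ShortComplex.ShortExact.moduleCat_exact_iff_function_exact _).1
    (LeftDerived.delta_exact (homMap_zero S) (homMap_shortExact hS) 0
      ((localCohomology.ringModIdeals (localCohomology.idealPowersDiagram J)).obj X.unop)).unop

/-- The identification of `Ext^0(R / J^t, M)` with `Hom(R / J^t, M)`. -/
def extZeroIso (M X : ModuleCat.{u} R) :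
    (Opposite.unop (((homFunctor M).leftDerived 0).obj X) : ModuleCat.{u} R) ≃ₗ[R] (X ⟶ M) :=
  ((homFunctor M).leftDerivedZeroIsoSelf.app X).unop.symm.toLinearEquiv

lemma extZeroIso_symm_naturality_left (M : ModuleCat.{u} R) {X Y : ModuleCat.{u} R} (f : X ⟶ Y)
    (h : Y ⟶ M) : (((homFunctor M).leftDerived 0).map f).unop.hom ((extZeroIso M Y).symm h) =
      (extZeroIso M X).symm (f ≫ h) :=
  congrArg (fun φ => φ.unop.hom h) ((homFunctor M).fromLeftDerivedZero.naturality f)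

lemma extZeroIso_symm_naturality_right {M N : ModuleCat.{u} R} (X : ModuleCat.{u} R) (f : M ⟶ N)
    (h : X ⟶ M) : ((NatTrans.leftDerived (homMap f) 0).app X).unop.hom ((extZeroIso M X).symm h) =
      (extZeroIso N X).symm (h ≫ f) :=
  congrArg (fun φ => (φ.app X).unop.hom h)
    (LeftDerived.leftDerived_fromLeftDerivedZero (homMap f))

/-- The quotient `R / J^t`. -/
abbrev powQuot (X : (ℕᵒᵖ)ᵒᵖ) : ModuleCat.{u} R :=
  (localCohomology.ringModIdeals (localCohomology.idealPowersDiagram J)).obj X.unop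

/-- The class of `1` in `R / J^t`. -/
def powQuotOne (X : (ℕᵒᵖ)ᵒᵖ) : powQuot J X :=
  Submodule.Quotient.mk (p := J ^ X.unop.unop) (1 : R)

lemma eq_smul_powQuotOne (X : (ℕᵒᵖ)ᵒᵖ) (x : powQuot J X) : ∃ r : R, x = r • powQuotOne J X := by
  obtain ⟨r, rfl⟩ := Submodule.Quotient.mk_surjective _ x
  refine ⟨r, ?_⟩
  rw [powQuotOne]
  exact congrArg Submodule.Quotient.mk (mul_one r).symm

/-- The evaluation at `1` of an element of `Ext^0(R / J^t, M) = Hom(R / J^t, M)`. -/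
def evalOne (M : ModuleCat.{u} R) (X : (ℕᵒᵖ)ᵒᵖ) : (system J 0 M).obj X ⟶ M :=
  ModuleCat.ofHom
    { toFun := fun a => (extZeroIso M (powQuot J X) a).hom (powQuotOne J X)
      map_add' := fun a b => by rw [map_add]; rfl
      map_smul' := fun r a => by rw [map_smul]; rfl }

lemma evalOne_symm (M : ModuleCat.{u} R) (X : (ℕᵒᵖ)ᵒᵖ) (h : powQuot J X ⟶ M) :
    (evalOne J M X).hom ((extZeroIso M (powQuot J X)).symm h) = h.hom (powQuotOne J X) :=
  congrArg (fun g => g.hom (powQuotOne J X)) (LinearEquiv.apply_symm_apply _ h)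

/-- The evaluations at `1` form a cocone. -/
def evalCocone (M : ModuleCat.{u} R) : Cocone (system J 0 M) where
  pt := M
  ι :=
    { app := evalOne J M
      naturality := fun X Y f => by
        refine ModuleCat.hom_ext (LinearMap.ext fun a => ?_)
        obtain ⟨h, rfl⟩ := (extZeroIso M (powQuot J X)).symm.surjective a
        have h1 := extZeroIso_symm_naturality_left M
          ((localCohomology.ringModIdeals (localCohomology.idealPowersDiagram J)).map f.unop) h
        exact (congrArg (evalOne J M Y).hom h1).trans
          ((evalOne_symm J M Y _).trans (evalOne_symm J M X h).symm) }

/-- The map `colim Hom(R / J^t, M) → M` given by the evaluation at `1`. -/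
def evalColimit (M : ModuleCat.{u} R) : colimit (system J 0 M) ⟶ M :=
  colimit.desc (system J 0 M) (evalCocone J M)

lemma evalColimit_ι (M : ModuleCat.{u} R) (X : (ℕᵒᵖ)ᵒᵖ) (a : (system J 0 M).obj X) :
    (evalColimit J M).hom ((colimit.ι (system J 0 M) X).hom a) = (evalOne J M X).hom a := by
  have h : colimit.ι (system J 0 M) X ≫ evalColimit J M = evalOne J M X :=
    colimit.ι_desc (evalCocone J M) X
  exact congrArg (fun f : (system J 0 M).obj X ⟶ M => f.hom a) h

lemma evalColimit_injective (M : ModuleCat.{u} R) :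
    Function.Injective (evalColimit J M).hom := by
  rw [injective_iff_map_eq_zero]
  intro z hz
  obtain ⟨X, a, rfl⟩ := exists_ι_eq z
  obtain ⟨h, rfl⟩ := (extZeroIso M (powQuot J X)).symm.surjective a
  rw [evalColimit_ι, evalOne_symm] at hz
  have : h = 0 := by
    refine ModuleCat.hom_ext (LinearMap.ext fun x => ?_)
    obtain ⟨r, rfl⟩ := eq_smul_powQuotOne J X x
    rw [map_smul, hz, smul_zero]
    rfl
  rw [this, map_zero, map_zero]

lemma evalColimit_naturality {M N : ModuleCat.{u} R} (f : M ⟶ N)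
    (z : (colimit (system J 0 M) : ModuleCat.{u} R)) :
    (evalColimit J N).hom ((colimMap (systemMap J (NatTrans.leftDerived (homMap f) 0))).hom z) =
      f.hom ((evalColimit J M).hom z) := by
  obtain ⟨X, a, rfl⟩ := exists_ι_eq z
  obtain ⟨h, rfl⟩ := (extZeroIso M (powQuot J X)).symm.surjective a
  rw [colimMap_ι_apply, evalColimit_ι, evalColimit_ι, evalOne_symm]
  have h1 := extZeroIso_symm_naturality_right (powQuot J X) f h
  exact (congrArg (evalOne J N X).hom h1).trans (evalOne_symm J N X _)

lemma range_evalColimit {n : ℕ} (y : Fin n → R) (M : ModuleCat.{u} R) :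
    LinearMap.range (evalColimit (Ideal.span (Set.range y)) M).hom = Gamma y M := by
  ext x
  rw [mem_Gamma]
  constructor
  · rintro ⟨z, rfl⟩ j
    obtain ⟨X, a, rfl⟩ := exists_ι_eq z
    obtain ⟨h, rfl⟩ := (extZeroIso M (powQuot (Ideal.span (Set.range y)) X)).symm.surjective a
    refine ⟨X.unop.unop, ?_⟩
    rw [evalColimit_ι, evalOne_symm, ← map_smul]
    have h1 : y j ^ X.unop.unop • powQuotOne (Ideal.span (Set.range y)) X = 0 := by
      refine (Submodule.Quotient.mk_eq_zero (Ideal.span (Set.range y) ^ X.unop.unop)).2 ?_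
      rw [show (fun x => y j ^ X.unop.unop • x) (1 : R) = y j ^ X.unop.unop from mul_one _]
      exact Ideal.pow_mem_pow (Ideal.subset_span (Set.mem_range_self j)) _
    rw [h1, map_zero]
  · intro hx
    -- the annihilator of `x` contains a power of the ideal, which is finitely generated
    obtain ⟨t, ht⟩ : ∃ t, Ideal.span (Set.range y) ^ t ≤
        LinearMap.ker (LinearMap.toSpanSingleton R M x) := by
      refine Ideal.exists_pow_le_of_le_radical_of_fg (Ideal.span_le.2 ?_)
        (Submodule.fg_span (Set.finite_range y))
      rintro _ ⟨j, rfl⟩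
      obtain ⟨k, hk⟩ := hx j
      exact ⟨k, hk⟩
    let X : (ℕᵒᵖ)ᵒᵖ := Opposite.op (Opposite.op t)
    let h : powQuot (Ideal.span (Set.range y)) X ⟶ M :=
      ModuleCat.ofHom (Submodule.liftQ _ (LinearMap.toSpanSingleton R M x) ht)
    refine ⟨(colimit.ι (system (Ideal.span (Set.range y)) 0 M) X).hom
      ((extZeroIso M (powQuot (Ideal.span (Set.range y)) X)).symm h), ?_⟩
    rw [evalColimit_ι, evalOne_symm]
    exact one_smul R x

/-- Local cohomology behaves like the derived functors of the torsion functor. -/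
theorem isGammaTheory {n : ℕ} (y : Fin n → R) :
    IsGammaTheory y (fun i M => (localCohomology (Ideal.span (Set.range y)) i).obj M) where
  zero M := ⟨(localCohomologyIso _ 0 M).toLinearEquiv.trans
    ((LinearEquiv.ofInjective _ (evalColimit_injective _ M)).trans
      (LinearEquiv.ofEq _ _ (range_evalColimit y M)))⟩
  one S hS _ := by
    obtain ⟨δ, hδ, hδ'⟩ := exists_exact (Ideal.span (Set.range y)) hS
    obtain ⟨e⟩ := nonempty_quotient_equiv _ _ hδ hδ' S.g.hom
      (evalColimit (Ideal.span (Set.range y)) S.X₂).hom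
      (evalColimit (Ideal.span (Set.range y)) S.X₃).hom
      (evalColimit_injective _ _) (evalColimit_naturality _ S.g)
    rw [range_evalColimit, range_evalColimit] at e
    exact ⟨(localCohomologyIso _ 1 S.X₁).toLinearEquiv.trans e⟩
  succ S hS _ i := by
    obtain ⟨e⟩ := nonempty_iso_succ (Ideal.span (Set.range y)) hS i
    exact ⟨((localCohomologyIso _ (i + 1) S.X₃).toLinearEquiv.trans e.toLinearEquiv).trans
      (localCohomologyIso _ (i + 2) S.X₁).toLinearEquiv.symm⟩

end ExtColimit
end

/-! ### Comparison of local cohomology with Čech cohomology -/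

noncomputable section
open CategoryTheory Limits TensorProduct

namespace CechSystem

variable {R : Type u} [CommRing R] {n : ℕ} (y : Fin n → R)

/-- The map `M → C^0(M)`. -/
def augmentation (M : ModuleCat.{u} R) : M →ₗ[R] Cochain ((locSystem y).obj M) 0 :=
  LinearMap.pi fun T => TensorProduct.mk R (Cech.Loc y T.1) M 1

lemma augmentation_bijective (M : ModuleCat.{u} R) : Function.Bijective (augmentation y M) := by
  have h0 : ∀ T : Cech.Idx n 0, T = ⟨∅, Finset.card_empty⟩ := fun T =>
    Subtype.ext (Finset.card_eq_zero.1 T.2)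
  constructor
  · rw [injective_iff_map_eq_zero]
    intro x hx
    obtain ⟨k, hk⟩ := (mk_eq_zero_iff y ∅ x).1 (congrFun hx ⟨∅, Finset.card_empty⟩)
    simpa using hk
  · intro z
    obtain ⟨k, x, hx⟩ := exists_pow_smul_eq_mk y (M := M) ∅ (z ⟨∅, Finset.card_empty⟩)
    refine ⟨x, funext fun T => ?_⟩
    obtain rfl := h0 T
    refine hx.symm.trans ?_
    have h1 : (∏ j ∈ (∅ : Finset (Fin n)), y j) ^ k = 1 := by rw [Finset.prod_empty, one_pow]
    refine (congrArg (fun r : R => r • (show Cech.Loc y ∅ ⊗[R] M from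
      z ⟨∅, Finset.card_empty⟩)) h1).trans ?_
    exact one_smul R (show Cech.Loc y ∅ ⊗[R] M from z ⟨∅, Finset.card_empty⟩)

lemma d_augmentation_eq_zero_iff (M : ModuleCat.{u} R) (x : M) :
    d ((locSystem y).obj M) 0 (augmentation y M x) = 0 ↔ x ∈ Gamma y M := by
  have hd : ∀ T, d ((locSystem y).obj M) 0 (augmentation y M x) T =
      ∑ j ∈ T.1.attach, sgn R j.1 T.1 • TensorProduct.mk R (Cech.Loc y T.1) M 1 x := fun T => by
    rw [d_apply]
    refine Finset.sum_congr rfl fun j _ => ?_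
    congr 1
    exact res_mk y M _ x
  rw [mem_Gamma]
  constructor
  · intro h j
    have h1 : ∑ i ∈ Finset.attach {j}, sgn R i.1 {j} •
        TensorProduct.mk R (Cech.Loc y {j}) M 1 x = 0 :=
      (hd ⟨{j}, Finset.card_singleton j⟩).symm.trans (congrFun h _)
    rw [Finset.sum_attach {j} (fun i => sgn R i {j} • TensorProduct.mk R (Cech.Loc y {j}) M 1 x),
      Finset.sum_singleton] at h1
    have h2 : TensorProduct.mk R (Cech.Loc y {j}) M 1 x = 0 := by
      rw [← one_smul R (TensorProduct.mk R (Cech.Loc y {j}) M 1 x), ← sgn_mul_self j {j},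
        mul_smul, h1, smul_zero]
    obtain ⟨k, hk⟩ := (mk_eq_zero_iff y _ x).1 h2
    rw [Finset.prod_singleton] at hk
    exact ⟨k, hk⟩
  · intro h
    funext T
    rw [hd]
    refine Finset.sum_eq_zero fun j _ => ?_
    obtain ⟨k, hk⟩ := h j.1
    have h2 : TensorProduct.mk R (Cech.Loc y T.1) M 1 x = 0 := by
      refine (mk_eq_zero_iff y _ x).2 ⟨k, ?_⟩
      rw [← Finset.mul_prod_erase _ _ j.2, mul_comm, mul_pow, mul_smul, hk, smul_zero]
    rw [h2]
    exact smul_zero (A := Cech.Loc y T.1 ⊗[R] M) _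

/-- The inclusion of the zeroth cohomology of a cochain complex. -/
def homologyZeroι (K : CochainComplex (ModuleCat.{u} R) ℕ) : K.homology 0 ⟶ K.X 0 :=
  (CochainComplex.isoHomologyπ₀ K).inv ≫ K.iCycles 0

lemma homologyZeroι_injective (K : CochainComplex (ModuleCat.{u} R) ℕ) :
    Function.Injective (homologyZeroι K).hom :=
  (ModuleCat.mono_iff_injective (homologyZeroι K)).1 (by unfold homologyZeroι; infer_instance)

lemma homologyZeroι_naturality {K L : CochainComplex (ModuleCat.{u} R) ℕ} (φ : K ⟶ L) :
    HomologicalComplex.homologyMap φ 0 ≫ homologyZeroι L = homologyZeroι K ≫ φ.f 0 := by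
  rw [homologyZeroι, homologyZeroι, Category.assoc, ← HomologicalComplex.cyclesMap_i,
    ← cancel_epi (CochainComplex.isoHomologyπ₀ K).hom, Iso.hom_inv_id_assoc]
  change HomologicalComplex.homologyπ K 0 ≫ _ = _
  rw [HomologicalComplex.homologyπ_naturality_assoc]
  congr 1
  exact Iso.hom_inv_id_assoc (CochainComplex.isoHomologyπ₀ L) _

lemma range_homologyZeroι (K : CochainComplex (ModuleCat.{u} R) ℕ) :
    LinearMap.range (homologyZeroι K).hom = LinearMap.ker (K.d 0 1).hom := by
  ext x
  constructor
  · rintro ⟨z, rfl⟩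
    have : homologyZeroι K ≫ K.d 0 1 = 0 := by simp [homologyZeroι]
    exact congrArg (fun f => f.hom z) this
  · intro hx
    have hex : (ShortComplex.mk (K.iCycles 0) (K.d 0 1) (by simp)).Exact :=
      ShortComplex.exact_of_f_is_kernel _ (K.cyclesIsKernel 0 1 (by simp))
    obtain ⟨c, hc⟩ := (ShortComplex.moduleCat_exact_iff _).1 hex x hx
    refine ⟨(CochainComplex.isoHomologyπ₀ K).hom.hom c, ?_⟩
    have : (CochainComplex.isoHomologyπ₀ K).hom ≫ homologyZeroι K = K.iCycles 0 := by
      simp [homologyZeroι]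
    exact (congrArg (fun f => f.hom c) this).trans hc

/-- The inclusion of the zeroth Čech cohomology of `M` into `M`. -/
def zeroToModule (M : ModuleCat.{u} R) : ((cech y).obj M).homology 0 →ₗ[R] M :=
  (LinearEquiv.ofBijective _ (augmentation_bijective y M)).symm.toLinearMap ∘ₗ
    (homologyZeroι ((cech y).obj M)).hom

lemma augmentation_zeroToModule (M : ModuleCat.{u} R) (z : ((cech y).obj M).homology 0) :
    augmentation y M (zeroToModule y M z) = (homologyZeroι ((cech y).obj M)).hom z :=
  LinearEquiv.apply_symm_apply (LinearEquiv.ofBijective _ (augmentation_bijective y M)) _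

lemma zeroToModule_injective (M : ModuleCat.{u} R) : Function.Injective (zeroToModule y M) := by
  intro a b hab
  apply homologyZeroι_injective
  rw [← augmentation_zeroToModule, hab, augmentation_zeroToModule]

lemma zeroToModule_naturality {M N : ModuleCat.{u} R} (f : M ⟶ N)
    (z : ((cech y).obj M).homology 0) :
    zeroToModule y N ((HomologicalComplex.homologyMap ((cech y).map f) 0).hom z) =
      f.hom (zeroToModule y M z) := by
  apply (augmentation_bijective y N).1
  rw [augmentation_zeroToModule]
  have h1 := congrArg (fun f => f.hom z) (homologyZeroι_naturality ((cech y).map f))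
  refine h1.trans ?_
  refine (congrArg (((cech y).map f).f 0).hom (augmentation_zeroToModule y M z).symm).trans ?_
  rfl

lemma range_zeroToModule (M : ModuleCat.{u} R) :
    LinearMap.range (zeroToModule y M) = Gamma y M := by
  ext x
  rw [← d_augmentation_eq_zero_iff]
  have hd : d ((locSystem y).obj M) 0 (augmentation y M x) = 0 ↔
      augmentation y M x ∈ LinearMap.range (homologyZeroι ((cech y).obj M)).hom := by
    rw [range_homologyZeroι]
    have := complex_obj_d ((locSystem y).obj M) 0 (augmentation y M x)
    rw [← this]
    rfl
  rw [hd]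
  constructor
  · rintro ⟨z, rfl⟩
    exact ⟨z, (augmentation_zeroToModule y M z).symm⟩
  · rintro ⟨z, hz⟩
    exact ⟨z, (augmentation_bijective y M).1 ((augmentation_zeroToModule y M z).trans hz)⟩

/-- Over a noetherian ring, Čech cohomology behaves like the derived functors of the torsion
functor. -/
theorem isGammaTheory [IsNoetherianRing R] :
    IsGammaTheory y (fun i M => ((cech y).obj M).homology i) where
  zero M := ⟨(LinearEquiv.ofInjective _ (zeroToModule_injective y M)).trans
      (LinearEquiv.ofEq _ _ (range_zeroToModule y M))⟩
  one S hS hE := by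
    have hC := cech_shortExact y hS
    have hz : IsZero (((cech y).obj S.X₂).homology 1) :=
      isZero_cech_homology_of_injective y Finset.univ S.X₂
        (Module.injective_module_of_injective_object R S.X₂ (inj := hE)) (by simp) 0
    have hex : Function.Exact (HomologicalComplex.homologyMap ((cech y).map S.g) 0).hom
        (hC.δ 0 1 (by simp)).hom :=
      (ShortComplex.ShortExact.moduleCat_exact_iff_function_exact _).1
        (hC.homology_exact₃ 0 1 (by simp))
    have hepi : Epi (hC.δ 0 1 (by simp)) := (hC.homology_exact₁ 0 1 (by simp)).epi_f
      (hz.eq_of_tgt _ _)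
    have e := nonempty_quotient_equiv (A := ((cech y).obj S.X₂).homology 0)
      (B := ((cech y).obj S.X₃).homology 0) (C := ((cech y).obj S.X₁).homology 1)
      _ _ hex ((ModuleCat.epi_iff_surjective _).1 hepi) S.g.hom
      (zeroToModule y S.X₂) (zeroToModule y S.X₃)
      (zeroToModule_injective _ _) (zeroToModule_naturality y S.g)
    rwa [range_zeroToModule, range_zeroToModule] at e
  succ S hS hE i := by
    have hC := cech_shortExact y hS
    have hz : ∀ i, IsZero (((cech y).obj S.X₂).homology (i + 1)) :=
      isZero_cech_homology_of_injective y Finset.univ S.X₂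
        (Module.injective_module_of_injective_object R S.X₂ (inj := hE)) (by simp)
    have hr : (ComplexShape.up ℕ).Rel (i + 1) (i + 2) := rfl
    have hepi : Epi (hC.δ (i + 1) (i + 2) hr) :=
      (hC.homology_exact₁ (i + 1) (i + 2) hr).epi_f ((hz (i + 1)).eq_of_tgt _ _)
    have hmono : Mono (hC.δ (i + 1) (i + 2) hr) :=
      (hC.homology_exact₃ (i + 1) (i + 2) hr).mono_g ((hz i).eq_of_src _ _)
    have : IsIso (hC.δ (i + 1) (i + 2) hr) := isIso_of_mono_of_epi _
    exact ⟨(asIso (hC.δ (i + 1) (i + 2) hr)).toLinearEquiv⟩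

/-- The system of the localizations `R_{y_T}`. -/
def ringSystem : Finset (Fin n) ⥤ ModuleCat.{u} R where
  obj T := ModuleCat.of R (Cech.Loc y T)
  map f := ModuleCat.ofHom (Cech.nat y (leOfHom f)).toLinearMap
  map_id _ := ModuleCat.hom_ext (LinearMap.ext fun z => nat_refl y subset_rfl z)
  map_comp f g := ModuleCat.hom_ext (LinearMap.ext fun z =>
    (nat_nat y (leOfHom f) (leOfHom g) z).symm)

/-- The isomorphism `R_{y_T} ⊗ R ≅ R_{y_T}`. -/
def locSystemIso : (locSystem y).obj (ModuleCat.of R R) ≅ ringSystem y :=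
  NatIso.ofComponents (fun T => (TensorProduct.rid R (Cech.Loc y T)).toModuleIso) (fun {S T} f => by
    refine ModuleCat.hom_ext (TensorProduct.ext' fun z r => ?_)
    exact (map_smul (Cech.nat y (leOfHom f)) r z).symm)

/-- The homology of a cochain complex in a positive degree. -/
def homologySuccEquiv (K : CochainComplex (ModuleCat.{u} R) ℕ) (t : ℕ) :
    K.homology (t + 1) ≃ₗ[R] (LinearMap.ker (K.d (t + 1) (t + 2)).hom ⧸
      (LinearMap.range (K.d t (t + 1)).hom).submoduleOf
        (LinearMap.ker (K.d (t + 1) (t + 2)).hom)) :=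
  (ShortComplex.homologyMapIso (K.isoSc' t (t + 1) (t + 2) (by simp) (by simp))).toLinearEquiv.trans
    (ShortComplex.homologyEquiv _)

/-- The homology of a cochain complex in degree zero. -/
def homologyZeroEquiv (K : CochainComplex (ModuleCat.{u} R) ℕ) :
    K.homology 0 ≃ₗ[R] LinearMap.ker (K.d 0 1).hom :=
  (LinearEquiv.ofInjective _ (homologyZeroι_injective K)).trans
    (LinearEquiv.ofEq _ _ (range_homologyZeroι K))

/-- The homology of the Čech complex of `R` is its cohomology in the elementary sense. -/
lemma nonempty_cohomology_equiv (i : ℕ) :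
    Nonempty (((cech y).obj (ModuleCat.of R R)).homology i ≃ₗ[R] Cech.Cohomology y i) := by
  have e : ((cech y).obj (ModuleCat.of R R)).homology i ≃ₗ[R]
      (complex.obj (ringSystem y)).homology i :=
    ((HomologicalComplex.homologyFunctor _ _ i).mapIso
      (complex.mapIso (locSystemIso y))).toLinearEquiv
  have hd : ∀ t, ((complex.obj (ringSystem y)).d t (t + 1)).hom = Cech.d y t := fun t =>
    LinearMap.ext fun z => complex_obj_d (ringSystem y) t z
  cases i with
  | zero =>
    refine ⟨e.trans ((homologyZeroEquiv _).trans ((LinearEquiv.ofEq _ _ ?_).trans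
      (Submodule.quotEquivOfEqBot
        ((Cech.coboundaries y 0).submoduleOf (Cech.cocycles y 0)) ?_).symm))⟩
    · rw [Cech.cocycles, ← hd 0]
      rfl
    · rw [Cech.coboundaries, Submodule.submoduleOf, Submodule.comap_bot, Submodule.ker_subtype]
  | succ t =>
    have e' := homologySuccEquiv (complex.obj (ringSystem y)) t
    have hd' : ((complex.obj (ringSystem y)).d (t + 1) (t + 2)).hom = Cech.d y (t + 1) := hd (t + 1)
    rw [hd t, hd'] at e'
    exact ⟨e.trans e'⟩

end CechSystem

/-- Over a noetherian ring, the local cohomology with support in `(y_1, …, y_n)` is the cohomology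
of the Čech complex. -/
theorem nonempty_localCohomology_equiv_cech {R : Type u} [CommRing R] [IsNoetherianRing R] {n : ℕ}
    (y : Fin n → R) (i : ℕ) :
    Nonempty ((localCohomology (Ideal.span (Set.range y)) i).obj (ModuleCat.of R R) ≃ₗ[R]
      Cech.Cohomology y i) :=
  ⟨((ExtColimit.isGammaTheory y).nonempty_linearEquiv (CechSystem.isGammaTheory y) i _).some.trans
    (CechSystem.nonempty_cohomology_equiv y i).some⟩
end

/-! ### Monomials and bidegrees -/

noncomputable section
open MvPolynomial

namespace StanleyReisner

variable {K : Type u} [Field K] {m n : ℕ}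

/-- The bidegree of a monomial of the polynomial ring. -/
def bideg : ((Fin m ⊕ Fin n) →₀ ℕ) →+ Bidegree m n where
  toFun e := (fun i => (e (Sum.inl i) : ℤ), fun j => (e (Sum.inr j) : ℤ))
  map_zero' := by ext <;> simp
  map_add' e e' := by ext <;> simp

/-- The coordinate of a bidegree at a vertex. -/
def coord (c : Bidegree m n) (v : Fin m ⊕ Fin n) : ℤ := Sum.elim c.1 c.2 v

lemma bidegree_ext {c c' : Bidegree m n} (h : ∀ v, coord c v = coord c' v) : c = c' :=
  Prod.ext (funext fun i => h (Sum.inl i)) (funext fun j => h (Sum.inr j))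

@[simp] lemma coord_add (c c' : Bidegree m n) (v) : coord (c + c') v = coord c v + coord c' v := by
  cases v <;> rfl

@[simp] lemma coord_sub (c c' : Bidegree m n) (v) : coord (c - c') v = coord c v - coord c' v := by
  cases v <;> rfl

@[simp] lemma coord_nsmul (l : ℕ) (c : Bidegree m n) (v) : coord (l • c) v = l * coord c v := by
  cases v <;> simp [coord]

@[simp] lemma coord_bideg (e : (Fin m ⊕ Fin n) →₀ ℕ) (v) : coord (bideg e) v = e v := by
  cases v <;> rfl

/-- The vertices of `T ⊆ W` as vertices of `V ⊔ W`. -/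
abbrev vert (m : ℕ) (T : Finset (Fin n)) : Finset (Fin m ⊕ Fin n) := T.map Function.Embedding.inr

/-- The exponent of `∏ j ∈ T, Y_j`. -/
def expo (m : ℕ) (T : Finset (Fin n)) : (Fin m ⊕ Fin n) →₀ ℕ :=
  ∑ v ∈ vert m T, Finsupp.single v 1

lemma expo_apply (T : Finset (Fin n)) (v : Fin m ⊕ Fin n) :
    expo m T v = if v ∈ vert m T then 1 else 0 := by
  rw [expo, Finsupp.finsetSum_apply]
  simp only [Finsupp.single_apply]
  exact Finset.sum_ite_eq' _ _ _

lemma support_expo (T : Finset (Fin n)) : (expo m T).support = vert m T := by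
  ext v
  rw [Finsupp.mem_support_iff, expo_apply]
  simp

lemma inr_mem_vert {T : Finset (Fin n)} {j : Fin n} : Sum.inr j ∈ vert m T ↔ j ∈ T := by
  simp [vert]

lemma inl_notMem_vert {T : Finset (Fin n)} {k : Fin m} : Sum.inl k ∉ vert m T := by
  simp [vert]

lemma prod_X_eq_monomial (B : Finset (Fin m ⊕ Fin n)) :
    ∏ v ∈ B, (X v : PolyRing K m n) = monomial (∑ v ∈ B, Finsupp.single v 1) 1 :=
  (monomial_sum_one B _).symm

variable (I : Ideal (PolyRing K m n))

lemma prod_y_eq (T : Finset (Fin n)) :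
    ∏ j ∈ T, y I j = Ideal.Quotient.mk I (monomial (expo m T) 1) := by
  rw [expo, ← prod_X_eq_monomial, map_prod, Finset.prod_map]
  rfl

/-- A monomial whose support is not a face vanishes in the Stanley–Reisner ring. -/
lemma monomial_mem_of_support_notMem {e : (Fin m ⊕ Fin n) →₀ ℕ} (he : e.support ∉ complex I)
    (k : K) : monomial e k ∈ I := by
  have h1 : ∏ v ∈ e.support, (X v : PolyRing K m n) ∈ I := not_not.1 he
  refine I.mem_of_dvd ?_ h1
  rw [monomial_eq]
  refine Dvd.dvd.mul_left ?_ _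
  rw [Finsupp.prod]
  exact Finset.prod_dvd_prod_of_dvd _ _ fun v hv =>
    dvd_pow_self _ (Finsupp.mem_support_iff.1 hv)

/-! ### Restriction to a face -/

section Restriction

variable (σ : Finset (Fin m ⊕ Fin n))

/-- Setting the variables outside `σ` to zero. -/
def kill : PolyRing K m n →ₐ[K] PolyRing K m n := aeval fun v => if v ∈ σ then X v else 0

lemma kill_monomial (e : (Fin m ⊕ Fin n) →₀ ℕ) (k : K) :
    kill σ (monomial e k) = if e.support ⊆ σ then monomial e k else 0 := by
  rw [kill, aeval_monomial]
  split_ifs with h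
  · rw [monomial_eq]
    congr 1
    exact Finset.prod_congr rfl fun v hv => by
      simp only [if_pos (h hv)]
  · obtain ⟨v, hv, hvσ⟩ := Finset.not_subset.1 h
    refine mul_eq_zero_of_right _ (Finset.prod_eq_zero hv ?_)
    simp only [if_neg hvσ]
    exact zero_pow (Finsupp.mem_support_iff.1 hv)

/-- The ring of Laurent polynomials. -/
abbrev Laurent (K : Type u) [Field K] (m n : ℕ) : Type u := AddMonoidAlgebra K (Bidegree m n)

/-- The map from the polynomial ring to the Laurent polynomials which sets the variables outside
`σ` to zero. -/
def toLaurent : PolyRing K m n →ₐ[K] Laurent K m n :=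
  (AddMonoidAlgebra.mapDomainAlgHom K K (bideg (m := m) (n := n))).comp (kill σ)

lemma toLaurent_monomial (e : (Fin m ⊕ Fin n) →₀ ℕ) (k : K) :
    toLaurent σ (monomial e k) =
      if e.support ⊆ σ then AddMonoidAlgebra.single (bideg e) k else 0 := by
  rw [toLaurent, AlgHom.comp_apply, kill_monomial]
  split_ifs
  · exact AddMonoidAlgebra.mapDomain_single
  · exact map_zero _

variable {I σ}

lemma toLaurent_eq_zero (hI : IsSquarefreeMonomialIdeal I) (hσ : σ ∈ complex I)
    {p : PolyRing K m n} (hp : p ∈ I) : toLaurent σ p = 0 := by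
  obtain ⟨A, hA⟩ := hI
  suffices h : I ≤ RingHom.ker (toLaurent σ : PolyRing K m n →ₐ[K] Laurent K m n) from h hp
  nth_rewrite 1 [hA]
  rw [Ideal.span_le]
  rintro _ ⟨B, hB, rfl⟩
  have hBσ : ¬ B ⊆ σ := fun h => (complex I).lower h hσ (hA ▸ Ideal.subset_span ⟨B, hB, rfl⟩)
  obtain ⟨v, hv, hvσ⟩ := Finset.not_subset.1 hBσ
  change toLaurent σ (∏ v ∈ B, X v) = 0
  rw [toLaurent, AlgHom.comp_apply, map_prod, Finset.prod_eq_zero hv, map_zero]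
  rw [kill, aeval_X, if_neg hvσ]

/-- The map from the Stanley–Reisner ring to the Laurent polynomials given by a face. -/
def quotToLaurent (hI : IsSquarefreeMonomialIdeal I) (hσ : σ ∈ complex I) :
    Quot I →ₐ[K] Laurent K m n :=
  Ideal.Quotient.liftₐ I (toLaurent σ) fun _ hp => toLaurent_eq_zero hI hσ hp

lemma quotToLaurent_mk (hI : IsSquarefreeMonomialIdeal I) (hσ : σ ∈ complex I)
    (p : PolyRing K m n) : quotToLaurent hI hσ (Ideal.Quotient.mk I p) = toLaurent σ p := rfl

/-- The image of `y_T` is invertible if `T` is contained in the face. -/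
lemma quotToLaurent_prod_y (hI : IsSquarefreeMonomialIdeal I) (hσ : σ ∈ complex I)
    {T : Finset (Fin n)} (hT : vert m T ⊆ σ) :
    quotToLaurent hI hσ (∏ j ∈ T, y I j) = AddMonoidAlgebra.single (bideg (expo m T)) 1 := by
  rw [prod_y_eq, quotToLaurent_mk, toLaurent_monomial, if_pos]
  rwa [support_expo]

lemma isUnit_quotToLaurent (hI : IsSquarefreeMonomialIdeal I) (hσ : σ ∈ complex I)
    {T : Finset (Fin n)} (hT : vert m T ⊆ σ) :
    ∀ s : Submonoid.powers (∏ j ∈ T, y I j), IsUnit (quotToLaurent hI hσ s) := by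
  rintro ⟨_, k, rfl⟩
  simp only [map_pow]
  refine IsUnit.pow k ?_
  rw [quotToLaurent_prod_y hI hσ hT]
  refine IsUnit.of_mul_eq_one (AddMonoidAlgebra.single (-(bideg (expo m T))) 1) ?_
  rw [AddMonoidAlgebra.single_mul_single, add_neg_cancel, one_mul]
  rfl

/-- The map from the localization at `y_T` to the Laurent polynomials given by a face containing
`T`. -/
def locToLaurent (hI : IsSquarefreeMonomialIdeal I) (hσ : σ ∈ complex I)
    {T : Finset (Fin n)} (hT : vert m T ⊆ σ) : Cech.Loc (y I) T →ₐ[K] Laurent K m n :=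
  IsLocalization.liftAlgHom (M := Submonoid.powers (∏ j ∈ T, y I j))
    (f := quotToLaurent hI hσ) (isUnit_quotToLaurent hI hσ hT)

end Restriction

/-- The fraction `k X^e / y_T^l`. -/
def frac (T : Finset (Fin n)) (e : (Fin m ⊕ Fin n) →₀ ℕ) (k : K) (l : ℕ) : Cech.Loc (y I) T :=
  Localization.mk (Ideal.Quotient.mk I (monomial e k))
      (⟨(∏ j ∈ T, y I j) ^ l, l, rfl⟩ : Submonoid.powers (∏ j ∈ T, y I j))

lemma algebraMap_pow_mul_frac (T : Finset (Fin n)) (e : (Fin m ⊕ Fin n) →₀ ℕ) (k : K) (l : ℕ) :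
    algebraMap (Quot I) (Cech.Loc (y I) T) ((∏ j ∈ T, y I j) ^ l) * frac I T e k l =
      algebraMap (Quot I) (Cech.Loc (y I) T) (Ideal.Quotient.mk I (monomial e k)) := by
  rw [frac, Localization.mk_eq_mk']
  exact IsLocalization.mk'_spec' _ _ (⟨(∏ j ∈ T, y I j) ^ l, l, rfl⟩ :
    Submonoid.powers (∏ j ∈ T, y I j))

variable {I}

lemma locToLaurent_frac {σ : Finset (Fin m ⊕ Fin n)} (hI : IsSquarefreeMonomialIdeal I)
    (hσ : σ ∈ complex I) {T : Finset (Fin n)} (hT : vert m T ⊆ σ) (e : (Fin m ⊕ Fin n) →₀ ℕ)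
    (k : K) (l : ℕ) : locToLaurent hI hσ hT (frac I T e k l) =
      if e.support ⊆ σ then AddMonoidAlgebra.single (bideg e - l • bideg (expo m T)) k else 0 := by
  have h1 := congrArg (locToLaurent hI hσ hT) (algebraMap_pow_mul_frac I T e k l)
  have h2 : ∀ r, locToLaurent hI hσ hT (algebraMap (Quot I) (Cech.Loc (y I) T) r) =
      quotToLaurent hI hσ r := fun r => IsLocalization.lift_eq _ r
  rw [map_mul, h2, h2, quotToLaurent_mk, toLaurent_monomial, map_pow,
    quotToLaurent_prod_y hI hσ hT, AddMonoidAlgebra.single_pow, one_pow] at h1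
  have h3 := congrArg (AddMonoidAlgebra.single (-(l • bideg (expo m T))) (1 : K) * ·) h1
  simp only [← mul_assoc, AddMonoidAlgebra.single_mul_single, neg_add_cancel, one_mul, mul_ite,
    mul_zero] at h3
  rw [← AddMonoidAlgebra.one_def, one_mul, neg_add_eq_sub] at h3
  exact h3

end StanleyReisner
end

/-! ### The components of the localizations -/

noncomputable section
open MvPolynomial

namespace StanleyReisner

variable {K : Type u} [Field K] {m n : ℕ} {I : Ideal (PolyRing K m n)}

lemma bideg_injective : Function.Injective (bideg (m := m) (n := n)) := by
  intro e e' h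
  ext v
  have := congrArg (fun c => coord c v) h
  simpa using this

lemma isUnit_algebraMap_pow (T : Finset (Fin n)) (l : ℕ) :
    IsUnit (algebraMap (Quot I) (Cech.Loc (y I) T) ((∏ j ∈ T, y I j) ^ l)) :=
  IsLocalization.map_units (Cech.Loc (y I) T)
    (⟨(∏ j ∈ T, y I j) ^ l, l, rfl⟩ : Submonoid.powers (∏ j ∈ T, y I j))

lemma pow_prod_y_mul (T : Finset (Fin n)) (l : ℕ) (e : (Fin m ⊕ Fin n) →₀ ℕ) (k : K) :
    (∏ j ∈ T, y I j) ^ l * Ideal.Quotient.mk I (monomial e k) =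
      Ideal.Quotient.mk I (monomial (l • expo m T + e) k) := by
  rw [prod_y_eq, ← map_pow, ← map_mul, monomial_pow, monomial_mul, one_pow, one_mul]

/-- A fraction with monomial numerator is determined by its bidegree. -/
lemma frac_eq_frac (T : Finset (Fin n)) {e e' : (Fin m ⊕ Fin n) →₀ ℕ} {l l' : ℕ} (k : K)
    (h : bideg e - l • bideg (expo m T) = bideg e' - l' • bideg (expo m T)) :
    frac I T e k l = frac I T e' k l' := by
  have h1 : l' • expo m T + e = l • expo m T + e' := by
    apply bideg_injective
    rw [map_add, map_add, map_nsmul, map_nsmul]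
    rw [sub_eq_sub_iff_add_eq_add] at h
    rw [add_comm, h, add_comm]
  apply ((isUnit_algebraMap_pow T l').mul (isUnit_algebraMap_pow T l)).mul_right_injective
  simp only
  rw [mul_assoc, algebraMap_pow_mul_frac, ← map_mul, pow_prod_y_mul, h1, mul_comm, ← mul_assoc,
    mul_comm (frac I T e' k l'), algebraMap_pow_mul_frac, mul_comm, ← map_mul, pow_prod_y_mul]

/-- A fraction vanishes if its support together with `T` is not a face. -/
lemma frac_eq_zero (T : Finset (Fin n)) {e : (Fin m ⊕ Fin n) →₀ ℕ} (l : ℕ) (k : K)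
    (h : e.support ∪ vert m T ∉ complex I) : frac I T e k l = 0 := by
  apply ((isUnit_algebraMap_pow T 1).mul (isUnit_algebraMap_pow T l)).mul_right_injective
  simp only
  rw [mul_assoc, algebraMap_pow_mul_frac, ← map_mul, pow_prod_y_mul, mul_zero, one_smul]
  have h1 : (expo m T + e).support = e.support ∪ vert m T := by
    ext v
    simp only [Finsupp.mem_support_iff, Finsupp.add_apply, expo_apply, Finset.mem_union]
    split_ifs with hv <;> simp [hv]
  rw [Ideal.Quotient.eq_zero_iff_mem.2 (monomial_mem_of_support_notMem I (h1 ▸ h) k), map_zero]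

lemma frac_smul (T : Finset (Fin n)) (e : (Fin m ⊕ Fin n) →₀ ℕ) (k : K) (l : ℕ) :
    frac I T e k l = k • frac I T e 1 l := by
  have : monomial e k = k • monomial e (1 : K) := by rw [smul_monomial, smul_eq_mul, mul_one]
  rw [frac, frac, Localization.smul_mk, this]
  rfl

/-- The localization at `y_T` is spanned by fractions with monomial numerators. -/
lemma loc_induction {T : Finset (Fin n)} {p : Cech.Loc (y I) T → Prop}
    (hfrac : ∀ e k l, p (frac I T e k l)) (hadd : ∀ a b, p a → p b → p (a + b))
    (z : Cech.Loc (y I) T) : p z := by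
  induction z using Localization.induction_on with
  | _ rs =>
    obtain ⟨r, ⟨_, l, rfl⟩⟩ := rs
    obtain ⟨q, rfl⟩ := Ideal.Quotient.mk_surjective r
    induction q using MvPolynomial.induction_on' with
    | monomial e k => exact hfrac e k l
    | add a b ha hb =>
      have := hadd _ _ ha hb
      rwa [Localization.add_mk_self, ← map_add] at this

/-- The set of vertices at which a bidegree does not vanish. -/
def supp (c : Bidegree m n) : Finset (Fin m ⊕ Fin n) := Finset.univ.filter fun v => coord c v ≠ 0

lemma mem_supp {c : Bidegree m n} {v : Fin m ⊕ Fin n} : v ∈ supp c ↔ coord c v ≠ 0 := by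
  simp [supp]

/-- The bidegrees of the nonzero fractions with monomial numerators and denominators a power
of `y_T`. -/
def Adm (I : Ideal (PolyRing K m n)) (T : Finset (Fin n)) (c : Bidegree m n) : Prop :=
  (∀ v ∉ vert m T, 0 ≤ coord c v) ∧ supp c ∪ vert m T ∈ complex I

lemma coord_frac (T : Finset (Fin n)) (e : (Fin m ⊕ Fin n) →₀ ℕ) (l : ℕ) (v : Fin m ⊕ Fin n) :
    coord (bideg e - l • bideg (expo m T)) v = e v - if v ∈ vert m T then (l : ℤ) else 0 := by
  rw [coord_sub, coord_nsmul, coord_bideg, coord_bideg, expo_apply]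
  split_ifs <;> simp

lemma supp_union_vert (T : Finset (Fin n)) (e : (Fin m ⊕ Fin n) →₀ ℕ) (l : ℕ) :
    supp (bideg e - l • bideg (expo m T)) ∪ vert m T = e.support ∪ vert m T := by
  ext v
  by_cases hv : v ∈ vert m T
  · simp only [Finset.mem_union, hv, or_true]
  · simp only [Finset.mem_union, hv, or_false, mem_supp, coord_frac, if_false,
      Finsupp.mem_support_iff, sub_zero, Nat.cast_ne_zero]

open Classical in
/-- The fraction with monomial numerator of bidegree `c`, and zero if there is none. -/
def mon (I : Ideal (PolyRing K m n)) (T : Finset (Fin n)) (c : Bidegree m n) :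
    Cech.Loc (y I) T :=
  if h : ∃ p : ((Fin m ⊕ Fin n) →₀ ℕ) × ℕ, bideg p.1 - p.2 • bideg (expo m T) = c then
    frac I T h.choose.1 1 h.choose.2 else 0

lemma frac_eq_smul_mon (T : Finset (Fin n)) (e : (Fin m ⊕ Fin n) →₀ ℕ) (k : K) (l : ℕ) :
    frac I T e k l = k • mon I T (bideg e - l • bideg (expo m T)) := by
  have h : ∃ p : ((Fin m ⊕ Fin n) →₀ ℕ) × ℕ,
      bideg p.1 - p.2 • bideg (expo m T) = bideg e - l • bideg (expo m T) := ⟨(e, l), rfl⟩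
  rw [mon, dif_pos h, frac_smul]
  congr 1
  exact frac_eq_frac T 1 h.choose_spec.symm

/-- A bidegree that is nonnegative outside `T` is the bidegree of a fraction. -/
lemma exists_bideg_eq {T : Finset (Fin n)} {c : Bidegree m n}
    (h : ∀ v ∉ vert m T, 0 ≤ coord c v) :
    ∃ p : ((Fin m ⊕ Fin n) →₀ ℕ) × ℕ, bideg p.1 - p.2 • bideg (expo m T) = c := by
  let l : ℕ := ∑ v, (coord c v).natAbs
  have hl : ∀ v, -(l : ℤ) ≤ coord c v := fun v => by
    have h1 : (coord c v).natAbs ≤ l :=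
      Finset.single_le_sum (f := fun v => (coord c v).natAbs) (fun _ _ => Nat.zero_le _)
        (Finset.mem_univ v)
    omega
  refine ⟨(Finsupp.equivFunOnFinite.symm
    fun v => (coord c v + if v ∈ vert m T then (l : ℤ) else 0).toNat, l), ?_⟩
  refine bidegree_ext fun v => ?_
  rw [coord_frac]
  simp only [Finsupp.equivFunOnFinite_symm_apply_apply]
  rw [Int.toNat_of_nonneg, add_sub_cancel_right]
  split_ifs with hv
  · have := hl v
    omega
  · have := h v hv
    omega

lemma mon_eq_zero {T : Finset (Fin n)} {c : Bidegree m n} (h : ¬ Adm I T c) : mon I T c = 0 := by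
  by_cases hc : ∃ p : ((Fin m ⊕ Fin n) →₀ ℕ) × ℕ, bideg p.1 - p.2 • bideg (expo m T) = c
  · obtain ⟨⟨e, l⟩, rfl⟩ := hc
    have h1 := frac_eq_smul_mon (I := I) T e 1 l
    rw [one_smul] at h1
    rw [← h1]
    apply frac_eq_zero
    rw [← supp_union_vert T e l]
    refine fun h2 => h ⟨fun v hv => ?_, h2⟩
    rw [coord_frac, if_neg hv]
    simp
  · rw [mon, dif_neg hc]

lemma loc_induction' {T : Finset (Fin n)} {p : Cech.Loc (y I) T → Prop}
    (hmon : ∀ c (k : K), p (k • mon I T c)) (hadd : ∀ a b, p a → p b → p (a + b))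
    (z : Cech.Loc (y I) T) : p z :=
  loc_induction (fun e k l => by rw [frac_eq_smul_mon]; exact hmon _ _) hadd z

lemma nat_frac {T T' : Finset (Fin n)} (h : T ⊆ T') (e : (Fin m ⊕ Fin n) →₀ ℕ) (k : K) (l : ℕ) :
    Cech.nat (y I) h (frac I T e k l) =
      frac I T' (l • expo m (T' \ T) + e) k l := by
  apply (isUnit_algebraMap_pow T' l).mul_right_injective
  simp only
  have h1 := congrArg (Cech.nat (y I) h) (algebraMap_pow_mul_frac I T e k l)
  rw [map_mul, AlgHom.commutes, AlgHom.commutes] at h1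
  have h2 : (∏ j ∈ T', y I j) ^ l = (∏ j ∈ T' \ T, y I j) ^ l * (∏ j ∈ T, y I j) ^ l := by
    rw [← mul_pow, Finset.prod_sdiff h]
  rw [algebraMap_pow_mul_frac, ← pow_prod_y_mul, map_mul, ← h1, ← mul_assoc, ← map_mul, ← h2]

/-- The transition maps send monomials to monomials, provided that there is a fraction of bidegree
`c` in the source; otherwise `mon I T c` is zero by convention. -/
lemma nat_mon {T T' : Finset (Fin n)} (h : T ⊆ T') {c : Bidegree m n}
    (hc : ∀ v ∉ vert m T, 0 ≤ coord c v) : Cech.nat (y I) h (mon I T c) = mon I T' c := by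
  obtain ⟨⟨e, l⟩, rfl⟩ := exists_bideg_eq hc
  have h1 := frac_eq_smul_mon (I := I) T e 1 l
  rw [one_smul] at h1
  rw [← h1, nat_frac, frac_eq_smul_mon, one_smul]
  congr 1
  refine bidegree_ext fun v => ?_
  simp only [coord_frac, Finsupp.add_apply, Finsupp.smul_apply, expo_apply]
  have h2 : v ∈ vert m T' ↔ v ∈ vert m (T' \ T) ∨ v ∈ vert m T := by
    cases v with
    | inl k => simp [vert]
    | inr j =>
      simp only [inr_mem_vert, Finset.mem_sdiff]
      have := @h j
      tauto
  have h3 : v ∈ vert m (T' \ T) → v ∉ vert m T := by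
    cases v with
    | inl k => simp [vert]
    | inr j => simp only [inr_mem_vert, Finset.mem_sdiff]; tauto
  by_cases h4 : v ∈ vert m T
  · have h5 : v ∉ vert m (T' \ T) := fun h => h3 h h4
    simp [h2, h4, h5]
  · by_cases h5 : v ∈ vert m (T' \ T)
    · simp [h2, h4, h5]
    · simp [h2, h4, h5]

open Classical in
/-- The coefficient of `mon I T c` in an element of the localization at `y_T`. -/
def coeffLoc (hI : IsSquarefreeMonomialIdeal I) (T : Finset (Fin n)) (c : Bidegree m n) :
    Cech.Loc (y I) T →ₗ[K] K :=
  if h : supp c ∪ vert m T ∈ complex I then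
    { toFun := fun z => (locToLaurent hI h Finset.subset_union_right z).coeff c
      map_add' := fun a b => by rw [map_add]; rfl
      map_smul' := fun k a => by rw [map_smul]; rfl }
  else 0

lemma coeffLoc_mon_self (hI : IsSquarefreeMonomialIdeal I) {T : Finset (Fin n)} {c : Bidegree m n}
    (h : Adm I T c) : coeffLoc hI T c (mon I T c) = 1 := by
  obtain ⟨⟨e, l⟩, rfl⟩ := exists_bideg_eq h.1
  have h1 := frac_eq_smul_mon (I := I) T e 1 l
  rw [one_smul] at h1
  rw [← h1, coeffLoc, dif_pos h.2]
  change (locToLaurent hI h.2 Finset.subset_union_right (frac I T e 1 l)).coeff _ = 1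
  rw [locToLaurent_frac, if_pos]
  · simp
  · rw [supp_union_vert]
    exact Finset.subset_union_left

lemma coeffLoc_mon_of_ne (hI : IsSquarefreeMonomialIdeal I) {T : Finset (Fin n)}
    {c c' : Bidegree m n} (h : c ≠ c') : coeffLoc hI T c (mon I T c') = 0 := by
  by_cases hc' : Adm I T c'
  swap
  · rw [mon_eq_zero hc', map_zero]
  obtain ⟨⟨e, l⟩, rfl⟩ := exists_bideg_eq hc'.1
  have h1 := frac_eq_smul_mon (I := I) T e 1 l
  rw [one_smul] at h1
  rw [← h1, coeffLoc]
  split_ifs with hc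
  · change (locToLaurent hI hc Finset.subset_union_right (frac I T e 1 l)).coeff _ = 0
    rw [locToLaurent_frac]
    split_ifs
    · rw [AddMonoidAlgebra.coeff_single]
      exact Finsupp.single_eq_of_ne h
    · rfl
  · rfl

/-- The projection of the localization at `y_T` to its component of bidegree `c`. -/
def projLoc (hI : IsSquarefreeMonomialIdeal I) (T : Finset (Fin n)) (c : Bidegree m n) :
    Cech.Loc (y I) T →ₗ[K] Cech.Loc (y I) T :=
  (coeffLoc hI T c).smulRight (mon I T c)

lemma projLoc_mon_self (hI : IsSquarefreeMonomialIdeal I) (T : Finset (Fin n)) (c : Bidegree m n) :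
    projLoc hI T c (mon I T c) = mon I T c := by
  rw [projLoc, LinearMap.smulRight_apply]
  by_cases h : Adm I T c
  · rw [coeffLoc_mon_self hI h, one_smul]
  · rw [mon_eq_zero h, smul_zero]

lemma projLoc_mon_of_ne (hI : IsSquarefreeMonomialIdeal I) (T : Finset (Fin n))
    {c c' : Bidegree m n} (h : c ≠ c') : projLoc hI T c (mon I T c') = 0 := by
  rw [projLoc, LinearMap.smulRight_apply, coeffLoc_mon_of_ne hI h, zero_smul]

/-- The transition maps respect the bigrading. -/
lemma nat_projLoc (hI : IsSquarefreeMonomialIdeal I) {T T' : Finset (Fin n)} (h : T ⊆ T')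
    (c : Bidegree m n) (z : Cech.Loc (y I) T) :
    Cech.nat (y I) h (projLoc hI T c z) = projLoc hI T' c (Cech.nat (y I) h z) := by
  have hsmul : ∀ (k : K) z, Cech.nat (y I) h (k • z) = k • Cech.nat (y I) h z := fun k z =>
    map_smul ((Cech.nat (y I) h).restrictScalars K) k z
  induction z using loc_induction' with
  | hmon c' k =>
    rw [map_smul, hsmul, hsmul, map_smul]
    congr 1
    by_cases hc' : ∀ v ∉ vert m T, 0 ≤ coord c' v
    · rw [nat_mon h hc']
      by_cases hcc : c = c'
      · subst hcc
        rw [projLoc_mon_self, projLoc_mon_self, nat_mon h hc']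
      · rw [projLoc_mon_of_ne hI T hcc, projLoc_mon_of_ne hI T' hcc, map_zero]
    · rw [mon_eq_zero (fun h => hc' h.1), map_zero, map_zero, map_zero]
  | hadd a b ha hb => rw [map_add, map_add, map_add, map_add, ha, hb]

/-- The component of bidegree `c` of the localization is spanned by one fraction. -/
lemma locPiece_eq_span (T : Finset (Fin n)) (c : Bidegree m n) :
    locPiece I T c = Submodule.span K {mon I T c} := by
  have key : ∀ (e : (Fin m ⊕ Fin n) →₀ ℕ) (l : ℕ), ((∀ i, (e (Sum.inl i) : ℤ) = c.1 i) ∧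
      (∀ j, (e (Sum.inr j) : ℤ) - (if j ∈ T then (l : ℤ) else 0) = c.2 j)) ↔
      bideg e - l • bideg (expo m T) = c := by
    intro e l
    constructor
    · rintro ⟨h1, h2⟩
      refine bidegree_ext fun v => ?_
      rw [coord_frac]
      cases v with
      | inl i => rw [if_neg inl_notMem_vert, sub_zero]; exact h1 i
      | inr j => simp only [inr_mem_vert]; exact h2 j
    · rintro rfl
      refine ⟨fun i => ?_, fun j => ?_⟩
      · have := coord_frac T e l (Sum.inl i)
        rw [if_neg inl_notMem_vert, sub_zero] at this
        exact this.symm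
      · have := coord_frac T e l (Sum.inr j)
        simp only [inr_mem_vert] at this
        exact this.symm
  apply le_antisymm
  · refine Submodule.span_le.2 ?_
    rintro _ ⟨e, k, l, h1, h2, rfl⟩
    have h3 := (key e l).1 ⟨h1, h2⟩
    have h4 := frac_eq_smul_mon (I := I) T e k l
    rw [h3] at h4
    exact Submodule.mem_span_singleton.2 ⟨k, h4.symm⟩
  · rw [Submodule.span_singleton_le_iff_mem]
    by_cases hc : Adm I T c
    · obtain ⟨⟨e, l⟩, h⟩ := exists_bideg_eq hc.1
      refine Submodule.subset_span ⟨e, 1, l, ((key e l).2 h).1, ((key e l).2 h).2, ?_⟩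
      have h4 := frac_eq_smul_mon (I := I) T e 1 l
      rw [one_smul, h] at h4
      exact h4.symm
    · rw [mon_eq_zero hc]
      exact zero_mem _

lemma projLoc_mem (hI : IsSquarefreeMonomialIdeal I) (T : Finset (Fin n)) (c : Bidegree m n)
    (z : Cech.Loc (y I) T) : projLoc hI T c z ∈ locPiece I T c := by
  rw [locPiece_eq_span]
  exact Submodule.mem_span_singleton.2 ⟨_, rfl⟩

lemma projLoc_of_mem (hI : IsSquarefreeMonomialIdeal I) {T : Finset (Fin n)} {c : Bidegree m n}
    {z : Cech.Loc (y I) T} (hz : z ∈ locPiece I T c) : projLoc hI T c z = z := by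
  rw [locPiece_eq_span] at hz
  obtain ⟨k, rfl⟩ := Submodule.mem_span_singleton.1 hz
  rw [map_smul, projLoc_mon_self]

lemma projLoc_of_mem_of_ne (hI : IsSquarefreeMonomialIdeal I) {T : Finset (Fin n)}
    {c c' : Bidegree m n} (h : c ≠ c') {z : Cech.Loc (y I) T} (hz : z ∈ locPiece I T c') :
    projLoc hI T c z = 0 := by
  rw [locPiece_eq_span] at hz
  obtain ⟨k, rfl⟩ := Submodule.mem_span_singleton.1 hz
  rw [map_smul, projLoc_mon_of_ne hI T h, smul_zero]

/-- Every element of the localization is the sum of its components. -/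
lemma exists_sum_projLoc (hI : IsSquarefreeMonomialIdeal I) {T : Finset (Fin n)}
    (z : Cech.Loc (y I) T) : ∃ s : Finset (Bidegree m n), ∀ s', s ⊆ s' →
      ∑ c ∈ s', projLoc hI T c z = z := by
  classical
  induction z using loc_induction' with
  | hmon c k =>
    refine ⟨{c}, fun s' hs' => ?_⟩
    rw [Finset.sum_eq_single_of_mem c (hs' (Finset.mem_singleton_self c))]
    · rw [map_smul, projLoc_mon_self]
    · intro b _ hb
      rw [map_smul, projLoc_mon_of_ne hI T hb, smul_zero]
  | hadd a b ha hb =>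
    obtain ⟨s, hs⟩ := ha
    obtain ⟨t, ht⟩ := hb
    refine ⟨s ∪ t, fun s' hs' => ?_⟩
    simp only [map_add, Finset.sum_add_distrib]
    rw [hs s' (Finset.subset_union_left.trans hs'), ht s' (Finset.subset_union_right.trans hs')]

end StanleyReisner
end

/-! ### Subquotients of graded modules -/

noncomputable section

section Subquotient

variable {ι R K C : Type*} [CommRing R] [Field K] [Algebra K R] [AddCommGroup C] [Module R C]
  [Module K C] [IsScalarTower K R C] (Z B : Submodule R C)

/-- The classes in the subquotient `Z / B` of the elements of a `K`-subspace. -/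
def subPiece (Cc : Submodule K C) : Submodule K (Z ⧸ B.submoduleOf Z) :=
  (Cc.comap (Z.subtype.restrictScalars K)).map
    ((Submodule.mkQ (B.submoduleOf Z)).restrictScalars K)

variable {Z B}

lemma mem_subPiece {Cc : Submodule K C} {x : Z ⧸ B.submoduleOf Z} :
    x ∈ subPiece Z B Cc ↔ ∃ z : Z, z.1 ∈ Cc ∧ Submodule.Quotient.mk z = x := Iff.rfl

lemma mk_eq_zero_submoduleOf {z : Z} :
    (Submodule.Quotient.mk z : Z ⧸ B.submoduleOf Z) = 0 ↔ z.1 ∈ B :=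
  Submodule.Quotient.mk_eq_zero _

/-- A decomposition of `C` for which `Z` and `B` are homogeneous induces a decomposition of
`Z / B`. -/
lemma isInternal_subPiece [DecidableEq ι] (Cc : ι → Submodule K C) (p : ι → C →ₗ[K] C)
    (hmem : ∀ c z, p c z ∈ Cc c) (hid : ∀ c, ∀ z ∈ Cc c, p c z = z)
    (hne : ∀ c c', c ≠ c' → ∀ z ∈ Cc c', p c z = 0) (hsum : ∀ z, ∃ s : Finset ι, ∑ c ∈ s, p c z = z)
    (hZ : ∀ c, ∀ z ∈ Z, p c z ∈ Z) (hB : ∀ c, ∀ z ∈ B, p c z ∈ B) :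
    DirectSum.IsInternal fun c => subPiece Z B (Cc c) := by
  rw [DirectSum.isInternal_submodule_iff_iSupIndep_and_iSup_eq_top]
  constructor
  · rw [iSupIndep_iff_finsetSum_eq_zero_imp_eq_zero]
    intro s v hv hsum0 c hc
    choose z hz hzv using fun c => fun hc : c ∈ s => mem_subPiece.1 (hv c hc)
    have h1 : ∑ c ∈ s.attach, (z c.1 c.2).1 ∈ B := by
      have h2 : (∑ c ∈ s.attach, z c.1 c.2 : Z).1 ∈ B := by
        rw [← mk_eq_zero_submoduleOf (Z := Z) (B := B)]
        rw [← Submodule.mkQ_apply, map_sum, ← hsum0, ← Finset.sum_attach s]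
        exact Finset.sum_congr rfl fun c _ => hzv c.1 c.2
      rwa [AddSubmonoidClass.coe_finsetSum] at h2
    have h2 := hB c _ h1
    rw [map_sum, Finset.sum_eq_single_of_mem ⟨c, hc⟩ (Finset.mem_attach _ _),
      hid c _ (hz c hc)] at h2
    · rw [← hzv c hc]
      exact mk_eq_zero_submoduleOf.2 h2
    · intro b _ hb
      exact hne _ _ (fun h => hb (Subtype.ext h.symm)) _ (hz b.1 b.2)
  · rw [eq_top_iff]
    rintro x -
    obtain ⟨z, rfl⟩ := Submodule.Quotient.mk_surjective _ x
    obtain ⟨s, hs⟩ := hsum z.1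
    have h1 : z = ∑ c ∈ s, (⟨p c z.1, hZ c _ z.2⟩ : Z) := by
      apply Subtype.ext
      rw [AddSubmonoidClass.coe_finsetSum]
      exact hs.symm
    rw [h1, ← Submodule.mkQ_apply, map_sum]
    exact Submodule.sum_mem _ fun c _ => Submodule.mem_iSup_of_mem c
      (mem_subPiece.2 ⟨_, hmem c _, rfl⟩)

lemma finrank_subPiece (Cc : Submodule K C) [Module.Finite K Cc] (hBZ : B ≤ Z) :
    Module.Finite K (subPiece Z B Cc) ∧
    Module.finrank K (subPiece Z B Cc) + Module.finrank K ↥(B.restrictScalars K ⊓ Cc) =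
      Module.finrank K ↥(Z.restrictScalars K ⊓ Cc) := by
  have hfin : Module.Finite K ↥(Z.restrictScalars K ⊓ Cc) :=
    Submodule.finiteDimensional_inf_right _ _
  obtain ⟨f, hf⟩ : ∃ f : ↥(Z.restrictScalars K ⊓ Cc) →ₗ[K] Z ⧸ B.submoduleOf Z,
      ∀ z, f z = Submodule.Quotient.mk ⟨z.1, z.2.1⟩ :=
    ⟨((Submodule.mkQ (B.submoduleOf Z)).restrictScalars K) ∘ₗ
      (Submodule.inclusion (inf_le_left : Z.restrictScalars K ⊓ Cc ≤ Z.restrictScalars K)),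
      fun _ => rfl⟩
  have hrange : LinearMap.range f = subPiece Z B Cc := by
    ext x
    rw [mem_subPiece]
    constructor
    · rintro ⟨z, rfl⟩
      exact ⟨⟨z.1, z.2.1⟩, z.2.2, (hf z).symm⟩
    · rintro ⟨z, hz, rfl⟩
      exact ⟨⟨z.1, z.2, hz⟩, hf _⟩
  have hker : LinearMap.ker f = (B.restrictScalars K ⊓ Cc).comap
      (Submodule.subtype (Z.restrictScalars K ⊓ Cc)) := by
    ext z
    rw [LinearMap.mem_ker, hf, mk_eq_zero_submoduleOf]
    exact ⟨fun h => ⟨h, z.2.2⟩, fun h => h.1⟩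
  rw [← hrange]
  refine ⟨inferInstance, ?_⟩
  rw [← f.finrank_range_add_finrank_ker, hker]
  congr 1
  exact (Submodule.comapSubtypeEquivOfLe (inf_le_inf_right Cc hBZ)).finrank_eq.symm

end Subquotient

/-! ### The components of the Čech cohomology -/

namespace StanleyReisner

variable {K : Type u} [Field K] {m n : ℕ} {I : Ideal (PolyRing K m n)}

/-- The cochains all of whose entries have bidegree `c`. -/
abbrev cochainPiece (I : Ideal (PolyRing K m n)) (t : ℕ) (c : Bidegree m n) :
    Submodule K (Cech.Cochain (y I) t) :=
  Submodule.pi Set.univ fun T : Cech.Idx n t => locPiece I T.1 c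

lemma cechPiece_eq (t : ℕ) (c : Bidegree m n) :
    cechPiece I t c = subPiece (Cech.cocycles (y I) t) (Cech.coboundaries (y I) t)
      (cochainPiece I t c) := rfl

instance (T : Finset (Fin n)) (c : Bidegree m n) : Module.Finite K (locPiece I T c) := by
  rw [locPiece_eq_span]
  infer_instance

instance (t : ℕ) (c : Bidegree m n) : Module.Finite K (cochainPiece I t c) := by
  let f : ((T : Cech.Idx n t) → locPiece I T.1 c) →ₗ[K] Cech.Cochain (y I) t :=
    LinearMap.pi fun T => (locPiece I T.1 c).subtype ∘ₗ LinearMap.proj T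
  have : cochainPiece I t c = LinearMap.range f := by
    ext z
    constructor
    · intro hz
      exact ⟨fun T => ⟨z T, hz T (Set.mem_univ T)⟩, rfl⟩
    · rintro ⟨w, rfl⟩ T -
      exact (w T).2
  rw [this]
  infer_instance

/-- The projection of the cochains to those of bidegree `c`. -/
def projCochain (hI : IsSquarefreeMonomialIdeal I) (t : ℕ) (c : Bidegree m n) :
    Cech.Cochain (y I) t →ₗ[K] Cech.Cochain (y I) t :=
  LinearMap.pi fun T => projLoc hI T.1 c ∘ₗ LinearMap.proj T

lemma cechD_apply (t : ℕ) (z : Cech.Cochain (y I) t) (T : Cech.Idx n (t + 1)) :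
    Cech.d (y I) t z T = ∑ j ∈ T.1.attach, CechSystem.sgn K j.1 T.1 •
      Cech.nat (y I) (Finset.erase_subset j.1 T.1) (z (T.erase j.1 j.2)) := by
  simp only [Cech.d, LinearMap.pi_apply, LinearMap.sum_apply, LinearMap.smul_apply]
  refine Finset.sum_congr rfl fun j _ => ?_
  rw [CechSystem.sgn, ← algebraMap_smul (Quot I) ((-1 : K) ^ _), map_pow, map_neg, map_one]
  rfl

lemma cechD_projCochain (hI : IsSquarefreeMonomialIdeal I) (t : ℕ) (c : Bidegree m n)
    (z : Cech.Cochain (y I) t) :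
    Cech.d (y I) t (projCochain hI t c z) = projCochain hI (t + 1) c (Cech.d (y I) t z) := by
  funext T
  change _ = projLoc hI T.1 c (Cech.d (y I) t z T)
  rw [cechD_apply, cechD_apply, map_sum]
  refine Finset.sum_congr rfl fun j _ => ?_
  rw [map_smul]
  exact congrArg (_ • ·) (nat_projLoc hI (Finset.erase_subset _ _) c _)

lemma coboundaries_le_cocycles (t : ℕ) : Cech.coboundaries (y I) t ≤ Cech.cocycles (y I) t := by
  cases t with
  | zero => exact bot_le
  | succ t =>
    rintro _ ⟨z, rfl⟩
    exact CechSystem.d_d (A := CechSystem.ringSystem (y I)) z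

lemma isInternal_cechPiece (hI : IsSquarefreeMonomialIdeal I) (t : ℕ) :
    DirectSum.IsInternal (cechPiece I t) := by
  refine isInternal_subPiece (cochainPiece I t) (projCochain hI t) ?_ ?_ ?_ ?_ ?_ ?_
  · exact fun c z T _ => projLoc_mem hI T.1 c (z T)
  · exact fun c z hz => funext fun T => projLoc_of_mem hI (hz T (Set.mem_univ T))
  · exact fun c c' h z hz => funext fun T => projLoc_of_mem_of_ne hI h (hz T (Set.mem_univ T))
  · intro z
    choose s hs using fun T : Cech.Idx n t => exists_sum_projLoc hI (z T)
    refine ⟨Finset.univ.biUnion s, funext fun T => ?_⟩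
    rw [Finset.sum_apply]
    exact hs T _ (Finset.subset_biUnion_of_mem s (Finset.mem_univ T))
  · intro c z hz
    rw [Cech.cocycles, LinearMap.mem_ker] at hz ⊢
    rw [cechD_projCochain, hz, map_zero]
  · intro c z hz
    cases t with
    | zero =>
      have h0 : z = 0 := hz
      rw [h0, map_zero]
      exact zero_mem _
    | succ t =>
      obtain ⟨w, rfl⟩ := hz
      exact ⟨projCochain hI t c w, cechD_projCochain hI t c w⟩

lemma cechD_mem_cochainPiece (t : ℕ) (c : Bidegree m n) {z : Cech.Cochain (y I) t}
    (hI : IsSquarefreeMonomialIdeal I)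
    (hz : z ∈ cochainPiece I t c) : Cech.d (y I) t z ∈ cochainPiece I (t + 1) c := by
  have h1 : projCochain hI t c z = z :=
    funext fun T => projLoc_of_mem hI (hz T (Set.mem_univ T))
  rw [← h1, cechD_projCochain]
  exact fun T _ => projLoc_mem hI T.1 c _

/-- A coboundary of bidegree `c` is the coboundary of a cochain of bidegree `c`. -/
lemma coboundaries_succ_inf (hI : IsSquarefreeMonomialIdeal I) (t : ℕ) (c : Bidegree m n) :
    (Cech.coboundaries (y I) (t + 1)).restrictScalars K ⊓ cochainPiece I (t + 1) c =
      (cochainPiece I t c).map ((Cech.d (y I) t).restrictScalars K) := by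
  ext z
  constructor
  · rintro ⟨⟨w, rfl⟩, hz⟩
    refine ⟨projCochain hI t c w, fun T _ => projLoc_mem hI T.1 c _, ?_⟩
    refine (cechD_projCochain hI t c w).trans ?_
    exact funext fun T => projLoc_of_mem hI (hz T (Set.mem_univ T))
  · rintro ⟨w, hw, rfl⟩
    exact ⟨⟨w, rfl⟩, cechD_mem_cochainPiece t c hI hw⟩

end StanleyReisner
end

/-! ### Simplicial coboundary maps -/

noncomputable section

namespace SimplicialCpx

variable (K : Type u) [Field K] {W : Type} [LinearOrder W] [Fintype W] (Γ : LowerSet (Finset W))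

open Classical in
/-- The matrix of the boundary map with respect to the bases of faces. -/
def boundaryMatrix (j k : ℤ) (h : k + 1 = j) : Matrix (Face Γ k) (Face Γ j) K :=
  LinearMap.toMatrix' (boundary K Γ j k h)

/-- The simplicial coboundary map, the transpose of the boundary map. -/
def coboundary (j k : ℤ) (h : k + 1 = j) : Chain K Γ k →ₗ[K] Chain K Γ j :=
  (boundaryMatrix K Γ j k h).transpose.mulVecLin

lemma coboundary_apply (j k : ℤ) (h : k + 1 = j) (g : Chain K Γ k) (B : Face Γ j) :
    coboundary K Γ j k h g B = ∑ v ∈ B.1.attach,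
      (-1 : K) ^ (B.1.filter (fun w => w < v.1)).card * g (B.erase h v.1 v.2) := by
  classical
  have h1 : ∀ C : Face Γ k, boundaryMatrix K Γ j k h C B = ∑ v ∈ B.1.attach,
      Pi.single (M := fun _ => K) (B.erase h v.1 v.2)
        ((-1 : K) ^ (B.1.filter (fun w => w < v.1)).card) C := by
    intro C
    rw [boundaryMatrix, LinearMap.toMatrix'_apply]
    rw [boundary, Fintype.linearCombination_apply_single, one_smul, Finset.sum_apply]
  change ∑ C, boundaryMatrix K Γ j k h C B * g C = _
  simp only [h1, Finset.sum_mul]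
  rw [Finset.sum_comm]
  refine Finset.sum_congr rfl fun v _ => ?_
  simp only [Pi.single_apply, ite_mul, zero_mul, Finset.sum_ite_eq', Finset.mem_univ, if_true]

lemma boundary_eq (j k : ℤ) (h : k + 1 = j) :
    (boundaryMatrix K Γ j k h).mulVecLin = boundary K Γ j k h := by
  classical
  exact Matrix.toLin'_toMatrix' _

lemma finrank_range_coboundary (j k : ℤ) (h : k + 1 = j) :
    Module.finrank K (LinearMap.range (coboundary K Γ j k h)) =
      Module.finrank K (LinearMap.range (boundary K Γ j k h)) := by
  rw [← boundary_eq]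
  exact Matrix.rank_transpose _

lemma boundary_comp_eq_zero {i j k : ℤ} (h : k + 1 = j) (h' : j + 1 = i)
    (hc : coboundary K Γ i j h' ∘ₗ coboundary K Γ j k h = 0) :
    boundary K Γ j k h ∘ₗ boundary K Γ i j h' = 0 := by
  classical
  rw [coboundary, coboundary, ← Matrix.mulVecLin_mul, ← Matrix.transpose_mul] at hc
  have h0 : ((boundaryMatrix K Γ j k h) * (boundaryMatrix K Γ i j h')).transpose = 0 :=
    Matrix.toLin'.injective (hc.trans (map_zero _).symm)
  rw [← boundary_eq, ← boundary_eq, ← Matrix.mulVecLin_mul, Matrix.transpose_eq_zero.1 h0]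
  exact Matrix.mulVecLin_zero

lemma finrank_reducedHomology (j : ℤ) (h : boundaries K Γ j ≤ cycles K Γ j) :
    Module.finrank K (ReducedHomology K Γ j) + Module.finrank K (boundaries K Γ j) =
      Module.finrank K (cycles K Γ j) := by
  rw [← Submodule.finrank_quotient_add_finrank ((boundaries K Γ j).submoduleOf (cycles K Γ j))]
  congr 1
  exact (Submodule.comapSubtypeEquivOfLe h).finrank_eq.symm

lemma finrank_cycles_add (j : ℤ) : Module.finrank K (cycles K Γ j) +
    Module.finrank K (LinearMap.range (boundary K Γ j (j - 1) (sub_add_cancel j 1))) =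
      Module.finrank K (Chain K Γ j) := by
  rw [add_comm]
  exact LinearMap.finrank_range_add_finrank_ker _

end SimplicialCpx
end

/-! ### Comparison with simplicial cochains -/

noncomputable section
open SimplicialCpx

namespace StanleyReisner

variable {K : Type u} [Field K] {m n : ℕ} {I : Ideal (PolyRing K m n)}

/-- The `k` for which the `k`-th coordinate of the first part of a bidegree does not vanish. -/
def suppLeft (c : Bidegree m n) : Finset (Fin m) := Finset.univ.filter fun k => c.1 k ≠ 0

/-- The `j` for which the `j`-th coordinate of the second part of a bidegree does not vanish. -/
def suppRight (c : Bidegree m n) : Finset (Fin n) := Finset.univ.filter fun j => c.2 j ≠ 0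

lemma supp_eq_disjSum (c : Bidegree m n) : supp c = (suppLeft c).disjSum (suppRight c) := by
  ext v
  cases v <;> simp [mem_supp, suppLeft, suppRight, coord]

/-- The complex `(lk (F ∪ G))_W`, where `G` and `F` are the supports of the two parts of the
bidegree `c`. -/
def linkRight (I : Ideal (PolyRing K m n)) (c : Bidegree m n) : LowerSet (Finset (Fin n)) :=
  restrictRight (link (complex I) ((suppLeft c).disjSum (suppRight c)))

lemma mem_linkRight {c : Bidegree m n} {B : Finset (Fin n)} : B ∈ linkRight I c ↔
    Disjoint (suppRight c) B ∧ supp c ∪ vert m B ∈ complex I := by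
  rw [supp_eq_disjSum]
  refine and_congr_left fun _ => ?_
  simp only [Finset.disjoint_left]
  constructor
  · intro h j hj hB
    exact h (Finset.inr_mem_disjSum.2 hj) (inr_mem_vert.2 hB)
  · rintro h (k | j) hv hB
    · exact inl_notMem_vert hB
    · exact h (Finset.inr_mem_disjSum.1 hv) (inr_mem_vert.1 hB)

lemma inr_mem_supp {c : Bidegree m n} {j : Fin n} : Sum.inr j ∈ supp c ↔ j ∈ suppRight c := by
  rw [supp_eq_disjSum, Finset.inr_mem_disjSum]

lemma nonneg_off_iff {c : Bidegree m n} (h1 : ∀ k, 0 ≤ c.1 k) (h2 : ∀ j, c.2 j ≤ 0)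
    (T : Finset (Fin n)) :
    (∀ v ∉ vert m T, 0 ≤ coord c v) ↔ suppRight c ⊆ T := by
  constructor
  · intro h j hj
    by_contra hT
    have h3 : 0 ≤ c.2 j := h (Sum.inr j) (fun h => hT (inr_mem_vert.1 h))
    exact (Finset.mem_filter.1 hj).2 (le_antisymm (h2 j) h3)
  · rintro h (k | j) hv
    · exact h1 k
    · by_contra h0
      refine hv (inr_mem_vert.2 (h (Finset.mem_filter.2 ⟨Finset.mem_univ _, fun h3 => h0 ?_⟩)))
      exact h3.ge

/-- The index sets with a nonzero entry of bidegree `c` are the unions of `suppRight c` and a face of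
`linkRight I c`. -/
lemma adm_iff {c : Bidegree m n} (h1 : ∀ k, 0 ≤ c.1 k) (h2 : ∀ j, c.2 j ≤ 0)
    (T : Finset (Fin n)) :
    Adm I T c ↔ suppRight c ⊆ T ∧ T \ suppRight c ∈ linkRight I c := by
  rw [Adm, nonneg_off_iff h1 h2]
  refine and_congr_right fun h => ?_
  rw [mem_linkRight, and_iff_right Finset.disjoint_sdiff]
  have : supp c ∪ vert m T = supp c ∪ vert m (T \ suppRight c) := by
    ext v
    cases v with
    | inl k => simp
    | inr j =>
      simp only [Finset.mem_union, inr_mem_vert, Finset.mem_sdiff, inr_mem_supp]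
      tauto
  rw [this]

lemma adm_union {c : Bidegree m n} (h1 : ∀ k, 0 ≤ c.1 k) (h2 : ∀ j, c.2 j ≤ 0)
    {B : Finset (Fin n)} (hB : B ∈ linkRight I c) : Adm I (suppRight c ∪ B) c := by
  rw [adm_iff h1 h2, Finset.union_sdiff_cancel_left (mem_linkRight.1 hB).1]
  exact ⟨Finset.subset_union_left, hB⟩

/-- The sign of the permutation which sorts the concatenation of `B` and `F`. -/
def shuffleSign (K : Type u) [Field K] (F B : Finset (Fin n)) : K :=
  ∏ b ∈ B, (-1) ^ (F.filter (fun f => f < b)).card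

lemma shuffleSign_mul_self (F B : Finset (Fin n)) :
    shuffleSign K F B * shuffleSign K F B = 1 := by
  rw [shuffleSign, ← Finset.prod_mul_distrib]
  exact Finset.prod_eq_one fun b _ => by rw [← mul_pow]; simp

lemma shuffleSign_mul_sgn {F B : Finset (Fin n)} (h : Disjoint F B) {v : Fin n} (hv : v ∈ B) :
    shuffleSign K F B * CechSystem.sgn K v (F ∪ B) =
      CechSystem.sgn K v B * shuffleSign K F (B.erase v) := by
  have h1 : CechSystem.sgn K v (F ∪ B) =
      (-1) ^ (F.filter (fun f => f < v)).card * CechSystem.sgn K v B := by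
    rw [CechSystem.sgn, CechSystem.sgn, ← pow_add, ← Finset.card_union_of_disjoint,
      Finset.filter_union]
    exact Finset.disjoint_filter_filter h
  rw [h1, shuffleSign, ← Finset.mul_prod_erase B _ hv, shuffleSign]
  have h2 : ((-1 : K) ^ (F.filter (fun f => f < v)).card) *
      ((-1 : K) ^ (F.filter (fun f => f < v)).card) = 1 := by
    rw [← mul_pow]; simp
  linear_combination (CechSystem.sgn K v B *
    ∏ b ∈ B.erase v, (-1 : K) ^ (F.filter (fun f => f < b)).card) * h2

lemma card_suppRight_union {c : Bidegree m n} {t : ℕ} {j : ℤ}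
    (h : (t : ℤ) = j + 1 + (suppRight c).card) (B : Face (linkRight I c) j) :
    (suppRight c ∪ B.1).card = t := by
  have h1 := Finset.card_union_of_disjoint (mem_linkRight.1 B.2.1).1
  have h2 := B.2.2
  omega

/-- The index of the entry of a cochain that corresponds to a face of `linkRight I c`. -/
def faceIdx {c : Bidegree m n} {t : ℕ} {j : ℤ} (h : (t : ℤ) = j + 1 + (suppRight c).card)
    (B : Face (linkRight I c) j) : Cech.Idx n t :=
  ⟨suppRight c ∪ B.1, card_suppRight_union h B⟩

lemma adm_faceIdx {c : Bidegree m n} (h1 : ∀ k, 0 ≤ c.1 k) (h2 : ∀ j, c.2 j ≤ 0) {t : ℕ} {j : ℤ}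
    (h : (t : ℤ) = j + 1 + (suppRight c).card) (B : Face (linkRight I c) j) :
    Adm I (faceIdx h B).1 c := adm_union h1 h2 B.2.1

/-- The comparison map from the Čech cochains to the simplicial cochains of `linkRight I c`. It
takes the coefficients of bidegree `c` with the signs that make it compatible with the differentials. -/
def toChain (hI : IsSquarefreeMonomialIdeal I) {c : Bidegree m n} {t : ℕ} {j : ℤ}
    (h : (t : ℤ) = j + 1 + (suppRight c).card) :
    Cech.Cochain (y I) t →ₗ[K] Chain K (linkRight I c) j :=
  LinearMap.pi fun B => shuffleSign K (suppRight c) B.1 •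
    (coeffLoc hI (faceIdx h B).1 c ∘ₗ LinearMap.proj (faceIdx h B))

lemma toChain_apply (hI : IsSquarefreeMonomialIdeal I) {c : Bidegree m n} {t : ℕ} {j : ℤ}
    (h : (t : ℤ) = j + 1 + (suppRight c).card) (z : Cech.Cochain (y I) t)
    (B : Face (linkRight I c) j) : toChain hI h z B =
      shuffleSign K (suppRight c) B.1 * coeffLoc hI (faceIdx h B).1 c (z (faceIdx h B)) := rfl

lemma coeffLoc_smul_mon (hI : IsSquarefreeMonomialIdeal I) {T : Finset (Fin n)} {c : Bidegree m n}
    {z : Cech.Loc (y I) T} (hz : z ∈ locPiece I T c) : coeffLoc hI T c z • mon I T c = z :=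
  projLoc_of_mem hI hz

lemma eq_zero_of_mem_locPiece {T : Finset (Fin n)} {c : Bidegree m n} (hc : ¬ Adm I T c)
    {z : Cech.Loc (y I) T} (hz : z ∈ locPiece I T c) : z = 0 := by
  rw [locPiece_eq_span, mon_eq_zero hc] at hz
  simpa using hz

/-- The transition maps preserve coefficients. -/
lemma coeffLoc_nat (hI : IsSquarefreeMonomialIdeal I) {T T' : Finset (Fin n)} (h : T ⊆ T')
    {c : Bidegree m n} (hT : Adm I T c) (hT' : Adm I T' c) {z : Cech.Loc (y I) T}
    (hz : z ∈ locPiece I T c) : coeffLoc hI T' c (Cech.nat (y I) h z) = coeffLoc hI T c z := by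
  rw [locPiece_eq_span] at hz
  obtain ⟨k, rfl⟩ := Submodule.mem_span_singleton.1 hz
  have hsmul : Cech.nat (y I) h (k • mon I T c) = k • Cech.nat (y I) h (mon I T c) :=
    map_smul ((Cech.nat (y I) h).restrictScalars K) k _
  rw [hsmul, nat_mon h hT.1, map_smul, map_smul, coeffLoc_mon_self hI hT,
    coeffLoc_mon_self hI hT']

lemma bijective_toChain (hI : IsSquarefreeMonomialIdeal I) {c : Bidegree m n}
    (h1 : ∀ k, 0 ≤ c.1 k) (h2 : ∀ j, c.2 j ≤ 0) {t : ℕ} {j : ℤ}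
    (h : (t : ℤ) = j + 1 + (suppRight c).card) :
    Function.Bijective ((toChain hI h).domRestrict (cochainPiece I t c)) := by
  constructor
  · rw [injective_iff_map_eq_zero]
    rintro ⟨z, hz⟩ h0
    refine Subtype.ext (funext fun T => ?_)
    have hzT := hz T (Set.mem_univ T)
    by_cases hT : Adm I T.1 c
    · obtain ⟨h3, h4⟩ := (adm_iff h1 h2 T.1).1 hT
      let B : Face (linkRight I c) j := ⟨T.1 \ suppRight c, h4, by
        have := Finset.card_sdiff_add_card_eq_card h3
        have := T.2
        omega⟩
      have hB : faceIdx h B = T := Subtype.ext (Finset.union_sdiff_of_subset h3)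
      have h5 : toChain hI h z B = 0 := congrFun h0 B
      rw [toChain_apply, hB] at h5
      have h6 := congrArg (shuffleSign K (suppRight c) B.1 * ·) h5
      simp only [← mul_assoc, shuffleSign_mul_self, one_mul, mul_zero] at h6
      change z T = 0
      rw [← coeffLoc_smul_mon hI hzT, h6, zero_smul]
    · exact eq_zero_of_mem_locPiece hT hzT
  · intro f
    classical
    let z : Cech.Cochain (y I) t := fun T => if hT : ∃ B, faceIdx h B = T then
      (shuffleSign K (suppRight c) hT.choose.1 * f hT.choose) • mon I T.1 c else 0
    refine ⟨⟨z, fun T _ => ?_⟩, ?_⟩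
    · simp only [z]
      split_ifs
      · rw [locPiece_eq_span]
        exact Submodule.mem_span_singleton.2 ⟨_, rfl⟩
      · exact zero_mem _
    · funext B
      change toChain hI h z B = f B
      have hB : ∃ B', faceIdx h B' = faceIdx h B := ⟨B, rfl⟩
      have hBB : hB.choose = B := by
        refine Subtype.ext ?_
        have h3 : suppRight c ∪ hB.choose.1 = suppRight c ∪ B.1 :=
          congrArg Subtype.val hB.choose_spec
        rw [← Finset.union_sdiff_cancel_left (mem_linkRight.1 B.2.1).1, ← h3,
          Finset.union_sdiff_cancel_left (mem_linkRight.1 hB.choose.2.1).1]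
      have hz : z (faceIdx h B) =
          (shuffleSign K (suppRight c) B.1 * f B) • mon I (faceIdx h B).1 c := by
        simp only [z]
        rw [dif_pos hB, hBB]
      rw [toChain_apply, hz, map_smul, coeffLoc_mon_self hI (adm_faceIdx h1 h2 h B), smul_eq_mul,
        mul_one, ← mul_assoc, shuffleSign_mul_self, one_mul]

/-- On the cochains of bidegree `c`, the Čech differential is the simplicial coboundary. -/
lemma toChain_cechD (hI : IsSquarefreeMonomialIdeal I) {c : Bidegree m n}
    (h1 : ∀ k, 0 ≤ c.1 k) (h2 : ∀ j, c.2 j ≤ 0) {t : ℕ} {j k : ℤ}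
    (h : (t : ℤ) = k + 1 + (suppRight c).card)
    (h' : ((t + 1 : ℕ) : ℤ) = j + 1 + (suppRight c).card) (hkj : k + 1 = j)
    {z : Cech.Cochain (y I) t} (hz : z ∈ cochainPiece I t c) :
    toChain hI h' (Cech.d (y I) t z) =
      coboundary K (linkRight I c) j k hkj (toChain hI h z) := by
  funext B
  obtain ⟨hdisj, -⟩ := mem_linkRight.1 B.2.1
  rw [toChain_apply, cechD_apply, map_sum, Finset.mul_sum, coboundary_apply]
  -- the coefficient of the entry of the cochain at an index set
  let g : Cech.Idx n t → K := fun T => coeffLoc hI T.1 c (z T)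
  have hterm : ∀ v : Fin n, ∀ hv : v ∈ (faceIdx h' B).1,
      shuffleSign K (suppRight c) B.1 * coeffLoc hI (faceIdx h' B).1 c
        (CechSystem.sgn K v (faceIdx h' B).1 •
          Cech.nat (y I) (Finset.erase_subset v (faceIdx h' B).1)
            (z ((faceIdx h' B).erase v hv))) =
      if hvB : v ∈ B.1 then CechSystem.sgn K v B.1 *
        (shuffleSign K (suppRight c) (B.1.erase v) * g (faceIdx h (B.erase hkj v hvB))) else 0 := by
    intro v hv
    split_ifs with hvB
    · have hidx : (faceIdx h' B).erase v hv = faceIdx h (B.erase hkj v hvB) := by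
        refine Subtype.ext ?_
        change (suppRight c ∪ B.1).erase v = suppRight c ∪ B.1.erase v
        rw [Finset.erase_union_distrib,
          Finset.erase_eq_of_notMem (Finset.disjoint_right.1 hdisj hvB)]
      have hadm : Adm I ((faceIdx h' B).erase v hv).1 c := by
        rw [hidx]
        exact adm_union h1 h2 (B.erase hkj v hvB).2.1
      have hsgn : shuffleSign K (suppRight c) B.1 * CechSystem.sgn K v (faceIdx h' B).1 =
          CechSystem.sgn K v B.1 * shuffleSign K (suppRight c) (B.1.erase v) :=
        shuffleSign_mul_sgn hdisj hvB
      have hcoeff := coeffLoc_nat hI (Finset.erase_subset v (faceIdx h' B).1) hadm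
        (adm_faceIdx h1 h2 h' B) (hz ((faceIdx h' B).erase v hv) (Set.mem_univ _))
      rw [map_smul, smul_eq_mul, ← mul_assoc, hsgn, mul_assoc, ← hidx]
      exact congrArg (fun x => _ * (_ * x)) hcoeff
    · have hnot : ¬ Adm I ((faceIdx h' B).erase v hv).1 c := by
        rw [adm_iff h1 h2]
        rintro ⟨h3, -⟩
        have hvF : v ∈ suppRight c := (Finset.mem_union.1 hv).resolve_right hvB
        exact Finset.notMem_erase v _ (h3 hvF)
      have h0 : Cech.nat (y I) (Finset.erase_subset v (faceIdx h' B).1)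
          (z ((faceIdx h' B).erase v hv)) = 0 := by
        rw [eq_zero_of_mem_locPiece hnot (hz _ (Set.mem_univ _))]
        exact map_zero (Cech.nat (y I) (Finset.erase_subset v (faceIdx h' B).1))
      rw [h0, smul_zero, map_zero, mul_zero]
  refine (Finset.sum_congr rfl fun v _ => hterm v.1 v.2).trans ?_
  let u : Fin n → K := fun v => if hvB : v ∈ B.1 then CechSystem.sgn K v B.1 *
        (shuffleSign K (suppRight c) (B.1.erase v) * g (faceIdx h (B.erase hkj v hvB))) else 0
  have hu : ∑ v ∈ (suppRight c ∪ B.1).attach, u v.1 = ∑ v ∈ B.1.attach, u v.1 := by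
    rw [Finset.sum_attach _ u, Finset.sum_attach _ u]
    refine (Finset.sum_subset Finset.subset_union_right fun v _ hv => dif_neg hv).symm
  refine hu.trans (Finset.sum_congr rfl fun v _ => ?_)
  exact dif_pos v.2

end StanleyReisner
end

/-! ### Dimensions of the components -/

noncomputable section
open SimplicialCpx

section Comparison

variable {K C C' E E' : Type*} [Field K] [AddCommGroup C] [Module K C] [AddCommGroup C']
  [Module K C'] [AddCommGroup E] [Module K E] [AddCommGroup E'] [Module K E']

lemma Submodule.finrank_map_of_injOn (f : C →ₗ[K] E) (N : Submodule K C) (h : Set.InjOn f N) :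
    Module.finrank K (N.map f) = Module.finrank K N := by
  rw [← LinearMap.range_domRestrict]
  exact LinearMap.finrank_range_of_inj (h.injective : Function.Injective (f.domRestrict N))

/-- If `f` and `f'` identify `X` with `E` and embed `X'` into `E'`, compatibly with `D : X → X'` and
`δ : E → E'`, then the kernels of `D` on `X` and of `δ` have the same dimension. -/
lemma finrank_ker_inf_eq {D : C →ₗ[K] C'} {X : Submodule K C} {X' : Submodule K C'} {f : C →ₗ[K] E}
    {f' : C' →ₗ[K] E'} {δ : E →ₗ[K] E'} (hf : Set.InjOn f X) (hfX : X.map f = ⊤)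
    (hf' : Set.InjOn f' X') (hD : ∀ z ∈ X, D z ∈ X') (hDf : ∀ z ∈ X, f' (D z) = δ (f z)) :
    Module.finrank K ↥(LinearMap.ker D ⊓ X) = Module.finrank K (LinearMap.ker δ) := by
  have h1 : (LinearMap.ker D ⊓ X).map f = LinearMap.ker δ := by
    ext e
    constructor
    · rintro ⟨z, ⟨hz, hzX⟩, rfl⟩
      rw [LinearMap.mem_ker, ← hDf z hzX, show D z = 0 from hz, map_zero]
    · intro he
      obtain ⟨z, hzX, rfl⟩ : e ∈ X.map f := hfX ▸ Submodule.mem_top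
      refine ⟨z, ⟨?_, hzX⟩, rfl⟩
      exact hf' (hD z hzX) (zero_mem X') (by rw [hDf z hzX, map_zero]; exact he)
  rw [← h1]
  exact (Submodule.finrank_map_of_injOn f _ (hf.mono inf_le_right)).symm

/-- In the situation of `finrank_ker_inf_eq`, the ranges of `D` on `X` and of `δ` have the same
dimension. -/
lemma finrank_map_eq_finrank_range {D : C →ₗ[K] C'} {X : Submodule K C} {X' : Submodule K C'}
    {f : C →ₗ[K] E} {f' : C' →ₗ[K] E'} {δ : E →ₗ[K] E'} (hfX : X.map f = ⊤)
    (hf' : Set.InjOn f' X') (hD : ∀ z ∈ X, D z ∈ X') (hDf : ∀ z ∈ X, f' (D z) = δ (f z)) :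
    Module.finrank K (X.map D) = Module.finrank K (LinearMap.range δ) := by
  have h1 : (X.map D).map f' = LinearMap.range δ := by
    rw [← Submodule.map_top, ← hfX]
    ext e
    constructor
    · rintro ⟨_, ⟨z, hz, rfl⟩, rfl⟩
      exact ⟨f z, ⟨z, hz, rfl⟩, (hDf z hz).symm⟩
    · rintro ⟨_, ⟨z, hz, rfl⟩, rfl⟩
      exact ⟨_, ⟨z, hz, rfl⟩, hDf z hz⟩
  rw [← h1]
  refine (Submodule.finrank_map_of_injOn f' _ (hf'.mono ?_)).symm
  rintro _ ⟨z, hz, rfl⟩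
  exact hD z hz

end Comparison

namespace StanleyReisner

variable {K : Type u} [Field K] {m n : ℕ} {I : Ideal (PolyRing K m n)}

lemma injOn_toChain (hI : IsSquarefreeMonomialIdeal I) {c : Bidegree m n}
    (h1 : ∀ k, 0 ≤ c.1 k) (h2 : ∀ j, c.2 j ≤ 0) {t : ℕ} {j : ℤ}
    (h : (t : ℤ) = j + 1 + (suppRight c).card) :
    Set.InjOn (toChain hI h) (cochainPiece I t c) := fun z hz z' hz' hzz =>
  congrArg Subtype.val ((bijective_toChain hI h1 h2 h).1 (a₁ := ⟨z, hz⟩) (a₂ := ⟨z', hz'⟩) hzz)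

lemma map_toChain (hI : IsSquarefreeMonomialIdeal I) {c : Bidegree m n}
    (h1 : ∀ k, 0 ≤ c.1 k) (h2 : ∀ j, c.2 j ≤ 0) {t : ℕ} {j : ℤ}
    (h : (t : ℤ) = j + 1 + (suppRight c).card) :
    (cochainPiece I t c).map (toChain hI h) = ⊤ := by
  rw [← LinearMap.range_domRestrict, LinearMap.range_eq_top]
  exact (bijective_toChain hI h1 h2 h).2

lemma coboundary_comp_coboundary (hI : IsSquarefreeMonomialIdeal I) {c : Bidegree m n}
    (h1 : ∀ k, 0 ≤ c.1 k) (h2 : ∀ j, c.2 j ≤ 0) {t : ℕ} {i j k : ℤ}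
    (h : (t : ℤ) = k + 1 + (suppRight c).card) (hkj : k + 1 = j) (hji : j + 1 = i) :
    coboundary K (linkRight I c) i j hji ∘ₗ coboundary K (linkRight I c) j k hkj = 0 := by
  ext1 g
  obtain ⟨z, hz, rfl⟩ : g ∈ (cochainPiece I t c).map (toChain hI h) :=
    map_toChain hI h1 h2 h ▸ Submodule.mem_top
  have h' : ((t + 1 : ℕ) : ℤ) = j + 1 + (suppRight c).card := by push_cast; omega
  have h'' : ((t + 1 + 1 : ℕ) : ℤ) = i + 1 + (suppRight c).card := by push_cast; omega
  rw [LinearMap.comp_apply, ← toChain_cechD hI h1 h2 h h' hkj hz,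
    ← toChain_cechD hI h1 h2 h' h'' hji (cechD_mem_cochainPiece t c hI hz)]
  have : Cech.d (y I) (t + 1) (Cech.d (y I) t z) = 0 :=
    coboundaries_le_cocycles (t + 1) ⟨z, rfl⟩
  rw [this, map_zero]
  rfl

lemma finrank_cocycles_inf (hI : IsSquarefreeMonomialIdeal I) {c : Bidegree m n}
    (h1 : ∀ k, 0 ≤ c.1 k) (h2 : ∀ j, c.2 j ≤ 0) {t : ℕ} {j k : ℤ}
    (h : (t : ℤ) = k + 1 + (suppRight c).card)
    (h' : ((t + 1 : ℕ) : ℤ) = j + 1 + (suppRight c).card) (hkj : k + 1 = j) :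
    Module.finrank K ↥((Cech.cocycles (y I) t).restrictScalars K ⊓ cochainPiece I t c) =
      Module.finrank K (LinearMap.ker (coboundary K (linkRight I c) j k hkj)) :=
  finrank_ker_inf_eq (D := (Cech.d (y I) t).restrictScalars K)
    (injOn_toChain hI h1 h2 h) (map_toChain hI h1 h2 h) (injOn_toChain hI h1 h2 h')
    (fun _ hz => cechD_mem_cochainPiece t c hI hz)
    (fun _ hz => toChain_cechD hI h1 h2 h h' hkj hz)

lemma finrank_coboundaries_inf (hI : IsSquarefreeMonomialIdeal I) {c : Bidegree m n}
    (h1 : ∀ k, 0 ≤ c.1 k) (h2 : ∀ j, c.2 j ≤ 0) {t : ℕ} {j k : ℤ}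
    (h : (t : ℤ) = k + 1 + (suppRight c).card)
    (h' : ((t + 1 : ℕ) : ℤ) = j + 1 + (suppRight c).card) (hkj : k + 1 = j) :
    Module.finrank K ↥((Cech.coboundaries (y I) (t + 1)).restrictScalars K ⊓
      cochainPiece I (t + 1) c) =
      Module.finrank K (LinearMap.range (boundary K (linkRight I c) j k hkj)) := by
  rw [coboundaries_succ_inf hI, ← finrank_range_coboundary]
  exact finrank_map_eq_finrank_range (D := (Cech.d (y I) t).restrictScalars K)
    (map_toChain hI h1 h2 h) (injOn_toChain hI h1 h2 h')
    (fun _ hz => cechD_mem_cochainPiece t c hI hz)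
    (fun _ hz => toChain_cechD hI h1 h2 h h' hkj hz)

/-- The component of the Čech cohomology in a bidegree `c = (a, b)` with `a ≥ 0` and `b ≤ 0` has the
dimension of the reduced homology of `linkRight I c`. -/
lemma finrank_cechPiece (hI : IsSquarefreeMonomialIdeal I) {c : Bidegree m n}
    (h1 : ∀ k, 0 ≤ c.1 k) (h2 : ∀ j, c.2 j ≤ 0) (t : ℕ) :
    Module.finrank K (cechPiece I t c) = Module.finrank K
      (ReducedHomology K (linkRight I c) ((t : ℤ) - (suppRight c).card - 1)) := by
  obtain ⟨j, hj⟩ : ∃ j : ℤ, j = (t : ℤ) - (suppRight c).card - 1 := ⟨_, rfl⟩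
  rw [← hj]
  have h : (t : ℤ) = j + 1 + (suppRight c).card := by omega
  clear hj
  have h' : ((t + 1 : ℕ) : ℤ) = j + 1 + 1 + (suppRight c).card := by push_cast; omega
  have e1 := (finrank_subPiece (K := K) (cochainPiece I t c) (coboundaries_le_cocycles t)).2
  rw [← cechPiece_eq] at e1
  have e2 := finrank_cocycles_inf hI h1 h2 h h' rfl
  have e3 := LinearMap.finrank_range_add_finrank_ker (coboundary K (linkRight I c) (j + 1) j rfl)
  rw [finrank_range_coboundary] at e3
  have e4 := finrank_cycles_add K (linkRight I c) j
  -- in degree zero there are no coboundaries, and no faces of dimension `j - 1` as `j < 0`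
  have e5 : Module.finrank K ↥((Cech.coboundaries (y I) t).restrictScalars K ⊓ cochainPiece I t c) =
      Module.finrank K (LinearMap.range
        (boundary K (linkRight I c) j (j - 1) (sub_add_cancel j 1))) ∧
      boundaries K (linkRight I c) j ≤ cycles K (linkRight I c) j := by
    cases t with
    | zero =>
      have hempty : IsEmpty (Face (linkRight I c) (j - 1)) := ⟨fun B => by
        have := B.2.2
        push_cast at h
        omega⟩
      constructor
      · have hbot : (Cech.coboundaries (y I) 0).restrictScalars K ⊓ cochainPiece I 0 c = ⊥ :=
          bot_inf_eq _
        rw [hbot, finrank_bot, Module.finrank_zero_of_subsingleton]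
      · intro x _
        exact Subsingleton.elim _ _
    | succ t =>
      have h0 : (t : ℤ) = j - 1 + 1 + (suppRight c).card := by push_cast at h; omega
      constructor
      · exact finrank_coboundaries_inf hI h1 h2 h0 h (sub_add_cancel j 1)
      · rintro _ ⟨x, rfl⟩
        exact LinearMap.congr_fun (boundary_comp_eq_zero K (linkRight I c) (sub_add_cancel j 1) rfl
          (coboundary_comp_coboundary hI h1 h2 h0 (sub_add_cancel j 1) rfl)) x
  have e6 := finrank_reducedHomology K (linkRight I c) j e5.2
  rw [e5.1] at e1
  have key : ∀ {p r z k r' N q H : ℕ}, p + r = z → z = k → r' + k = N → q + r = N → H + r' = q →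
      p = H := by omega
  exact key e1 e2 e3 e4 e6

end StanleyReisner
end

/-! ### Vanishing of components -/

noncomputable section
open CategoryTheory

namespace StanleyReisner

variable {K : Type u} [Field K] {m n : ℕ} {I : Ideal (PolyRing K m n)}

lemma cechPiece_eq_bot_iff (t : ℕ) (c : Bidegree m n) : cechPiece I t c = ⊥ ↔
    ∀ z ∈ cochainPiece I t c, Cech.d (y I) t z = 0 → z ∈ Cech.coboundaries (y I) t := by
  rw [cechPiece_eq, eq_bot_iff]
  constructor
  · intro h z hz hd
    exact mk_eq_zero_submoduleOf.1 (h (mem_subPiece.2 ⟨⟨z, hd⟩, hz, rfl⟩))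
  · intro h x hx
    obtain ⟨z, hz, rfl⟩ := mem_subPiece.1 hx
    exact mk_eq_zero_submoduleOf.2 (h z.1 hz z.2)

lemma cechPiece_eq_bot_of_neg {c : Bidegree m n} {k : Fin m} (hk : c.1 k < 0) (t : ℕ) :
    cechPiece I t c = ⊥ := by
  rw [cechPiece_eq_bot_iff]
  intro z hz _
  have h0 : z = 0 := funext fun T => by
    refine eq_zero_of_mem_locPiece (fun h => ?_) (hz T (Set.mem_univ T))
    exact hk.not_ge (h.1 (Sum.inl k) inl_notMem_vert)
  rw [h0]
  exact zero_mem _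

lemma nat_mem_locPiece {T T' : Finset (Fin n)} (h : T ⊆ T') {c : Bidegree m n}
    {z : Cech.Loc (y I) T} (hz : z ∈ locPiece I T c) : Cech.nat (y I) h z ∈ locPiece I T' c := by
  rw [locPiece_eq_span] at hz ⊢
  obtain ⟨k, rfl⟩ := Submodule.mem_span_singleton.1 hz
  have hsmul : Cech.nat (y I) h (k • mon I T c) = k • Cech.nat (y I) h (mon I T c) :=
    map_smul ((Cech.nat (y I) h).restrictScalars K) k _
  rw [hsmul]
  by_cases hT : ∀ v ∉ vert m T, 0 ≤ coord c v
  · rw [nat_mon h hT]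
    exact Submodule.mem_span_singleton.2 ⟨k, rfl⟩
  · rw [mon_eq_zero (fun h => hT h.1), map_zero, smul_zero]
    exact zero_mem _

/-- The transition maps between the components of bidegree `c`. -/
def natPiece (c : Bidegree m n) {T T' : Finset (Fin n)} (h : T ⊆ T') :
    locPiece I T c →ₗ[K] locPiece I T' c :=
  (((Cech.nat (y I) h).toLinearMap.restrictScalars K).domRestrict (locPiece I T c)).codRestrict
    (locPiece I T' c) fun z => nat_mem_locPiece h z.2

/-- The system of the components of bidegree `c` of the localizations. -/
def pieceSystem (I : Ideal (PolyRing K m n)) (c : Bidegree m n) :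
    Finset (Fin n) ⥤ ModuleCat.{u} K where
  obj T := ModuleCat.of K (locPiece I T c)
  map f := ModuleCat.ofHom (natPiece c (leOfHom f))
  map_id _ := ModuleCat.hom_ext (LinearMap.ext fun z =>
    Subtype.ext (CechSystem.nat_refl (y I) subset_rfl z.1))
  map_comp f g := ModuleCat.hom_ext (LinearMap.ext fun z =>
    Subtype.ext (CechSystem.nat_nat (y I) (leOfHom f) (leOfHom g) z.1).symm)

lemma adm_insert_iff {c : Bidegree m n} {j : Fin n} (hj : 0 < c.2 j) (T : Finset (Fin n)) :
    Adm I (insert j T) c ↔ Adm I T c := by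
  have h1 : Sum.inr j ∈ supp c := mem_supp.2 hj.ne'
  have h2 : supp c ∪ vert m (insert j T) = supp c ∪ vert m T := by
    rw [vert, Finset.map_insert, Finset.union_insert, Finset.insert_eq_of_mem]
    exact Finset.mem_union_left _ h1
  rw [Adm, Adm, h2]
  refine and_congr_left fun _ => ⟨fun h v hv => ?_, fun h v hv => h v fun hv' => hv ?_⟩
  · by_cases hvj : v = Sum.inr j
    · rw [hvj]
      exact hj.le
    · refine h v fun hv' => ?_
      rw [vert, Finset.map_insert, Finset.mem_insert] at hv'
      exact hv'.elim hvj hv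
  · exact Finset.map_subset_map.2 (Finset.subset_insert j T) hv'

lemma bijective_natPiece (hI : IsSquarefreeMonomialIdeal I) {c : Bidegree m n} {j : Fin n}
    (hj : 0 < c.2 j) (T : Finset (Fin n)) :
    Function.Bijective (natPiece (I := I) c (Finset.subset_insert j T)) := by
  by_cases hT : Adm I T c
  · have hT' := (adm_insert_iff hj T).2 hT
    constructor
    · rw [injective_iff_map_eq_zero]
      intro z hz
      have h0 : Cech.nat (y I) (Finset.subset_insert j T) z.1 = 0 := congrArg Subtype.val hz
      have h1 := coeffLoc_nat hI (Finset.subset_insert j T) hT hT' z.2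
      rw [h0, map_zero] at h1
      refine Subtype.ext ?_
      rw [← coeffLoc_smul_mon hI z.2, ← h1, zero_smul]
      rfl
    · rintro ⟨z, hz⟩
      have hz' := hz
      rw [locPiece_eq_span] at hz'
      obtain ⟨k, rfl⟩ := Submodule.mem_span_singleton.1 hz'
      refine ⟨⟨k • mon I T c, ?_⟩, Subtype.ext ?_⟩
      · rw [locPiece_eq_span]
        exact Submodule.mem_span_singleton.2 ⟨k, rfl⟩
      · refine (map_smul
          ((Cech.nat (y I) (Finset.subset_insert j T)).restrictScalars K) k _).trans ?_
        exact congrArg (k • ·) (nat_mon (Finset.subset_insert j T) hT.1)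
  · have hT' := (adm_insert_iff hj T).not.2 hT
    constructor
    · intro z z' _
      exact Subtype.ext ((eq_zero_of_mem_locPiece hT z.2).trans
        (eq_zero_of_mem_locPiece hT z'.2).symm)
    · intro z
      exact ⟨0, Subtype.ext (by rw [map_zero]; exact (eq_zero_of_mem_locPiece hT' z.2).symm)⟩

/-- If a `Y`-coordinate `j` of `c` is positive, then the component of bidegree `c` of the Čech
complex is acyclic, as inserting `j` into the index sets gives isomorphisms. -/
lemma cechPiece_eq_bot_of_pos (hI : IsSquarefreeMonomialIdeal I) {c : Bidegree m n} {j : Fin n}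
    (hj : 0 < c.2 j) (t : ℕ) : cechPiece I t c = ⊥ := by
  rw [cechPiece_eq_bot_iff]
  intro z hz hd
  let A := pieceSystem I c
  have hA : ∀ T, Function.Bijective (CechSystem.res A (Finset.subset_insert j T)) :=
    bijective_natPiece hI hj
  -- the cochains of the system are the cochains of bidegree `c`
  let incl : ∀ s, CechSystem.Cochain A s → Cech.Cochain (y I) s := fun s w T => (w T).1
  have hincl : ∀ s w, incl (s + 1) (CechSystem.d A s w) = Cech.d (y I) s (incl s w) := by
    intro s w
    funext T
    rw [cechD_apply]
    change (locPiece I T.1 c).subtype (CechSystem.d A s w T) = _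
    rw [CechSystem.d_apply]
    refine (map_sum _ _ _).trans ?_
    rfl
  let w : CechSystem.Cochain A t := fun T => ⟨z T, hz T (Set.mem_univ T)⟩
  have hw : CechSystem.d A t w = 0 := by
    funext T
    refine Subtype.ext ?_
    change incl (t + 1) (CechSystem.d A t w) T = 0
    rw [hincl]
    exact congrFun hd T
  cases t with
  | zero =>
    have h0 := CechSystem.eq_zero_of_bijective j hA w hw
    have : z = 0 := funext fun T => congrArg Subtype.val (congrFun h0 T)
    rw [this]
    exact zero_mem _
  | succ t =>
    obtain ⟨w', hw'⟩ := CechSystem.exists_d_eq_of_bijective j hA w hw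
    exact ⟨incl t w', by rw [← hincl, hw']⟩

end StanleyReisner
end

/-! ### Power series -/

noncomputable section

lemma MvPowerSeries.coeff_mul_X_apply {σ R : Type*} [CommSemiring R] (v : σ) (f : MvPowerSeries σ R)
    (e : σ →₀ ℕ) : MvPowerSeries.coeff e (f * MvPowerSeries.X v) =
      if e v = 0 then 0 else MvPowerSeries.coeff (e - Finsupp.single v 1) f := by
  classical
  rw [MvPowerSeries.X, MvPowerSeries.coeff_mul_monomial]
  have : Finsupp.single v 1 ≤ e ↔ ¬ e v = 0 := by
    rw [Finsupp.single_le_iff]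
    omega
  simp only [this, ite_not, mul_one]

/-- The product of the series `X v / (1 - X v) = ∑_{d > 0} X v ^ d` over a set of variables is the
sum of the monomials whose support is that set. -/
lemma MvPowerSeries.coeff_prod_X_mul_inv {σ k : Type*} [DecidableEq σ] [Field k] (A : Finset σ)
    (e : σ →₀ ℕ) : MvPowerSeries.coeff e
      (∏ v ∈ A, (MvPowerSeries.X v * (1 - MvPowerSeries.X v)⁻¹ : MvPowerSeries σ k)) =
      if e.support = A then 1 else 0 := by
  let s : Finset σ → MvPowerSeries σ k := fun A e => if e.support = A then 1 else 0
  have hs : ∀ A e, MvPowerSeries.coeff e (s A) = if e.support = A then 1 else 0 := fun _ _ => rfl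
  suffices h : ∏ v ∈ A, (MvPowerSeries.X v * (1 - MvPowerSeries.X v)⁻¹ : MvPowerSeries σ k) = s A by
    rw [h, hs]
  induction A using Finset.induction_on with
  | empty =>
    ext e
    rw [hs, Finset.prod_empty, MvPowerSeries.coeff_one]
    simp only [Finsupp.support_eq_empty]
  | insert v A hv ih =>
    rw [Finset.prod_insert hv, ih, mul_right_comm, eq_comm, MvPowerSeries.eq_mul_inv_iff_mul_eq]
    · ext e
      rw [mul_sub, mul_one, map_sub, MvPowerSeries.coeff_mul_X_apply, mul_comm (MvPowerSeries.X v),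
        MvPowerSeries.coeff_mul_X_apply, hs, hs, hs]
      by_cases h0 : e v = 0
      · have h1 : e.support ≠ insert v A := fun h => by
          have : v ∈ e.support := h ▸ Finset.mem_insert_self v A
          exact Finsupp.mem_support_iff.1 this h0
        rw [if_pos h0, if_pos h0, if_neg h1, sub_zero]
      rw [if_neg h0, if_neg h0]
      have hve : v ∈ e.support := Finsupp.mem_support_iff.2 h0
      by_cases h1 : e v = 1
      · have h2 : (e - Finsupp.single v 1).support = e.support.erase v := by
          ext w
          by_cases hw : w = v
          · simp [hw, h1]
          · simp [hw]
        have h3 : e.support = insert v A ↔ e.support.erase v = A := by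
          constructor
          · intro h
            rw [h, Finset.erase_insert hv]
          · rintro rfl
            rw [Finset.insert_erase hve]
        have h4 : e.support.erase v ≠ insert v A := fun h =>
          Finset.notMem_erase v e.support (h ▸ Finset.mem_insert_self v A)
        rw [h2, if_neg h4, sub_zero]
        simp only [h3]
      · have h2 : (e - Finsupp.single v 1).support = e.support := by
          ext w
          by_cases hw : w = v
          · simp only [hw, Finsupp.mem_support_iff, Finsupp.tsub_apply, Finsupp.single_eq_same]
            omega
          · simp [Ne.symm hw]
        have h3 : e.support ≠ A := fun h => hv (h ▸ hve)
        rw [h2, sub_self, if_neg h3]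
    · simp

lemma DirectSum.IsInternal.map_linearEquiv {ι R M N : Type*} [DecidableEq ι] [Ring R]
    [AddCommGroup M] [Module R M] [AddCommGroup N] [Module R N] {H : ι → Submodule R M}
    (h : DirectSum.IsInternal H) (e : M ≃ₗ[R] N) :
    DirectSum.IsInternal fun c => (H c).map e.toLinearMap := by
  rw [DirectSum.isInternal_submodule_iff_iSupIndep_and_iSup_eq_top] at h ⊢
  refine ⟨(iSupIndep_map_orderIso_iff (Submodule.orderIsoMapComap e)).2 h.1, ?_⟩
  rw [← Submodule.map_iSup, h.2, Submodule.map_top, LinearMap.range_eq_top]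
  exact e.surjective

lemma SimplicialCpx.mem_faces {W : Type*} [Fintype W] {Γ : LowerSet (Finset W)} {B : Finset W} :
    B ∈ SimplicialCpx.faces Γ ↔ B ∈ Γ := by
  simp [SimplicialCpx.faces]

/-! ### Hilbert series of the local cohomology -/

namespace StanleyReisner
open SimplicialCpx

variable {K : Type u} [Field K] {m n : ℕ} {I : Ideal (PolyRing K m n)}

section Transport

variable {i : ℕ} (φ : LocalCohomology I i ≃ₗ[Quot I] Cech.Cohomology (y I) i)

/-- The isomorphism, as an isomorphism of vector spaces. -/
def restrictEquiv : LocalCohomology I i ≃ₗ[K] Cech.Cohomology (y I) i :=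
  { φ.toLinearMap.restrictScalars K, φ.toEquiv with }

lemma piece_eq_map (c : Bidegree m n) :
    piece I φ c = (cechPiece I i c).map (restrictEquiv φ).symm.toLinearMap :=
  (Submodule.map_equiv_eq_comap_symm (restrictEquiv φ).symm (cechPiece I i c)).symm

/-- The transported component is isomorphic to the component of the Čech cohomology. -/
def pieceEquiv (c : Bidegree m n) : cechPiece I i c ≃ₗ[K] piece I φ c :=
  ((restrictEquiv φ).symm.submoduleMap (cechPiece I i c)).trans
    (LinearEquiv.ofEq _ _ (piece_eq_map φ c).symm)

lemma isInternal_piece (hI : IsSquarefreeMonomialIdeal I) : DirectSum.IsInternal (piece I φ) := by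
  rw [show piece I φ = fun c => (cechPiece I i c).map (restrictEquiv φ).symm.toLinearMap from
    funext fun c => piece_eq_map φ c]
  exact (isInternal_cechPiece hI i).map_linearEquiv (restrictEquiv φ).symm

end Transport

/-- The bidegree that corresponds to an exponent of the Hilbert series. -/
def signedBideg (e : (Fin m ⊕ Fin n) →₀ ℕ) : Bidegree m n :=
  (fun i => (e (Sum.inl i) : ℤ), fun j => -(e (Sum.inr j) : ℤ))

lemma supp_signedBideg (e : (Fin m ⊕ Fin n) →₀ ℕ) : supp (signedBideg e) = e.support := by
  ext v
  cases v <;> simp [mem_supp, signedBideg, coord]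

/-- If `F` is not a face, then the link is void and its homology vanishes. -/
lemma finrank_reducedHomology_eq_zero {F : Finset (Fin n)} (hF : F ∉ restrictRight (complex I))
    (G : Finset (Fin m)) (j : ℤ) : Module.finrank K (ReducedHomology K
      (restrictRight (link (complex I) (G.disjSum F))) j) = 0 := by
  have h : IsEmpty (Face (restrictRight (link (complex I) (G.disjSum F))) j) := by
    refine ⟨fun B => hF ?_⟩
    refine (complex I).lower (fun v hv => ?_) B.2.1.2
    obtain ⟨w, hw, rfl⟩ := Finset.mem_map.1 hv
    exact Finset.mem_union_left _ (Finset.inr_mem_disjSum.2 hw)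
  exact Module.finrank_zero_of_subsingleton

end StanleyReisner

end

theorem mainTheorem3 {K : Type u} [Field K] {m n : ℕ}
    (I : Ideal (StanleyReisner.PolyRing K m n))
    (hI : StanleyReisner.IsSquarefreeMonomialIdeal I) (i : ℕ) :
    -- the local cohomology is that of the Čech complex, from which it gets its bigrading
    ∃ φ : StanleyReisner.LocalCohomology I i ≃ₗ[StanleyReisner.Quot I]
        Cech.Cohomology (StanleyReisner.y I) i,
      -- the components are a direct sum decomposition, they have finite dimension, and they
      -- vanish outside the bidegrees `(a, b)` with `a ≥ 0` and `b ≤ 0`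
      DirectSum.IsInternal (StanleyReisner.piece I φ) ∧
      (∀ c, Module.Finite K (StanleyReisner.piece I φ c)) ∧
      (∀ c, StanleyReisner.piece I φ c ≠ ⊥ → (∀ k, 0 ≤ c.1 k) ∧ ∀ j, c.2 j ≤ 0) ∧
      StanleyReisner.hilbertSeries (StanleyReisner.piece I φ) =
        ∑ F ∈ SimplicialCpx.faces (SimplicialCpx.restrictRight (StanleyReisner.complex I)),
          ∑ G : Finset (Fin m),
            (Module.finrank K (SimplicialCpx.ReducedHomology K
              (SimplicialCpx.restrictRight
                (SimplicialCpx.link (StanleyReisner.complex I) (G.disjSum F)))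
              ((i : ℤ) - (F.card : ℤ) - 1)) : MvPowerSeries (Fin m ⊕ Fin n) ℚ) *
            (∏ k ∈ G, MvPowerSeries.X (Sum.inl k) * (1 - MvPowerSeries.X (Sum.inl k))⁻¹) *
            (∏ j ∈ F, MvPowerSeries.X (Sum.inr j) * (1 - MvPowerSeries.X (Sum.inr j))⁻¹) := by
  open StanleyReisner SimplicialCpx in
  obtain ⟨φ⟩ : Nonempty (LocalCohomology I i ≃ₗ[StanleyReisner.Quot I] Cech.Cohomology (y I) i) :=
    nonempty_localCohomology_equiv_cech (y I) i
  refine ⟨φ, isInternal_piece φ hI, fun c => ?_, fun c hc => ?_, ?_⟩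
  · have : Module.Finite K (cechPiece I i c) :=
      (finrank_subPiece (K := K) (cochainPiece I i c) (coboundaries_le_cocycles i)).1
    exact Module.Finite.equiv (pieceEquiv φ c)
  · have hne : cechPiece I i c ≠ ⊥ := fun h => hc (by rw [piece_eq_map, h, Submodule.map_bot])
    exact ⟨fun k => not_lt.1 fun hk => hne (cechPiece_eq_bot_of_neg hk i),
      fun j => not_lt.1 fun hj => hne (cechPiece_eq_bot_of_pos hI hj i)⟩
  · ext e
    -- the left-hand side is the dimension of the homology of one link
    have hleft : MvPowerSeries.coeff e (hilbertSeries (piece I φ)) =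
        (Module.finrank K (ReducedHomology K (linkRight I (signedBideg e))
          ((i : ℤ) - (suppRight (signedBideg e)).card - 1)) : ℚ) := by
      rw [← finrank_cechPiece hI (c := signedBideg e) (fun k => Int.natCast_nonneg _)
        (fun j => neg_nonpos.2 (Int.natCast_nonneg _)) i]
      exact congrArg Nat.cast (pieceEquiv φ (signedBideg e)).finrank_eq.symm
    -- the summand of `F` and `G` contributes only if `F` and `G` are the supports of `e`
    have hterm : ∀ (F : Finset (Fin n)) (G : Finset (Fin m)) (d : ℕ), MvPowerSeries.coeff e
        ((d : MvPowerSeries (Fin m ⊕ Fin n) ℚ) *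
          (∏ k ∈ G, MvPowerSeries.X (Sum.inl k) * (1 - MvPowerSeries.X (Sum.inl k))⁻¹) *
          (∏ j ∈ F, MvPowerSeries.X (Sum.inr j) * (1 - MvPowerSeries.X (Sum.inr j))⁻¹)) =
        if F = suppRight (signedBideg e) then
          if G = suppLeft (signedBideg e) then (d : ℚ) else 0 else 0 := by
      intro F G d
      rw [mul_assoc, ← Finset.prod_disjSum (s := G) (t := F) (f := fun v =>
        (MvPowerSeries.X v * (1 - MvPowerSeries.X v)⁻¹ : MvPowerSeries (Fin m ⊕ Fin n) ℚ)),
        ← map_natCast (MvPowerSeries.C (σ := Fin m ⊕ Fin n) (R := ℚ)), MvPowerSeries.coeff_C_mul,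
        MvPowerSeries.coeff_prod_X_mul_inv, ← supp_signedBideg, supp_eq_disjSum, ← ite_and]
      have h1 : (suppLeft (signedBideg e)).disjSum (suppRight (signedBideg e)) = G.disjSum F ↔
          F = suppRight (signedBideg e) ∧ G = suppLeft (signedBideg e) := by
        constructor
        · intro h
          constructor
          · ext j
            rw [← Finset.inr_mem_disjSum (s := G), ← h, Finset.inr_mem_disjSum]
          · ext k
            rw [← Finset.inl_mem_disjSum (t := F), ← h, Finset.inl_mem_disjSum]
        · rintro ⟨rfl, rfl⟩
          rfl
      simp only [h1, mul_ite, mul_one, mul_zero]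
    rw [hleft, map_sum]
    simp only [map_sum, hterm, Finset.sum_ite_irrel, Finset.sum_ite_eq', Finset.sum_const_zero,
      Finset.mem_univ, if_true]
    by_cases hF : suppRight (signedBideg e) ∈ restrictRight (complex I)
    · rw [if_pos (mem_faces.2 hF)]
      rfl
    · rw [if_neg fun h => hF (mem_faces.1 h)]
      exact congrArg Nat.cast (finrank_reducedHomology_eq_zero hF _ _)
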